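/- Let $N\ge 1$. Let $V:\mathbb R^N\to\mathbb R$ be continuous and bounded below with $\inf_{\mathbb R^N} V>-1$, and let $\Lambda\subset\mathbb R^N$ be a nonempty bounded open set with $\inf_{\Lambda}V<\min_{\partial\Lambda}V$. Let $0<\delta<e^{-3/2}$ and put $$F_1(s)=\begin{cases}0,& s=0,\\ -\tfrac12 s^2\log s^2,&0<|s|<\delta,\\ -\tfrac12s^2(\log\delta^2+3)+2\delta|s|-\tfrac{\delta^2}{2},&|s|\ge\delta,\end{cases}\qquad F_2(s)=\begin{cases}0,&|s|<\delta,\\ \tfrac12s^2\log(s^2/\delta^2)+2\delta|s|-\tfrac32s^2-\tfrac{\delta^2}{2},&|s|\ge\delta.\end{cases}$$ Let $b_0>0$ with $2b_0<\inf V+1$, let $a_0>\delta$ with $F_2'(a_0)/a_0=b_0$, and put $\overline F_2'(s)=F_2'(s)$ for $0\le s\le a_0$, $\overline F_2'(s)=b_0s$ for $s\ge a_0$. Let $0<t_1<a_0<t_2$ and let $h\in C^1([t_1,t_2])$ satisfy $h\le\overline F_2'$ on $[t_1,t_2]$, $h(t_i)=\overline F_2'(t_i)$ and $h'(t_i)=\overline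 F_2''(t_i)$ for $i=1,2$, with $h(t)/t$ nondecreasing. Let $\tilde F_2'=h$ on $[t_1,t_2]$ and $\tilde F_2'=\overline F_2'$ elsewhere on $[0,\infty)$; let $$g_2(x,t)=\chi_\Lambda(x)F_2'(t)+(1-\chi_\Lambda(x))\tilde F_2'(t)\quad(t\ge0),$$ extended to be odd in $t$, and $G_2(x,t)=\int_0^tg_2(x,s)\,ds$. For $\varepsilon>0$ let $X_\varepsilon$ be the space of all $u\in H^1(\mathbb R^N)\cap L^{F_1}(\mathbb R^N)$ with $\int V(\varepsilon x)|u|^2<\infty$, where $L^{F_1}(\mathbb R^N)$ is the Orlicz space of $F_1$ with its Luxemburg norm $\|\cdot\|_{F_1}$, and give $X_\varepsilon$ the norm $$\|u\|_\varepsilon=\Big(\int_{\mathbb R^N}|\nabla u|^2+(V(\varepsilon x)+1)|u|^2\Big)^{1/2}+\|u\|_{F_1}.$$ On $X_\varepsilon$ let $$J_\varepsilon(u)=\tfrac12\int_{\mathbb R^N}\big(|\nabla u|^2+(V(\varepsilon x)+1)|u|^2\big)+\int_{\mathbb R^N}F_1(u)-\int_{\mathbb R^N}G_2(\varepsilon x,u),$$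 $$\Psi_\varepsilon(u)=J_\varepsilon(u)-\tfrac12\int_{\mathbb R^N}|u|^2-\int_{\mathbb R^N}\Big[F_2(u)-\tfrac12F_2'(u)u+\tfrac12g_2(\varepsilon x,u)u-G_2(\varepsilon x,u)\Big],$$ and let $\mathcal N_\varepsilon=\{u\in X_\varepsilon\setminus\{0\}: J_\varepsilon'(u)u=0\}$ be the Nehari set. For $u\in\mathcal N_\varepsilon$ write $\|J_\varepsilon'(u)\|_*=\min_{\lambda\in\mathbb R}\|J_\varepsilon'(u)-\lambda\Psi_\varepsilon'(u)\|$ (dual norm of $X_\varepsilon$); $u\in\mathcal N_\varepsilon$ is called a critical point of $J_\varepsilon$ constrained to $\mathcal N_\varepsilon$ if $\|J_\varepsilon'(u)\|_*=0$. Then for every $\varepsilon>0$ the functionals $J_\varepsilon$ and $\Psi_\varepsilon$ are of class $C^1$ on $X_\varepsilon$, and: 1. $\Psi_\varepsilon'(u)u\neq0$ for every $u\in\mathcal N_\varepsilon$, and $\mathcal N_\varepsilon$ is a $C^1$ submanifold of $X_\varepsilon$ of codimension one (it is locally straightened, by $C^1$ diffeomorphisms between open subsets of $X_\varepsilon$,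 to a closed subspace of codimension one). 2. If $u\in\mathcal N_\varepsilon$ is a critical point of $J_\varepsilon$ constrained to $\mathcal N_\varepsilon$, then $J_\varepsilon'(u)=0$ in the dual of $X_\varepsilon$. 3. $J_\varepsilon|_{\mathcal N_\varepsilon}$ satisfies the Palais–Smale condition: for every $c\in\mathbb R$, each sequence $(u_n)$ in $\mathcal N_\varepsilon$ with $J_\varepsilon(u_n)\to c$ and $\|J_\varepsilon'(u_n)\|_*\to0$ has a subsequence that converges in $X_\varepsilon$ to a point of $\mathcal N_\varepsilon$. -/

import Mathlib

open MeasureTheory Set Filter Topology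
open scoped ContDiff ENNReal InnerProductSpace

noncomputable section

namespace LogNehari

/-! ### The logarithmic nonlinearity `F₂ - F₁ = (1/2) s² log s²` -/

/-- The function `F₁`; recall that `Real.log 0 = 0`, so that `F₁ 0 = 0`. -/
def F1 (δ s : ℝ) : ℝ :=
  if |s| < δ then -(1 / 2) * s ^ 2 * Real.log (s ^ 2)
  else -(1 / 2) * s ^ 2 * (Real.log (δ ^ 2) + 3) + 2 * δ * |s| - δ ^ 2 / 2

/-- The function `F₂`. -/
def F2 (δ s : ℝ) : ℝ :=
  if |s| < δ then 0
  else (1 / 2) * s ^ 2 * Real.log (s ^ 2 / δ ^ 2) + 2 * δ * |s| - (3 / 2) * s ^ 2 - δ ^ 2 / 2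

/-- The function `F₂'` truncated at `a₀`, i.e. continued linearly by `b₀ s` for `s ≥ a₀`
(used for `s ≥ 0`). -/
def F2bar' (δ b₀ a₀ s : ℝ) : ℝ := if s ≤ a₀ then deriv (F2 δ) s else b₀ * s

/-! ### The data of the penalized problem -/

/-- The data of the penalized logarithmic Schrödinger problem in `ℝ^N`, with the conditions
imposed on them. The bound on `δ` makes precise that `δ` is small: it says that `F₁` is convex and
superlinear at infinity. -/
structure PenalizedProblem (N : ℕ) where
  V : EuclideanSpace ℝ (Fin N) → ℝ
  Λ : Set (EuclideanSpace ℝ (Fin N))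
  δ : ℝ
  b₀ : ℝ
  a₀ : ℝ
  t₁ : ℝ
  t₂ : ℝ
  h : ℝ → ℝ
  continuous_V : Continuous V
  bddBelow_V : BddBelow (range V)
  neg_one_lt_iInf_V : -1 < ⨅ x, V x
  isOpen_Λ : IsOpen Λ
  isBounded_Λ : Bornology.IsBounded Λ
  nonempty_Λ : Λ.Nonempty
  sInf_lt_sInf_frontier : sInf (V '' Λ) < sInf (V '' frontier Λ)
  δ_pos : 0 < δ
  δ_small : δ < Real.exp (-(3 / 2))
  b₀_pos : 0 < b₀
  b₀_small : 2 * b₀ < (⨅ x, V x) + 1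
  δ_lt_a₀ : δ < a₀
  a₀_spec : deriv (F2 δ) a₀ / a₀ = b₀
  t₁_pos : 0 < t₁
  t₁_lt_a₀ : t₁ < a₀
  a₀_lt_t₂ : a₀ < t₂
  contDiffOn_h : ContDiffOn ℝ 1 h (Icc t₁ t₂)
  h_le : ∀ t ∈ Icc t₁ t₂, h t ≤ F2bar' δ b₀ a₀ t
  h_t₁ : h t₁ = F2bar' δ b₀ a₀ t₁
  h_t₂ : h t₂ = F2bar' δ b₀ a₀ t₂
  deriv_h_t₁ : derivWithin h (Icc t₁ t₂) t₁ = deriv (F2bar' δ b₀ a₀) t₁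
  deriv_h_t₂ : derivWithin h (Icc t₁ t₂) t₂ = deriv (F2bar' δ b₀ a₀) t₂
  h_div_mono : MonotoneOn (fun t => h t / t) (Icc t₁ t₂)

/-! ### Weak gradients and Orlicz spaces -/

/-- `g` is the weak gradient of `u` on `ℝ^N`: for all test functions `φ` and all directions `v`,
`∫ u ∂_v φ = - ∫ ⟨g, v⟩ φ`. -/
def HasWeakGradient {N : ℕ} (u : EuclideanSpace ℝ (Fin N) → ℝ)
    (g : EuclideanSpace ℝ (Fin N) → EuclideanSpace ℝ (Fin N)) : Prop :=
  ∀ φ : EuclideanSpace ℝ (Fin N) → ℝ, ContDiff ℝ ∞ φ → HasCompactSupport φ →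
    ∀ v : EuclideanSpace ℝ (Fin N),
      ∫ x, u x * fderiv ℝ φ x v = -∫ x, ⟪g x, v⟫_ℝ * φ x

/-- The modular `∫ Φ(|u| / l)`, with values in `[0, ∞]`. -/
def modular {N : ℕ} (Φ : ℝ → ℝ) (u : EuclideanSpace ℝ (Fin N) → ℝ) (l : ℝ) : ℝ≥0∞ :=
  ∫⁻ x, ENNReal.ofReal (Φ (|u x| / l))

/-- Membership in the Orlicz space `L^Φ(ℝ^N)`. -/
def MemOrlicz {N : ℕ} (Φ : ℝ → ℝ) (u : EuclideanSpace ℝ (Fin N) → ℝ) : Prop :=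
  LocallyIntegrable u ∧ ∃ l : ℝ, 0 < l ∧ modular Φ u l < ⊤

/-- The Luxemburg norm of `L^Φ(ℝ^N)`. -/
def luxemburgNorm {N : ℕ} (Φ : ℝ → ℝ) (u : EuclideanSpace ℝ (Fin N) → ℝ) : ℝ :=
  sInf {l : ℝ | 0 < l ∧ modular Φ u l ≤ 1}

section Orlicz

variable {N : ℕ} {Φ : ℝ → ℝ} {u v : EuclideanSpace ℝ (Fin N) → ℝ}

lemma modular_congr (huv : u =ᵐ[volume] v) (l : ℝ) : modular Φ u l = modular Φ v l := by
  apply lintegral_congr_ae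
  filter_upwards [huv] with x hx
  rw [hx]

lemma luxemburgNorm_congr (huv : u =ᵐ[volume] v) : luxemburgNorm Φ u = luxemburgNorm Φ v := by
  simp only [luxemburgNorm, modular_congr huv]

lemma luxemburgNorm_nonneg : 0 ≤ luxemburgNorm Φ u :=
  Real.sInf_nonneg fun _ hl => hl.1.le

lemma convex_scale (hΦ : ConvexOn ℝ (Ici 0) Φ) (h0 : Φ 0 = 0) {t θ : ℝ} (ht : 0 ≤ t)
    (hθ : 0 ≤ θ) (hθ1 : θ ≤ 1) : Φ (θ * t) ≤ θ * Φ t := by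
  have := hΦ.2 (mem_Ici.2 ht) (mem_Ici.2 le_rfl) hθ (sub_nonneg.2 hθ1) (by ring)
  simpa [h0] using this

lemma convex_mono (hΦ : ConvexOn ℝ (Ici 0) Φ) (h0 : Φ 0 = 0) (hpos : ∀ t, 0 ≤ t → 0 ≤ Φ t)
    {s t : ℝ} (hs : 0 ≤ s) (hst : s ≤ t) : Φ s ≤ Φ t := by
  rcases hs.eq_or_lt with rfl | hs'
  · rw [h0]; exact hpos t hst
  · have ht : 0 < t := hs'.trans_le hst
    have h1 := convex_scale hΦ h0 ht.le (θ := s / t) (by positivity) ((div_le_one ht).2 hst)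
    rw [div_mul_cancel₀ _ ht.ne'] at h1
    exact h1.trans (mul_le_of_le_one_left (hpos t ht.le) ((div_le_one ht).2 hst))

lemma modular_add (hm : Measurable Φ) (hΦ : ConvexOn ℝ (Ici 0) Φ) (h0 : Φ 0 = 0)
    (hpos : ∀ t, 0 ≤ t → 0 ≤ Φ t) (hu : AEMeasurable u) {a b : ℝ} (ha : 0 < a) (hb : 0 < b) :
    modular Φ (fun x => u x + v x) (a + b) ≤
      ENNReal.ofReal (a / (a + b)) * modular Φ u a +
        ENNReal.ofReal (b / (a + b)) * modular Φ v b := by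
  have hab : 0 < a + b := by positivity
  unfold modular
  rw [← lintegral_const_mul' _ _ ENNReal.ofReal_ne_top,
    ← lintegral_const_mul' _ _ ENNReal.ofReal_ne_top, ← lintegral_add_left']
  · apply lintegral_mono
    intro x
    simp only
    rw [← ENNReal.ofReal_mul (by positivity), ← ENNReal.ofReal_mul (by positivity),
      ← ENNReal.ofReal_add (mul_nonneg (by positivity) (hpos _ (by positivity)))
        (mul_nonneg (by positivity) (hpos _ (by positivity)))]
    apply ENNReal.ofReal_le_ofReal
    have h1 : |u x + v x| / (a + b) ≤
        (a / (a + b)) * (|u x| / a) + (b / (a + b)) * (|v x| / b) := by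
      have : (a / (a + b)) * (|u x| / a) + (b / (a + b)) * (|v x| / b)
          = (|u x| + |v x|) / (a + b) := by
        field_simp
      rw [this]
      gcongr
      exact abs_add_le _ _
    refine (convex_mono hΦ h0 hpos (by positivity) h1).trans ?_
    have hx : |u x| / a ∈ Ici (0 : ℝ) := mem_Ici.2 (by positivity)
    have hy : |v x| / b ∈ Ici (0 : ℝ) := mem_Ici.2 (by positivity)
    have h2 : 0 ≤ a / (a + b) := by positivity
    have h3 : 0 ≤ b / (a + b) := by positivity
    have := hΦ.2 hx hy h2 h3 (by field_simp)
    simpa using this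
  · refine AEMeasurable.const_mul ?_ _
    exact (hm.comp_aemeasurable (hu.norm.div_const a)).ennreal_ofReal

lemma modular_scale (hΦ : ConvexOn ℝ (Ici 0) Φ) (h0 : Φ 0 = 0)
    {l k : ℝ} (hl : 0 < l) (hk : 1 ≤ k) :
    modular Φ u (l * k) ≤ ENNReal.ofReal (1 / k) * modular Φ u l := by
  have hk0 : 0 < k := by positivity
  unfold modular
  rw [← lintegral_const_mul' _ _ ENNReal.ofReal_ne_top]
  apply lintegral_mono
  intro x
  simp only
  rw [← ENNReal.ofReal_mul (by positivity)]
  apply ENNReal.ofReal_le_ofReal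
  have := convex_scale hΦ h0 (t := |u x| / l) (θ := 1 / k) (by positivity) (by positivity)
    ((div_le_one hk0).2 hk)
  convert this using 2
  field_simp

lemma modular_smul {c l : ℝ} (hc : c ≠ 0) :
    modular Φ (fun x => c * u x) (|c| * l) = modular Φ u l := by
  unfold modular
  congr 1
  ext x
  rw [abs_mul, mul_div_mul_left _ _ (abs_ne_zero.2 hc)]

lemma MemOrlicz.congr (hu : MemOrlicz Φ u) (huv : u =ᵐ[volume] v) : MemOrlicz Φ v :=
  ⟨hu.1.congr huv, by simpa only [modular_congr huv] using hu.2⟩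

lemma MemOrlicz.add (hm : Measurable Φ) (hΦ : ConvexOn ℝ (Ici 0) Φ) (h0 : Φ 0 = 0)
    (hpos : ∀ t, 0 ≤ t → 0 ≤ Φ t) (hu : MemOrlicz Φ u) (hv : MemOrlicz Φ v) :
    MemOrlicz Φ (fun x => u x + v x) := by
  obtain ⟨hu1, a, ha, hua⟩ := hu
  obtain ⟨hv1, b, hb, hvb⟩ := hv
  refine ⟨hu1.add hv1, a + b, by positivity, ?_⟩
  refine (modular_add hm hΦ h0 hpos hu1.aestronglyMeasurable.aemeasurable ha hb).trans_lt ?_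
  exact ENNReal.add_lt_top.2 ⟨ENNReal.mul_lt_top ENNReal.ofReal_lt_top hua,
    ENNReal.mul_lt_top ENNReal.ofReal_lt_top hvb⟩

lemma MemOrlicz.zero (h0 : Φ 0 = 0) :
    MemOrlicz Φ (fun _ : EuclideanSpace ℝ (Fin N) => (0 : ℝ)) :=
  ⟨locallyIntegrable_const 0, 1, one_pos, by simp [modular, h0]⟩

lemma MemOrlicz.smul (h0 : Φ 0 = 0) (hu : MemOrlicz Φ u) (c : ℝ) :
    MemOrlicz Φ (fun x => c * u x) := by
  rcases eq_or_ne c 0 with rfl | hc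
  · simpa using MemOrlicz.zero h0
  · obtain ⟨hu1, a, ha, hua⟩ := hu
    exact ⟨hu1.smul c, |c| * a, by positivity, by rwa [modular_smul hc]⟩

lemma MemOrlicz.exists_le_one (hΦ : ConvexOn ℝ (Ici 0) Φ) (h0 : Φ 0 = 0)
    (hu : MemOrlicz Φ u) : ∃ l : ℝ, 0 < l ∧ modular Φ u l ≤ 1 := by
  obtain ⟨-, l, hl, hfin⟩ := hu
  set k : ℝ := max 1 (modular Φ u l).toReal
  have hk : 1 ≤ k := le_max_left _ _
  have hk0 : 0 < k := one_pos.trans_le hk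
  refine ⟨l * k, mul_pos hl hk0, (modular_scale hΦ h0 hl hk).trans ?_⟩
  rw [← ENNReal.ofReal_toReal hfin.ne, ← ENNReal.ofReal_mul (by positivity),
    ENNReal.ofReal_le_one, one_div, inv_mul_le_iff₀ hk0, mul_one]
  exact le_max_right _ _

lemma luxemburgNorm_add_le (hm : Measurable Φ) (hΦ : ConvexOn ℝ (Ici 0) Φ) (h0 : Φ 0 = 0)
    (hpos : ∀ t, 0 ≤ t → 0 ≤ Φ t) (hu : MemOrlicz Φ u) (hv : MemOrlicz Φ v) :
    luxemburgNorm Φ (fun x => u x + v x) ≤ luxemburgNorm Φ u + luxemburgNorm Φ v := by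
  have bdd : ∀ w : EuclideanSpace ℝ (Fin N) → ℝ,
      BddBelow {l : ℝ | 0 < l ∧ modular Φ w l ≤ 1} := fun w => ⟨0, fun l hl => hl.1.le⟩
  refine le_of_forall_pos_le_add fun η hη => ?_
  obtain ⟨a, ⟨ha, hua⟩, ha'⟩ := Real.lt_sInf_add_pos (hu.exists_le_one hΦ h0) (half_pos hη)
  obtain ⟨b, ⟨hb, hvb⟩, hb'⟩ := Real.lt_sInf_add_pos (hv.exists_le_one hΦ h0) (half_pos hη)
  have h1 : luxemburgNorm Φ (fun x => u x + v x) ≤ a + b := by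
    refine csInf_le (bdd _) ⟨by positivity, ?_⟩
    refine (modular_add hm hΦ h0 hpos hu.1.aestronglyMeasurable.aemeasurable ha hb).trans ?_
    calc ENNReal.ofReal (a / (a + b)) * modular Φ u a + ENNReal.ofReal (b / (a + b)) * modular Φ v b
        ≤ ENNReal.ofReal (a / (a + b)) * 1 + ENNReal.ofReal (b / (a + b)) * 1 := by gcongr
      _ = 1 := by
        rw [mul_one, mul_one, ← ENNReal.ofReal_add (by positivity) (by positivity), ← add_div,
          div_self (by positivity), ENNReal.ofReal_one]
  change a < luxemburgNorm Φ u + η / 2 at ha'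
  change b < luxemburgNorm Φ v + η / 2 at hb'
  linarith

lemma luxemburgNorm_zero (h0 : Φ 0 = 0) :
    luxemburgNorm Φ (fun _ : EuclideanSpace ℝ (Fin N) => (0 : ℝ)) = 0 := by
  have : {l : ℝ | 0 < l ∧ modular Φ (fun _ : EuclideanSpace ℝ (Fin N) => (0 : ℝ)) l ≤ 1}
      = Ioi 0 := by
    ext l; simp [modular, h0]
  rw [luxemburgNorm, this, csInf_Ioi]

lemma luxemburgNorm_smul (h0 : Φ 0 = 0) (c : ℝ) :
    luxemburgNorm Φ (fun x => c * u x) = |c| * luxemburgNorm Φ u := by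
  rcases eq_or_ne c 0 with rfl | hc
  · simpa using luxemburgNorm_zero h0
  · have hc' : 0 < |c| := abs_pos.2 hc
    rw [luxemburgNorm, luxemburgNorm, ← smul_eq_mul, ← Real.sInf_smul_of_nonneg hc'.le]
    congr 1
    ext l
    rw [mem_smul_set]
    constructor
    · rintro ⟨hl, hl1⟩
      refine ⟨l / |c|, ⟨by positivity, ?_⟩, by simp only [smul_eq_mul]; field_simp⟩
      rw [← modular_smul hc, mul_div_cancel₀ _ hc'.ne']
      exact hl1
    · rintro ⟨m, ⟨hm, hm1⟩, rfl⟩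
      exact ⟨by simp only [smul_eq_mul]; positivity, by rwa [smul_eq_mul, modular_smul hc]⟩

end Orlicz

/-! ### The function `F₁` is admissible for an Orlicz space -/

section F1

variable {δ : ℝ}

lemma F1_zero (hδ : 0 < δ) : F1 δ 0 = 0 := by simp [F1, hδ]

lemma measurable_F1 : Measurable (F1 δ) := by
  unfold F1
  refine Measurable.ite (measurableSet_lt measurable_norm measurable_const) ?_ ?_
  · fun_prop
  · have : Measurable fun s : ℝ => |s| := measurable_norm
    fun_prop

lemma log_delta_lt (hδ : 0 < δ) (hδ' : δ < Real.exp (-(3 / 2))) : Real.log δ < -(3 / 2) :=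
  (Real.log_lt_iff_lt_exp hδ).2 hδ'

/-- The derivative of `F₁` on `(0, ∞)`. -/
lemma hasDerivAt_F1 (hδ : 0 < δ) {s : ℝ} (hs : 0 < s) :
    HasDerivAt (F1 δ) (if s < δ then -(2 * Real.log s + 1) * s
      else -(2 * Real.log δ + 3) * s + 2 * δ) s := by
  have hA : ∀ s : ℝ, 0 < s → HasDerivAt (fun s : ℝ => -(s ^ 2 * Real.log s))
      (-(2 * Real.log s + 1) * s) s := by
    intro s hs
    have := ((hasDerivAt_pow 2 s).mul (Real.hasDerivAt_log hs.ne')).neg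
    refine this.congr_deriv ?_
    field_simp
    simp
    ring
  have hB : ∀ s : ℝ, HasDerivAt
      (fun s : ℝ => -(1 / 2) * s ^ 2 * (2 * Real.log δ + 3) + 2 * δ * s - δ ^ 2 / 2)
      (-(2 * Real.log δ + 3) * s + 2 * δ) s := by
    intro s
    have := (((((hasDerivAt_pow 2 s).const_mul (-(1 / 2 : ℝ))).mul_const
      (2 * Real.log δ + 3)).add ((hasDerivAt_id s).const_mul (2 * δ))).sub_const (δ ^ 2 / 2))
    refine this.congr_deriv ?_
    simp
    ring
  have eA : ∀ s : ℝ, 0 < s → s < δ → F1 δ s = -(s ^ 2 * Real.log s) := by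
    intro s hs hsδ
    rw [F1, if_pos (by rwa [abs_of_pos hs]), Real.log_pow]
    push_cast
    ring
  have eB : ∀ s : ℝ, δ ≤ s →
      F1 δ s = -(1 / 2) * s ^ 2 * (2 * Real.log δ + 3) + 2 * δ * s - δ ^ 2 / 2 := by
    intro s hs
    rw [F1, abs_of_pos (hδ.trans_le hs), if_neg (not_lt.2 hs), Real.log_pow]
    push_cast
    ring
  rcases lt_trichotomy s δ with h | h | h
  · rw [if_pos h]
    refine (hA s hs).congr_of_eventuallyEq ?_
    filter_upwards [Ioo_mem_nhds hs h] with t ht using eA t ht.1 ht.2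
  · subst h
    rw [if_neg (lt_irrefl _)]
    have e1 : F1 s s = -(s ^ 2 * Real.log s) := by rw [eB s le_rfl]; ring
    have h1 : HasDerivWithinAt (F1 s) (-(2 * Real.log s + 3) * s + 2 * s) (Iic s) s := by
      have := ((hA s hs).congr_deriv
        (show _ = -(2 * Real.log s + 3) * s + 2 * s by ring)).hasDerivWithinAt (s := Iic s)
      refine this.congr_of_eventuallyEq ?_ e1
      filter_upwards [self_mem_nhdsWithin, mem_nhdsWithin_of_mem_nhds (Ioi_mem_nhds hs)]
        with t ht ht0
      rcases (mem_Iic.1 ht).eq_or_lt with rfl | ht'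
      · exact e1
      · exact eA t ht0 ht'
    have h2 : HasDerivWithinAt (F1 s) (-(2 * Real.log s + 3) * s + 2 * s) (Ici s) s :=
      (hB s).hasDerivWithinAt.congr (fun t ht => eB t ht) (eB s le_rfl)
    have := h1.union h2
    rwa [Iic_union_Ici, hasDerivWithinAt_univ] at this
  · rw [if_neg (not_lt.2 h.le)]
    refine (hB s).congr_of_eventuallyEq ?_
    filter_upwards [Ioi_mem_nhds h] with t ht using eB t (le_of_lt ht)

lemma continuousOn_F1 (hδ : 0 < δ) : ContinuousOn (F1 δ) (Ici 0) := by
  intro s hs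
  rcases (mem_Ici.1 hs).eq_or_lt with rfl | hs'
  · refine ContinuousAt.continuousWithinAt ?_
    have h1 : Continuous fun s : ℝ => -(s * (s * Real.log s)) :=
      (continuous_id.mul Real.continuous_mul_log).neg
    refine h1.continuousAt.congr ?_
    filter_upwards [Ioo_mem_nhds (neg_lt_zero.2 hδ) hδ] with t ht
    rw [F1, if_pos (abs_lt.2 ht), Real.log_pow]
    push_cast
    ring
  · exact (hasDerivAt_F1 hδ hs').continuousAt.continuousWithinAt

lemma convexOn_F1 (hδ : 0 < δ) (hδ' : δ < Real.exp (-(3 / 2))) : ConvexOn ℝ (Ici 0) (F1 δ) := by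
  have hl := log_delta_lt hδ hδ'
  refine MonotoneOn.convexOn_of_deriv (convex_Ici 0) (continuousOn_F1 hδ) ?_ ?_
  · rw [interior_Ici]
    exact fun s hs => (hasDerivAt_F1 hδ hs).differentiableAt.differentiableWithinAt
  · rw [interior_Ici]
    have hA : ∀ s t : ℝ, 0 < s → s ≤ t → t ≤ δ →
        -(2 * Real.log s + 1) * s ≤ -(2 * Real.log t + 1) * t := by
      intro s t hs hst htδ
      have ht : 0 < t := hs.trans_le hst
      have h1 : Real.log t ≤ Real.log δ := Real.log_le_log ht htδ
      have h2 : Real.log t - Real.log s ≤ (t - s) / s := by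
        rw [← Real.log_div ht.ne' hs.ne']
        refine (Real.log_le_sub_one_of_pos (by positivity)).trans_eq ?_
        field_simp
      have h3 : (Real.log t - Real.log s) * s ≤ t - s := by
        rwa [le_div_iff₀ hs] at h2
      nlinarith [mul_nonneg (sub_nonneg.2 hst) (show 0 ≤ -(3 / 2) - Real.log t by linarith)]
    have hB : ∀ s t : ℝ, s ≤ t →
        -(2 * Real.log δ + 3) * s + 2 * δ ≤ -(2 * Real.log δ + 3) * t + 2 * δ := by
      intro s t hst
      nlinarith
    intro s hs t ht hst
    rw [(hasDerivAt_F1 hδ hs).deriv, (hasDerivAt_F1 hδ ht).deriv]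
    split_ifs with h1 h2 h2
    · exact hA s t hs hst h2.le
    · have e1 := hA s δ hs h1.le le_rfl
      have e2 := hB δ t (not_lt.1 h2)
      linarith
    · exact absurd (hst.trans_lt h2) h1
    · exact hB s t hst

lemma F1_nonneg (hδ : 0 < δ) (hδ' : δ < Real.exp (-(3 / 2))) {s : ℝ} (hs : 0 ≤ s) :
    0 ≤ F1 δ s := by
  have hl := log_delta_lt hδ hδ'
  unfold F1
  rw [abs_of_nonneg hs, Real.log_pow, Real.log_pow]
  push_cast
  split_ifs with h
  · rcases hs.eq_or_lt with rfl | hs'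
    · simp
    · have : Real.log s < Real.log δ := Real.log_lt_log hs' h
      nlinarith [mul_nonneg (sq_nonneg s) (show 0 ≤ -Real.log s by linarith)]
  · have h' := not_lt.1 h
    nlinarith [mul_nonneg (sq_nonneg s) (show 0 ≤ -(2 * Real.log δ + 3) by linarith)]

end F1

/-! ### The function space -/

section Gradient

variable {N : ℕ}

lemma HasWeakGradient.congr {u u' : EuclideanSpace ℝ (Fin N) → ℝ}
    {g g' : EuclideanSpace ℝ (Fin N) → EuclideanSpace ℝ (Fin N)} (h : HasWeakGradient u g)
    (hu : u =ᵐ[volume] u') (hg : g =ᵐ[volume] g') : HasWeakGradient u' g' := by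
  intro φ hφ hφc v
  have e1 : ∫ x, u' x * fderiv ℝ φ x v = ∫ x, u x * fderiv ℝ φ x v :=
    integral_congr_ae (by filter_upwards [hu] with x hx; rw [hx])
  have e2 : ∫ x, ⟪g' x, v⟫_ℝ * φ x = ∫ x, ⟪g x, v⟫_ℝ * φ x :=
    integral_congr_ae (by filter_upwards [hg] with x hx; rw [hx])
  rw [e1, e2, h φ hφ hφc v]

lemma integrable_mul_fderiv {u : EuclideanSpace ℝ (Fin N) → ℝ} (hu : LocallyIntegrable u)
    {φ : EuclideanSpace ℝ (Fin N) → ℝ} (hφ : ContDiff ℝ ∞ φ) (hφc : HasCompactSupport φ)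
    (v : EuclideanSpace ℝ (Fin N)) : Integrable fun x => u x * fderiv ℝ φ x v := by
  have h1 : Continuous fun x => fderiv ℝ φ x v :=
    (hφ.continuous_fderiv (by simp)).clm_apply continuous_const
  have h2 : HasCompactSupport fun x => fderiv ℝ φ x v :=
    hφc.fderiv_apply (𝕜 := ℝ) v
  simpa [mul_comm] using hu.integrable_smul_left_of_hasCompactSupport h1 h2

lemma integrable_inner_mul {g : EuclideanSpace ℝ (Fin N) → EuclideanSpace ℝ (Fin N)}
    (hg : LocallyIntegrable g)
    {φ : EuclideanSpace ℝ (Fin N) → ℝ} (hφ : ContDiff ℝ ∞ φ) (hφc : HasCompactSupport φ)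
    (v : EuclideanSpace ℝ (Fin N)) : Integrable fun x => ⟪g x, v⟫_ℝ * φ x := by
  have := (hg.integrable_smul_left_of_hasCompactSupport hφ.continuous hφc).inner_const (𝕜 := ℝ) v
  refine this.congr (ae_of_all _ fun x => ?_)
  simp [inner_smul_left, mul_comm]

lemma HasWeakGradient.add {u u' : EuclideanSpace ℝ (Fin N) → ℝ}
    {g g' : EuclideanSpace ℝ (Fin N) → EuclideanSpace ℝ (Fin N)}
    (h : HasWeakGradient u g) (h' : HasWeakGradient u' g')
    (hu : LocallyIntegrable u) (hu' : LocallyIntegrable u')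
    (hg : LocallyIntegrable g) (hg' : LocallyIntegrable g') :
    HasWeakGradient (fun x => u x + u' x) (fun x => g x + g' x) := by
  intro φ hφ hφc v
  simp only [add_mul, inner_add_left]
  rw [integral_add (integrable_mul_fderiv hu hφ hφc v) (integrable_mul_fderiv hu' hφ hφc v),
    integral_add (integrable_inner_mul hg hφ hφc v) (integrable_inner_mul hg' hφ hφc v),
    h φ hφ hφc v, h' φ hφ hφc v]
  ring

lemma HasWeakGradient.smul {u : EuclideanSpace ℝ (Fin N) → ℝ}
    {g : EuclideanSpace ℝ (Fin N) → EuclideanSpace ℝ (Fin N)}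
    (h : HasWeakGradient u g) (c : ℝ) :
    HasWeakGradient (fun x => c * u x) (fun x => c • g x) := by
  intro φ hφ hφc v
  simp only [inner_smul_left, mul_assoc, integral_const_mul]
  rw [h φ hφ hφc v]
  simp

lemma HasWeakGradient.unique {u : EuclideanSpace ℝ (Fin N) → ℝ}
    {g g' : EuclideanSpace ℝ (Fin N) → EuclideanSpace ℝ (Fin N)}
    (h : HasWeakGradient u g) (h' : HasWeakGradient u g')
    (hg : LocallyIntegrable g) (hg' : LocallyIntegrable g') : g =ᵐ[volume] g' := by
  refine ae_eq_of_integral_contDiff_smul_eq hg hg' fun φ hφ hφc => ?_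
  have i1 := hg.integrable_smul_left_of_hasCompactSupport hφ.continuous hφc
  have i2 := hg'.integrable_smul_left_of_hasCompactSupport hφ.continuous hφc
  refine ext_inner_left ℝ fun v => ?_
  rw [← integral_inner i1, ← integral_inner i2]
  have := (h φ hφ hφc v).symm.trans (h' φ hφ hφc v)
  simpa [inner_smul_right, real_inner_comm, mul_comm] using neg_injective this

end Gradient

namespace PenalizedProblem

variable {N : ℕ} (D : PenalizedProblem N) (ε : ℝ)

/-- The space `X_ε = H_ε ∩ L^{F₁}(ℝ^N)`, where `H_ε` consists of all `u ∈ H¹(ℝ^N)` such that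
`∫ V(εx) |u|² < ∞`, as a linear subspace of `L²(ℝ^N)`. -/
def energySubmodule : Submodule ℝ (Lp ℝ 2 (volume : Measure (EuclideanSpace ℝ (Fin N)))) where
  carrier := {u | (∃ g : Lp (EuclideanSpace ℝ (Fin N)) 2
        (volume : Measure (EuclideanSpace ℝ (Fin N))), HasWeakGradient u g) ∧
      Integrable (fun x => D.V (ε • x) * (u x) ^ 2) ∧ MemOrlicz (F1 D.δ) u}
  zero_mem' := by
    have h0 := Lp.coeFn_zero ℝ 2 (volume : Measure (EuclideanSpace ℝ (Fin N)))
    refine ⟨⟨0, ?_⟩, ?_, ?_⟩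
    · have : HasWeakGradient (0 : EuclideanSpace ℝ (Fin N) → ℝ) 0 := by
        intro φ _ _ v; simp
      exact this.congr h0.symm (Lp.coeFn_zero _ 2 _).symm
    · refine (integrable_zero _ ℝ _).congr ?_
      filter_upwards [h0] with x hx
      simp [hx]
    · exact (MemOrlicz.zero (F1_zero D.δ_pos)).congr h0.symm
  add_mem' := by
    rintro u v ⟨⟨g, hg⟩, hu1, hu2⟩ ⟨⟨k, hk⟩, hv1, hv2⟩
    have ha := Lp.coeFn_add u v
    have hL : ∀ w : Lp (EuclideanSpace ℝ (Fin N)) 2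
        (volume : Measure (EuclideanSpace ℝ (Fin N))), LocallyIntegrable w := fun w =>
      (Lp.memLp w).locallyIntegrable (by norm_num)
    refine ⟨⟨g + k, ?_⟩, ?_, ?_⟩
    · exact (hg.add hk hu2.1 hv2.1 (hL g) (hL k)).congr ha.symm (Lp.coeFn_add g k).symm
    · have hV : AEStronglyMeasurable (fun x => D.V (ε • x))
          (volume : Measure (EuclideanSpace ℝ (Fin N))) :=
        (D.continuous_V.comp (continuous_const_smul ε)).aestronglyMeasurable
      refine ((hu1.norm.const_mul 2).add (hv1.norm.const_mul 2)).mono'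
        (hV.mul ((Lp.aestronglyMeasurable _).pow 2)) ?_
      filter_upwards [ha] with x hx
      rw [hx]
      simp only [Pi.add_apply, norm_mul, norm_pow, Real.norm_eq_abs, sq_abs]
      nlinarith [mul_nonneg (abs_nonneg (D.V (ε • x))) (sq_nonneg (u x - v x))]
    · exact (hu2.add measurable_F1 (convexOn_F1 D.δ_pos D.δ_small) (F1_zero D.δ_pos)
        (fun t ht => F1_nonneg D.δ_pos D.δ_small ht) hv2).congr ha.symm
  smul_mem' := by
    rintro c u ⟨⟨g, hg⟩, hu1, hu2⟩
    have ha := Lp.coeFn_smul c u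
    refine ⟨⟨c • g, ?_⟩, ?_, ?_⟩
    · exact (hg.smul c).congr ha.symm (Lp.coeFn_smul c g).symm
    · refine (hu1.const_mul (c ^ 2)).congr ?_
      filter_upwards [ha] with x hx
      rw [hx]
      simp only [Pi.smul_apply, smul_eq_mul]
      ring
    · exact (hu2.smul (F1_zero D.δ_pos) c).congr ha.symm

/-- The space `X_ε`; it carries the norm `‖·‖_ε` below, not the norm of `L²`. -/
def X : Type := D.energySubmodule ε

instance : AddCommGroup (D.X ε) := inferInstanceAs (AddCommGroup (D.energySubmodule ε))

instance : Module ℝ (D.X ε) := inferInstanceAs (Module ℝ (D.energySubmodule ε))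

variable {D ε}

/-- The class in `L²` of an element of `X_ε`. -/
def toL2 (u : D.X ε) : Lp ℝ 2 (volume : Measure (EuclideanSpace ℝ (Fin N))) := u.1

instance : CoeFun (D.X ε) fun _ => EuclideanSpace ℝ (Fin N) → ℝ := ⟨fun u => toL2 u⟩

/-- The weak gradient of an element of `X_ε`. -/
def grad (u : D.X ε) :
    Lp (EuclideanSpace ℝ (Fin N)) 2 (volume : Measure (EuclideanSpace ℝ (Fin N))) :=
  Classical.choose u.2.1

variable (D ε)

/-- The norm `‖u‖_{H_ε} = (∫ |∇u|² + (V(εx) + 1) |u|²)^{1/2}`. -/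
def normH (u : D.X ε) : ℝ :=
  Real.sqrt (∫ x, (‖grad u x‖ ^ 2 + (D.V (ε • x) + 1) * (u x) ^ 2))

/-- The norm `‖u‖_ε = ‖u‖_{H_ε} + ‖u‖_{F₁}` of `X_ε`. -/
instance : Norm (D.X ε) := ⟨fun u => D.normH ε u + luxemburgNorm (F1 D.δ) u⟩

section Instances

variable {D ε}

lemma norm_def (u : D.X ε) : ‖u‖ = D.normH ε u + luxemburgNorm (F1 D.δ) u := rfl

lemma hasWeakGradient_grad (u : D.X ε) : HasWeakGradient u (grad u) := Classical.choose_spec u.2.1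

lemma memOrlicz (u : D.X ε) : MemOrlicz (F1 D.δ) u := u.2.2.2

lemma coe_add (u v : D.X ε) : (u + v : D.X ε) =ᵐ[volume] fun x => u x + v x :=
  Lp.coeFn_add (toL2 u) (toL2 v)

lemma coe_smul (c : ℝ) (u : D.X ε) : (c • u : D.X ε) =ᵐ[volume] fun x => c * u x :=
  Lp.coeFn_smul c (toL2 u)

lemma locallyIntegrable_grad (w : Lp (EuclideanSpace ℝ (Fin N)) 2
    (volume : Measure (EuclideanSpace ℝ (Fin N)))) : LocallyIntegrable w :=
  (Lp.memLp w).locallyIntegrable (by norm_num)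

lemma grad_add (u v : D.X ε) : grad (u + v) = grad u + grad v := by
  refine Lp.ext ?_
  have h := ((hasWeakGradient_grad u).add (hasWeakGradient_grad v) (memOrlicz u).1 (memOrlicz v).1
    (locallyIntegrable_grad _) (locallyIntegrable_grad _)).congr (coe_add u v).symm
    (Lp.coeFn_add (grad u) (grad v)).symm
  exact (hasWeakGradient_grad (u + v)).unique h (locallyIntegrable_grad _)
    (locallyIntegrable_grad _)

lemma grad_smul (c : ℝ) (u : D.X ε) : grad (c • u) = c • grad u := by
  refine Lp.ext ?_
  have h := ((hasWeakGradient_grad u).smul c).congr (coe_smul c u).symm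
    (Lp.coeFn_smul c (grad u)).symm
  exact (hasWeakGradient_grad (c • u)).unique h (locallyIntegrable_grad _)
    (locallyIntegrable_grad _)

lemma V_add_one_pos (D : PenalizedProblem N) (y : EuclideanSpace ℝ (Fin N)) : 0 < D.V y + 1 := by
  have := ciInf_le D.bddBelow_V y
  linarith [D.neg_one_lt_iInf_V]

lemma integrable_weight (u : D.X ε) : Integrable fun x => (D.V (ε • x) + 1) * (u x) ^ 2 := by
  have h1 : Integrable fun x => D.V (ε • x) * (u x) ^ 2 := u.2.2.1
  have h2 : Integrable fun x => (u x) ^ 2 := (Lp.memLp (toL2 u)).integrable_sq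
  refine (h1.add h2).congr (ae_of_all _ fun x => ?_)
  simp only [Pi.add_apply]
  ring

lemma memLp_weighted (u : D.X ε) :
    MemLp (fun x => Real.sqrt (D.V (ε • x) + 1) * u x) 2 volume := by
  have hV : AEStronglyMeasurable (fun x => Real.sqrt (D.V (ε • x) + 1))
      (volume : Measure (EuclideanSpace ℝ (Fin N))) :=
    (((D.continuous_V.comp (continuous_const_smul ε)).add
      continuous_const).sqrt).aestronglyMeasurable
  refine (memLp_two_iff_integrable_sq (hV.mul (Lp.aestronglyMeasurable _))).2 ?_
  refine (integrable_weight u).congr (ae_of_all _ fun x => ?_)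
  simp only [Pi.mul_apply, mul_pow]
  rw [Real.sq_sqrt (V_add_one_pos D _).le]

/-- The isometric realization of `H_ε` in `L² × L²`, used only to check that `normH` is a norm. -/
def embed (u : D.X ε) : WithLp 2
    (Lp (EuclideanSpace ℝ (Fin N)) 2 (volume : Measure (EuclideanSpace ℝ (Fin N))) ×
      Lp ℝ 2 (volume : Measure (EuclideanSpace ℝ (Fin N)))) :=
  WithLp.toLp 2 (grad u, (memLp_weighted u).toLp _)

lemma embed_add (u v : D.X ε) : embed (u + v) = embed u + embed v := by
  unfold embed
  rw [← WithLp.toLp_add, Prod.mk_add_mk, grad_add, ← MemLp.toLp_add]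
  congr 2
  refine MemLp.toLp_congr _ _ ?_
  filter_upwards [coe_add u v] with x hx
  simp only [hx, Pi.add_apply]
  ring

lemma embed_smul (c : ℝ) (u : D.X ε) : embed (c • u) = c • embed u := by
  unfold embed
  rw [← WithLp.toLp_smul, Prod.smul_mk, grad_smul, ← MemLp.toLp_const_smul]
  congr 2
  refine MemLp.toLp_congr _ _ ?_
  filter_upwards [coe_smul c u] with x hx
  simp only [hx, Pi.smul_apply, smul_eq_mul]
  ring

lemma L2_norm_sq {F : Type*} [NormedAddCommGroup F] [InnerProductSpace ℝ F]
    (w : Lp F 2 (volume : Measure (EuclideanSpace ℝ (Fin N)))) : ‖w‖ ^ 2 = ∫ x, ‖w x‖ ^ 2 := by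
  rw [← real_inner_self_eq_norm_sq, L2.inner_def]
  simp only [real_inner_self_eq_norm_sq]

lemma normH_eq (u : D.X ε) : D.normH ε u = ‖embed u‖ := by
  have h1 : Integrable fun x => ‖grad u x‖ ^ 2 := (Lp.memLp (grad u)).integrable_norm_pow (by simp)
  rw [normH, embed, WithLp.prod_norm_eq_of_L2, integral_add h1 (integrable_weight u), L2_norm_sq,
    L2_norm_sq]
  congr 2
  refine integral_congr_ae ?_
  filter_upwards [(memLp_weighted u).coeFn_toLp] with x hx
  change _ = ‖(memLp_weighted u).toLp _ x‖ ^ 2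
  simp only [hx, norm_mul, mul_pow, Real.norm_eq_abs, sq_abs]
  rw [Real.sq_sqrt (V_add_one_pos D _).le]

lemma normedSpaceCore : NormedSpace.Core ℝ (D.X ε) where
  norm_nonneg u := add_nonneg (Real.sqrt_nonneg _) luxemburgNorm_nonneg
  norm_smul c u := by
    rw [norm_def, norm_def, normH_eq, normH_eq, embed_smul, norm_smul,
      luxemburgNorm_congr (coe_smul c u), luxemburgNorm_smul (F1_zero D.δ_pos), Real.norm_eq_abs]
    ring
  norm_triangle u v := by
    rw [norm_def, norm_def, norm_def, normH_eq, normH_eq, normH_eq, embed_add,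
      luxemburgNorm_congr (coe_add u v)]
    have h1 := norm_add_le (embed u) (embed v)
    have h2 := luxemburgNorm_add_le measurable_F1 (convexOn_F1 D.δ_pos D.δ_small)
      (F1_zero D.δ_pos) (fun t ht => F1_nonneg D.δ_pos D.δ_small ht) (memOrlicz u) (memOrlicz v)
    linarith
  norm_eq_zero_iff u := by
    constructor
    · intro hu
      rw [norm_def] at hu
      have h1 : D.normH ε u = 0 := le_antisymm
        (by linarith [luxemburgNorm_nonneg (Φ := F1 D.δ) (u := u)]) (Real.sqrt_nonneg _)
      rw [normH_eq, norm_eq_zero] at h1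
      have h2 : (memLp_weighted u).toLp _ = 0 := congrArg WithLp.snd h1
      have h3 := (memLp_weighted u).coeFn_toLp
      rw [h2] at h3
      refine Subtype.ext (Lp.ext ?_)
      filter_upwards [h3, Lp.coeFn_zero ℝ 2 (volume : Measure (EuclideanSpace ℝ (Fin N)))]
        with x hx hx0
      rw [hx0] at hx
      have h4 : Real.sqrt (D.V (ε • x) + 1) ≠ 0 := (Real.sqrt_pos.2 (V_add_one_pos D _)).ne'
      have h5 : u x = 0 := (mul_eq_zero.1 hx.symm).resolve_left h4
      exact h5.trans hx0.symm
    · rintro rfl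
      have e : (0 : D.X ε) = (0 : ℝ) • (0 : D.X ε) := by simp
      rw [norm_def, e, normH_eq, embed_smul, zero_smul, norm_zero,
        luxemburgNorm_congr (coe_smul 0 (0 : D.X ε)), luxemburgNorm_smul (F1_zero D.δ_pos)]
      simp

end Instances

instance : NormedAddCommGroup (D.X ε) := NormedAddCommGroup.ofCore (𝕜 := ℝ) normedSpaceCore

instance : NormedSpace ℝ (D.X ε) := NormedSpace.ofCore normedSpaceCore

/-! ### The penalized nonlinearity, the energy functional and the Nehari set -/

/-- The function `F₂'` truncated at `a₀` and smoothed on `[t₁, t₂]` (used for `s ≥ 0`). -/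
def F2tilde' (s : ℝ) : ℝ :=
  open scoped Classical in if s ∈ Icc D.t₁ D.t₂ then D.h s else F2bar' D.δ D.b₀ D.a₀ s

/-- The penalized nonlinearity `g₂`, for `t ≥ 0`. -/
def g2pos (x : EuclideanSpace ℝ (Fin N)) (t : ℝ) : ℝ :=
  D.Λ.indicator 1 x * deriv (F2 D.δ) t + (1 - D.Λ.indicator 1 x) * D.F2tilde' t

/-- The penalized nonlinearity `g₂`, extended to an odd function of `t`. -/
def g2 (x : EuclideanSpace ℝ (Fin N)) (t : ℝ) : ℝ :=
  if 0 ≤ t then D.g2pos x t else -D.g2pos x (-t)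

/-- The primitive `G₂` of `g₂`. -/
def G2 (x : EuclideanSpace ℝ (Fin N)) (t : ℝ) : ℝ := ∫ s in (0 : ℝ)..t, D.g2 x s

/-- The energy functional `J_ε`. -/
def J (u : D.X ε) : ℝ :=
  (1 / 2) * (∫ x, (‖grad u x‖ ^ 2 + (D.V (ε • x) + 1) * (u x) ^ 2)) +
    (∫ x, F1 D.δ (u x)) - ∫ x, D.G2 (ε • x) (u x)

/-- The functional `Ψ_ε`. -/
def Ψ (u : D.X ε) : ℝ :=
  D.J ε u - (1 / 2) * (∫ x, (u x) ^ 2) -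
    ∫ x, (F2 D.δ (u x) - (1 / 2) * deriv (F2 D.δ) (u x) * u x +
      (1 / 2) * D.g2 (ε • x) (u x) * u x - D.G2 (ε • x) (u x))

/-- The Nehari set `N_ε`. -/
def nehari : Set (D.X ε) := {u | u ≠ 0 ∧ fderiv ℝ (D.J ε) u u = 0}

/-- `‖J'_ε(u)‖_*`, the infimum over `λ ∈ ℝ` of the dual norms `‖J'_ε(u) - λ Ψ'_ε(u)‖`. -/
def constrainedNorm (u : D.X ε) : ℝ :=
  ⨅ r : ℝ, ‖fderiv ℝ (D.J ε) u - r • fderiv ℝ (D.Ψ ε) u‖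

/-- `u` is a critical point of `J_ε` constrained to `N_ε`. -/
def IsConstrainedCritical (u : D.X ε) : Prop := u ∈ D.nehari ε ∧ D.constrainedNorm ε u = 0

/-- `(u_n)` is a `(PS)_c` sequence for the restriction of `J_ε` to `N_ε`. -/
def IsConstrainedPS (c : ℝ) (u : ℕ → D.X ε) : Prop :=
  (∀ n, u n ∈ D.nehari ε) ∧ Tendsto (fun n => D.J ε (u n)) atTop (𝓝 c) ∧
    Tendsto (fun n => D.constrainedNorm ε (u n)) atTop (𝓝 0)

end PenalizedProblem

/-- `S` is a (split) `C¹` submanifold of codimension one of the normed space `E`: there is a closed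
subspace `Y` of codimension one such that around each point of `S` some `C¹` diffeomorphism
between open subsets of `E` straightens `S` to `Y`. -/
def IsC1Hypersurface {E : Type*} [NormedAddCommGroup E] [NormedSpace ℝ E] (S : Set E) : Prop :=
  ∃ Y : Submodule ℝ E, IsClosed (Y : Set E) ∧ Module.finrank ℝ (E ⧸ Y) = 1 ∧
    ∀ u ∈ S, ∃ φ : OpenPartialHomeomorph E E, u ∈ φ.source ∧
      ContDiffOn ℝ 1 φ φ.source ∧ ContDiffOn ℝ 1 φ.symm φ.target ∧
      ∀ x ∈ φ.source, x ∈ S ↔ φ x ∈ Y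

end LogNehari

end

/-!
The energy is studied on the Banach space `X_ε = H_ε ∩ L^{F₁}`, where the splitting of the
logarithm into `F₂ - F₁` makes `J_ε` of class `C¹`: `F₁` is convex with
`F₁(s) ≤ F₁'(s) s ≤ 2 F₁(s)`, so that its modular and its Luxemburg norm are small, or bounded, on
the same sequences, and `F₂'` vanishes near `0` and grows slower than every power `|s|^(1 + β)`.
Differentiability of all the integral functionals is a single statement about a growth function
`growth = F₁ + s² + |s|^p` with `p = 2 + 2 / N` (`Admissible.exists_hasFDerivAt`).
The exponent is chosen so that the Sobolev inequality `∫ |u|^p ≤ C ‖u‖_{H¹}^p` follows, in every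
dimension, from averages over small balls (`exists_sobolev`); the same averages give local
compactness in `L²` (`tendsto_lintegral_ball`).

Since `F₁'(s) s = 2 F₁(s) - s² - 2 F₂(s) + F₂'(s) s`, one has `Ψ_ε(u) = J_ε'(u) u / 2`
(`Psi_eq_half`), so the Nehari set is the zero set of `Ψ_ε` away from the origin. For `u` in it,
`g₂(x, t) / t` being monotone gives `Ψ_ε'(u) u ≤ -∫_{Λ_ε} u²` (`fderiv_Psi_self_le`), and
`J_ε(u) = J_ε(u) - Ψ_ε(u) ≥ ½ ∫_{Λ_ε} u²` (`integral_chi_sq_le_J`). On the other hand, outside `Λ_ε`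
the nonlinearity is absorbed by the quadratic part because `2 b₀ < inf V + 1`, and the logarithm
inside can be cut at any height `T`:
`½ ‖u‖²_{H_ε} + ∫ F₁'(u) u ≤ 2 log (T / δ) ∫_{Λ_ε} u² + C T^(-2/N) ‖u‖_{H_ε}^p`
(`exists_energy_le`). For `T = δ` this keeps the Nehari set away from `0`; for `T` large it bounds
`∫_{Λ_ε} u²` from below on bounded sets; and for `T` proportional to `‖u‖_{H_ε}` it bounds the
sublevels of `J_ε`. So `Ψ_ε'(u) u` is negative, and `0` is a regular value of `Ψ_ε` off the origin,
which gives the manifold structure. Testing `J_ε'(u) - λ Ψ_ε'(u)` with `u` bounds `λ`, so that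
`‖J_ε'(u)‖ ≤ K ‖J_ε'(u)‖_*` on bounded parts of the Nehari set (`exists_norm_fderiv_J_le`); this
settles constrained critical points and turns a constrained Palais–Smale sequence into a bounded
sequence with `J_ε'(u_n) → 0`.

For such a sequence, testing with cutoffs supported away from the bounded set `Λ_ε` shows that no
mass of `u_n²` and `F₁(u_n)` escapes to infinity (`exists_tail_le`). Together with local
compactness, `u_n - u_m → 0` in `L²` and in the modular of `F₁`, hence in the Luxemburg norm.
Finally `(J_ε'(u_n) - J_ε'(u_m))(u_n - u_m) → 0` and the monotonicity of `F₁'` give convergence in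
`H_ε` (`exists_normH_sub_sq_le`).
-/

noncomputable section

namespace LogNehari

/-! ### Derivatives of `F₁` and `F₂` -/

section Scalar

variable {δ : ℝ}

/-- A function of `max s δ` is differentiable across `s = δ` if the derivative vanishes there. -/
lemma hasDerivAt_comp_max {q q' : ℝ → ℝ} (hδ : 0 < δ) (hq : ∀ r, 0 < r → HasDerivAt q (q' r) r)
    (hq' : ContinuousOn q' (Ioi 0)) (h0 : q' δ = 0) (s : ℝ) :
    HasDerivAt (fun s => q (max s δ)) (q' (max s δ)) s := by
  have hpos : ∀ s, 0 < max s δ := fun s => lt_max_of_lt_right hδ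
  have hmax : Continuous fun s : ℝ => max s δ := continuous_id.max continuous_const
  have hqc : Continuous fun s => q (max s δ) :=
    continuous_iff_continuousAt.2 fun s =>
      ContinuousAt.comp (f := fun s => max s δ) (g := q) (hq _ (hpos s)).continuousAt
        hmax.continuousAt
  have hqc' : Continuous fun s => q' (max s δ) :=
    hq'.comp_continuous hmax hpos
  refine hasDerivAt_of_hasDerivAt_of_ne' (x := δ) (g := fun s => q' (max s δ)) ?_
    hqc.continuousAt hqc'.continuousAt s
  intro y hy
  rcases lt_or_gt_of_ne hy with h | h
  · rw [max_eq_right h.le, h0]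
    refine (hasDerivAt_const y (q δ)).congr_of_eventuallyEq ?_
    filter_upwards [Iio_mem_nhds h] with t ht
    rw [max_eq_right (le_of_lt ht)]
  · rw [max_eq_left h.le]
    refine (hq y (hδ.trans h)).congr_of_eventuallyEq ?_
    filter_upwards [Ioi_mem_nhds h] with t ht
    rw [max_eq_left (le_of_lt ht)]

lemma continuous_comp_max {q : ℝ → ℝ} (hδ : 0 < δ) (hq : ContinuousOn q (Ioi 0)) :
    Continuous fun s => q (max s δ) :=
  hq.comp_continuous (continuous_id.max continuous_const) fun _ => lt_max_of_lt_right hδ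

/-- The derivative of `F₂` on `[δ, ∞)`. -/
def Q1 (δ r : ℝ) : ℝ := 2 * r * (Real.log r - Real.log δ) + 2 * δ - 2 * r

/-- The function `F₂` on `[δ, ∞)`. -/
def Q0 (δ r : ℝ) : ℝ :=
  r ^ 2 * (Real.log r - Real.log δ) + 2 * δ * r - 3 / 2 * r ^ 2 - δ ^ 2 / 2

/-- The second derivative of `F₂` on `[δ, ∞)`. -/
def Q2 (δ r : ℝ) : ℝ := 2 * (Real.log r - Real.log δ)

/-- The derivative of `F₂`. -/
def dF2 (δ s : ℝ) : ℝ := Q1 δ (max s δ) - Q1 δ (max (-s) δ)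

/-- The second derivative of `F₂`. -/
def ddF2 (δ s : ℝ) : ℝ := Q2 δ (max s δ) + Q2 δ (max (-s) δ)

/-- The derivative of `F₁`; recall that `Real.log s = log |s|`. -/
def dF1 (δ s : ℝ) : ℝ := dF2 δ s - 2 * (s * Real.log s) - s

lemma Q0_delta : Q0 δ δ = 0 := by simp [Q0]; ring
lemma Q1_delta : Q1 δ δ = 0 := by simp [Q1]
lemma Q2_delta : Q2 δ δ = 0 := by simp [Q2]

lemma hasDerivAt_Q0 {r : ℝ} (hr : 0 < r) : HasDerivAt (Q0 δ) (Q1 δ r) r := by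
  have := ((((hasDerivAt_pow 2 r).mul ((Real.hasDerivAt_log hr.ne').sub_const (Real.log δ))).add
    ((hasDerivAt_id r).const_mul (2 * δ))).sub ((hasDerivAt_pow 2 r).const_mul (3 / 2))).sub_const
    (δ ^ 2 / 2)
  refine this.congr_deriv ?_
  simp only [Q1]
  field_simp
  simp
  ring

lemma hasDerivAt_Q1 {r : ℝ} (hr : 0 < r) : HasDerivAt (Q1 δ) (Q2 δ r) r := by
  have := (((((hasDerivAt_id r).const_mul 2).mul
    ((Real.hasDerivAt_log hr.ne').sub_const (Real.log δ)))).add_const (2 * δ)).sub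
    ((hasDerivAt_id r).const_mul 2)
  refine this.congr_deriv ?_
  simp only [Q2, id]
  field_simp
  ring

lemma continuousOn_Q1 : ContinuousOn (Q1 δ) (Ioi 0) := fun _ hr =>
  (hasDerivAt_Q1 hr).continuousAt.continuousWithinAt

lemma continuousOn_Q2 : ContinuousOn (Q2 δ) (Ioi 0) := by
  unfold Q2
  exact (continuousOn_const.mul ((Real.continuousOn_log.mono fun x hx => (ne_of_gt hx)).sub
    continuousOn_const))

lemma F2_eq (hδ : 0 < δ) (s : ℝ) : F2 δ s = Q0 δ (max s δ) + Q0 δ (max (-s) δ) := by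
  have key : ∀ r, δ ≤ r → (1 / 2) * r ^ 2 * Real.log (r ^ 2 / δ ^ 2) + 2 * δ * r
      - (3 / 2) * r ^ 2 - δ ^ 2 / 2 = Q0 δ r := by
    intro r hr
    have hr0 : 0 < r := hδ.trans_le hr
    rw [Q0, Real.log_div (by positivity) (by positivity), Real.log_pow, Real.log_pow]
    push_cast
    ring
  unfold F2
  split_ifs with h
  · rw [abs_lt] at h
    rw [max_eq_right h.2.le, max_eq_right (by linarith), Q0_delta, add_zero]
  · rw [not_lt] at h
    rcases le_total 0 s with hs | hs
    · rw [abs_of_nonneg hs] at h ⊢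
      rw [max_eq_left h, max_eq_right (by linarith), Q0_delta, add_zero, key s h]
    · rw [abs_of_nonpos hs] at h ⊢
      rw [max_eq_right (by linarith : s ≤ δ), max_eq_left h, Q0_delta, zero_add, ← key (-s) h,
        neg_sq]

lemma hasDerivAt_F2 (hδ : 0 < δ) (s : ℝ) : HasDerivAt (F2 δ) (dF2 δ s) s := by
  have h1 := hasDerivAt_comp_max hδ (fun r hr => hasDerivAt_Q0 (δ := δ) hr) continuousOn_Q1
    Q1_delta
  have h2 := (h1 s).add ((h1 (-s)).comp s (hasDerivAt_neg s))
  have e : F2 δ = (fun s => Q0 δ (max s δ)) + (fun s => Q0 δ (max s δ)) ∘ Neg.neg :=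
    funext fun s => F2_eq hδ s
  rw [e]
  refine h2.congr_deriv ?_
  simp [dF2, sub_eq_add_neg]

lemma deriv_F2 (hδ : 0 < δ) : deriv (F2 δ) = dF2 δ :=
  funext fun s => (hasDerivAt_F2 hδ s).deriv

lemma hasDerivAt_dF2 (hδ : 0 < δ) (s : ℝ) : HasDerivAt (dF2 δ) (ddF2 δ s) s := by
  have h1 := hasDerivAt_comp_max hδ (fun r hr => hasDerivAt_Q1 (δ := δ) hr) continuousOn_Q2
    Q2_delta
  have h2 := (h1 s).sub ((h1 (-s)).comp s (hasDerivAt_neg s))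
  have e : dF2 δ = (fun s => Q1 δ (max s δ)) - (fun s => Q1 δ (max s δ)) ∘ Neg.neg := rfl
  rw [e]
  refine h2.congr_deriv ?_
  simp [ddF2]

lemma continuous_dF2 (hδ : 0 < δ) : Continuous (dF2 δ) :=
  continuous_iff_continuousAt.2 fun s => (hasDerivAt_dF2 hδ s).continuousAt

lemma continuous_ddF2 (hδ : 0 < δ) : Continuous (ddF2 δ) :=
  (continuous_comp_max hδ continuousOn_Q2).add
    ((continuous_comp_max hδ continuousOn_Q2).comp continuous_neg)

lemma F1_eq (hδ : 0 < δ) (s : ℝ) : F1 δ s = F2 δ s - s * (s * Real.log s) := by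
  unfold F1 F2
  split_ifs with h
  · rw [Real.log_pow]; push_cast; ring
  · have hs : s ≠ 0 := by
      rintro rfl; simp at h; linarith
    rw [Real.log_div (by positivity) (by positivity), Real.log_pow, Real.log_pow]
    push_cast
    ring

lemma continuous_dF1 (hδ : 0 < δ) : Continuous (dF1 δ) :=
  ((continuous_dF2 hδ).sub (continuous_const.mul Real.continuous_mul_log)).sub continuous_id

lemma hasDerivAt_dF1 (hδ : 0 < δ) (s : ℝ) : HasDerivAt (F1 δ) (dF1 δ s) s := by
  have hL : ∀ s : ℝ, HasDerivAt (fun s : ℝ => s * (s * Real.log s))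
      (2 * (s * Real.log s) + s) s := by
    refine hasDerivAt_of_hasDerivAt_of_ne' (x := 0) ?_
      (continuous_id.mul Real.continuous_mul_log).continuousAt
      ((continuous_const.mul Real.continuous_mul_log).add continuous_id).continuousAt
    intro s hs
    refine ((hasDerivAt_id s).mul ((hasDerivAt_id s).mul
      (Real.hasDerivAt_log hs))).congr_deriv ?_
    simp only [id]
    field_simp
    simp
    ring
  have e : F1 δ = fun s => F2 δ s - s * (s * Real.log s) := funext (F1_eq hδ)
  rw [e]
  refine ((hasDerivAt_F2 hδ s).sub (hL s)).congr_deriv ?_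
  simp only [dF1]; ring

lemma F1_abs (s : ℝ) : F1 δ |s| = F1 δ s := by simp [F1]

lemma dF2_neg (s : ℝ) : dF2 δ (-s) = -dF2 δ s := by simp [dF2]

lemma dF1_neg (s : ℝ) : dF1 δ (-s) = -dF1 δ s := by simp [dF1, dF2_neg]; ring

lemma dF1_zero : dF1 δ 0 = 0 := by simp [dF1, dF2]

lemma dF2_of_lt {s : ℝ} (h : |s| ≤ δ) : dF2 δ s = 0 := by
  rw [abs_le] at h
  rw [dF2, max_eq_right h.2, max_eq_right (by linarith), sub_self]

lemma dF2_of_ge (hδ : 0 < δ) {s : ℝ} (h : δ ≤ s) : dF2 δ s = Q1 δ s := by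
  rw [dF2, max_eq_left h, max_eq_right (by linarith), Q1_delta, sub_zero]

lemma ddF2_of_lt {s : ℝ} (h : |s| ≤ δ) : ddF2 δ s = 0 := by
  rw [abs_le] at h
  rw [ddF2, max_eq_right h.2, max_eq_right (by linarith), Q2_delta, add_zero]

lemma ddF2_of_ge (hδ : 0 < δ) {s : ℝ} (h : δ ≤ s) : ddF2 δ s = Q2 δ s := by
  rw [ddF2, max_eq_left h, max_eq_right (by linarith), Q2_delta, add_zero]

lemma F2_of_lt {s : ℝ} (h : |s| < δ) : F2 δ s = 0 := by rw [F2, if_pos h]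

lemma F2_of_ge (hδ : 0 < δ) {s : ℝ} (h : δ ≤ s) : F2 δ s = Q0 δ s := by
  rw [F2_eq hδ, max_eq_left h, max_eq_right (by linarith), Q0_delta, add_zero]

/-- `F₁'` as given by the two branches of the definition of `F₁`. -/
lemma dF1_of_pos (hδ : 0 < δ) {s : ℝ} (hs : 0 < s) :
    dF1 δ s = if s < δ then -(2 * Real.log s + 1) * s else -(2 * Real.log δ + 3) * s + 2 * δ :=
  (hasDerivAt_dF1 hδ s).unique (hasDerivAt_F1 hδ hs)

lemma F1_of_pos {s : ℝ} (hs : 0 < s) :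
    F1 δ s = if s < δ then -s ^ 2 * Real.log s
      else -(2 * Real.log δ + 3) / 2 * s ^ 2 + 2 * δ * s - δ ^ 2 / 2 := by
  unfold F1
  rw [abs_of_pos hs]
  split_ifs
  · rw [Real.log_pow]; push_cast; ring
  · rw [Real.log_pow]; push_cast; ring

lemma F1_le_dF1 (hδ : 0 < δ) (hδ' : δ < Real.exp (-(3 / 2))) (s : ℝ) : F1 δ s ≤ dF1 δ s * s := by
  have hl := log_delta_lt hδ hδ'
  suffices H : ∀ s, 0 < s → F1 δ s ≤ dF1 δ s * s by
    rcases lt_trichotomy s 0 with h | h | h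
    · have := H (-s) (by linarith)
      rw [dF1_neg, ← F1_abs, abs_neg, F1_abs] at this
      linarith
    · subst h; simp [F1_zero hδ]
    · exact H s h
  intro s hs
  rw [F1_of_pos hs, dF1_of_pos hδ hs]
  split_ifs with h
  · have : Real.log s < Real.log δ := Real.log_lt_log hs h
    nlinarith [mul_nonneg (sq_nonneg s) (show 0 ≤ -Real.log s - 1 by linarith)]
  · nlinarith [mul_nonneg (sq_nonneg s) (show 0 ≤ -(2 * Real.log δ + 3) by linarith), sq_nonneg δ]

lemma dF1_mul_le (hδ : 0 < δ) {s : ℝ} (hs : 0 < s) : dF1 δ s * s ≤ 2 * F1 δ s := by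
  rw [F1_of_pos hs, dF1_of_pos hδ hs]
  split_ifs with h
  · nlinarith [sq_nonneg s]
  · nlinarith

lemma dF1_mul_ge (hδ : 0 < δ) (hδ' : δ < Real.exp (-(3 / 2))) {s : ℝ} (hs : 0 < s) :
    4 / 3 * (F1 δ s + s ^ 2) ≤ dF1 δ s * s + 2 * s ^ 2 := by
  have hl := log_delta_lt hδ hδ'
  rw [F1_of_pos hs, dF1_of_pos hδ hs]
  split_ifs with h
  · have : Real.log s < Real.log δ := Real.log_lt_log hs h
    nlinarith [mul_nonneg (sq_nonneg s) (show 0 ≤ -Real.log s - 3 / 2 by linarith)]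
  · nlinarith [mul_nonneg (sq_nonneg s) (show 0 ≤ -(2 * Real.log δ + 3) by linarith), sq_nonneg δ,
      sq_nonneg (s - δ), sq_nonneg s]

lemma F1_nonneg' (hδ : 0 < δ) (hδ' : δ < Real.exp (-(3 / 2))) (s : ℝ) : 0 ≤ F1 δ s := by
  rw [← F1_abs]; exact F1_nonneg hδ hδ' (abs_nonneg s)

/-- Power comparison: a differential inequality `a f ≤ s f'` integrates to `(t/s)^a f(s) ≤ f(t)`. -/
lemma rpow_mul_le_of_deriv {f f' : ℝ → ℝ} {a : ℝ}
    (hf : ∀ s, 0 < s → HasDerivAt f (f' s) s) (h : ∀ s, 0 < s → a * f s ≤ f' s * s)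
    {s t : ℝ} (hs : 0 < s) (hst : s ≤ t) : (t / s) ^ a * f s ≤ f t := by
  have hd : ∀ x, 0 < x → HasDerivAt (fun x => f x * x ^ (-a))
      (f' x * x ^ (-a) + f x * ((-a) * x ^ (-a - 1))) x := fun x hx =>
    (hf x hx).mul (Real.hasDerivAt_rpow_const (Or.inl hx.ne'))
  have hmono : MonotoneOn (fun x => f x * x ^ (-a)) (Ioi 0) := by
    refine monotoneOn_of_deriv_nonneg (convex_Ioi 0)
      (fun x hx => (hd x hx).continuousAt.continuousWithinAt)
      (fun x hx => ?_) (fun x hx => ?_)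
    · rw [interior_Ioi] at hx
      exact (hd x hx).differentiableAt.differentiableWithinAt
    · rw [interior_Ioi] at hx
      have hx' : 0 < x := hx
      rw [(hd x hx).deriv]
      have e : x ^ (-a) = x ^ (-a - 1) * x := by
        rw [← Real.rpow_add_one hx'.ne']; congr 1; ring
      rw [e]
      have : 0 ≤ x ^ (-a - 1) * (f' x * x - a * f x) :=
        mul_nonneg (Real.rpow_nonneg hx'.le _) (sub_nonneg.2 (h x hx))
      nlinarith
  have ht : 0 < t := hs.trans_le hst
  have := hmono hs ht hst
  simp only at this
  rw [Real.rpow_neg hs.le, Real.rpow_neg ht.le] at this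
  rw [Real.div_rpow ht.le hs.le]
  have hsa := Real.rpow_pos_of_pos hs a
  have hta := Real.rpow_pos_of_pos ht a
  rw [← div_eq_mul_inv, ← div_eq_mul_inv, div_le_div_iff₀ hsa hta] at this
  rw [div_mul_eq_mul_div, div_le_iff₀ hsa]
  linarith

lemma le_rpow_mul_of_deriv {f f' : ℝ → ℝ} {a : ℝ}
    (hf : ∀ s, 0 < s → HasDerivAt f (f' s) s) (h : ∀ s, 0 < s → f' s * s ≤ a * f s)
    {s t : ℝ} (hs : 0 < s) (hst : s ≤ t) : f t ≤ (t / s) ^ a * f s := by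
  have := rpow_mul_le_of_deriv (f := fun s => -f s) (f' := fun s => -f' s) (a := a)
    (fun s hs => (hf s hs).neg) (fun s hs => by have := h s hs; linarith) hs hst
  linarith

/-- The growth condition `Δ₂` for `F₁`. -/
lemma F1_mul_le (hδ : 0 < δ) {c : ℝ} (hc : 1 ≤ c) (s : ℝ) : F1 δ (c * s) ≤ c ^ 2 * F1 δ s := by
  suffices H : ∀ s, 0 < s → F1 δ (c * s) ≤ c ^ 2 * F1 δ s by
    rcases eq_or_ne s 0 with rfl | hs
    · simp [F1_zero hδ]
    · have := H |s| (abs_pos.2 hs)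
      rwa [F1_abs, ← F1_abs, abs_mul, abs_abs, ← abs_mul, F1_abs] at this
  intro s hs
  have := le_rpow_mul_of_deriv (f := F1 δ) (a := 2) (fun s _ => hasDerivAt_dF1 hδ s)
    (fun s hs => dF1_mul_le hδ hs) hs (t := c * s) (by nlinarith)
  rw [mul_div_cancel_right₀ _ hs.ne'] at this
  exact_mod_cast this

lemma F1_scale (hδ : 0 < δ) (hδ' : δ < Real.exp (-(3 / 2))) {c : ℝ} (hc : 0 ≤ c) (hc1 : c ≤ 1)
    (s : ℝ) : F1 δ (c * s) ≤ c * F1 δ s := by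
  have := convex_scale (convexOn_F1 hδ hδ') (F1_zero hδ) (abs_nonneg s) hc hc1
  rw [F1_abs] at this
  rwa [← F1_abs, abs_mul, abs_of_nonneg hc]

lemma F1_mono (hδ : 0 < δ) (hδ' : δ < Real.exp (-(3 / 2))) {s t : ℝ} (h : |s| ≤ |t|) :
    F1 δ s ≤ F1 δ t := by
  have := convex_mono (convexOn_F1 hδ hδ') (F1_zero hδ) (fun t ht => F1_nonneg hδ hδ' ht)
    (abs_nonneg s) h
  rwa [F1_abs, F1_abs] at this

lemma F1_sub_le (hδ : 0 < δ) (hδ' : δ < Real.exp (-(3 / 2))) (a b : ℝ) :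
    F1 δ (a - b) ≤ 4 * (F1 δ a + F1 δ b) := by
  have h1 : |a - b| ≤ |2 * max (|a|) (|b|)| := by
    rw [abs_of_nonneg (a := 2 * max (|a|) (|b|)) (by positivity)]
    have := abs_sub a b
    linarith [le_max_left (|a|) (|b|), le_max_right (|a|) (|b|)]
  refine (F1_mono hδ hδ' h1).trans ((F1_mul_le hδ one_le_two _).trans ?_)
  rcases max_cases (|a|) (|b|) with ⟨h, -⟩ | ⟨h, -⟩
  · rw [h, F1_abs]; linarith [F1_nonneg' hδ hδ' b]
  · rw [h, F1_abs]; linarith [F1_nonneg' hδ hδ' a]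

/-- On sets of finite measure `F₁` is controlled by the square. -/
lemma F1_le_add_sq (hδ : 0 < δ) (hδ' : δ < Real.exp (-(3 / 2))) {η : ℝ} (hη : 0 < η) :
    ∃ C : ℝ, 0 ≤ C ∧ ∀ s, F1 δ s ≤ η + C * s ^ 2 := by
  have hc : ContinuousAt (F1 δ) 0 := (hasDerivAt_dF1 hδ 0).continuousAt
  obtain ⟨r, hr, hr'⟩ := Metric.continuousAt_iff.1 hc η hη
  have hr2 : 0 < r / 2 := by positivity
  refine ⟨F1 δ (r / 2) / (r / 2) ^ 2, div_nonneg (F1_nonneg' hδ hδ' _) (by positivity), fun s => ?_⟩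
  rcases le_total (r / 2) |s| with h | h
  · have h1 := F1_mul_le hδ (c := |s| / (r / 2)) ((one_le_div hr2).2 h) (r / 2)
    rw [div_mul_cancel₀ _ hr2.ne', F1_abs, div_pow, sq_abs] at h1
    have : s ^ 2 / (r / 2) ^ 2 * F1 δ (r / 2) = F1 δ (r / 2) / (r / 2) ^ 2 * s ^ 2 := by ring
    linarith
  · have h1 := hr' (x := s) (by rw [dist_zero_right, Real.norm_eq_abs]; linarith)
    rw [F1_zero hδ, dist_zero_right, Real.norm_eq_abs] at h1
    have := le_abs_self (F1 δ s)
    have : 0 ≤ F1 δ (r / 2) / (r / 2) ^ 2 * s ^ 2 :=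
      mul_nonneg (div_nonneg (F1_nonneg' hδ hδ' _) (by positivity)) (sq_nonneg s)
    linarith

lemma monotone_dF1 (hδ : 0 < δ) (hδ' : δ < Real.exp (-(3 / 2))) : Monotone (dF1 δ) := by
  have h0 : ∀ s, 0 ≤ s → 0 ≤ dF1 δ s := by
    intro s hs
    rcases hs.eq_or_lt with rfl | hs'
    · rw [dF1_zero]
    · have h1 := F1_le_dF1 hδ hδ' s
      have h2 := F1_nonneg hδ hδ' hs
      exact nonneg_of_mul_nonneg_left (h2.trans h1) hs'
  have h1 : MonotoneOn (dF1 δ) (Ici 0) := by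
    have hc := convexOn_F1 hδ hδ'
    have : MonotoneOn (dF1 δ) (Ioi 0) := by
      have := (hc.subset Ioi_subset_Ici_self (convex_Ioi 0)).monotoneOn_deriv
        (fun x _ => (hasDerivAt_dF1 hδ x).differentiableAt)
      intro a ha b hb hab
      have := this ha hb hab
      rwa [(hasDerivAt_dF1 hδ a).deriv, (hasDerivAt_dF1 hδ b).deriv] at this
    intro a ha b hb hab
    rcases (mem_Ici.1 ha).eq_or_lt with rfl | ha'
    · rw [dF1_zero]; exact h0 b hb
    · exact this ha' (ha'.trans_le hab) hab
  intro a b hab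
  rcases le_total 0 a with ha | ha
  · exact h1 ha (ha.trans hab) hab
  · rcases le_total 0 b with hb | hb
    · have h2 := h0 b hb
      have h3 := h0 (-a) (by linarith)
      rw [dF1_neg] at h3
      linarith
    · have := h1 (mem_Ici.2 (neg_nonneg.2 hb)) (mem_Ici.2 (neg_nonneg.2 ha)) (neg_le_neg hab)
      rw [dF1_neg, dF1_neg] at this
      linarith

/-! ### Growth of `F₂'` -/

lemma dF2_nonneg (hδ : 0 < δ) {s : ℝ} (hs : 0 ≤ s) : 0 ≤ dF2 δ s := by
  rcases le_total s δ with h | h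
  · rw [dF2_of_lt (by rwa [abs_of_nonneg hs])]
  · rw [dF2_of_ge hδ h, Q1]
    have hs' : 0 < s := hδ.trans_le h
    have : 1 - δ / s ≤ Real.log s - Real.log δ := by
      rw [← Real.log_div hs'.ne' hδ.ne']
      have := Real.one_sub_inv_le_log_of_pos (x := s / δ) (by positivity)
      rwa [inv_div] at this
    have h2 : s * (1 - δ / s) = s - δ := by field_simp
    nlinarith [mul_le_mul_of_nonneg_left this hs'.le]

lemma dF2_mul_nonneg (hδ : 0 < δ) (s : ℝ) : 0 ≤ dF2 δ s * s := by
  rcases le_total 0 s with h | h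
  · exact mul_nonneg (dF2_nonneg hδ h) h
  · have := dF2_nonneg hδ (neg_nonneg.2 h)
    rw [dF2_neg] at this
    nlinarith

/-- `F₂'` is superlinear, but up to a term of order `|s|^{2+β}` with small coefficient it is
controlled by the square, the constant growing logarithmically only. -/
lemma dF2_mul_le (hδ : 0 < δ) {β T : ℝ} (hβ : 0 < β) (hT : δ ≤ T) (s : ℝ) :
    dF2 δ s * s ≤ 2 * Real.log (T / δ) * s ^ 2 + 2 / β * T ^ (-β) * |s| ^ (2 + β) := by
  suffices H : ∀ s, 0 ≤ s → dF2 δ s * s ≤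
      2 * Real.log (T / δ) * s ^ 2 + 2 / β * T ^ (-β) * s ^ (2 + β) by
    rcases le_total 0 s with h | h
    · rw [abs_of_nonneg h]; exact H s h
    · have := H (-s) (neg_nonneg.2 h)
      rw [dF2_neg] at this
      rw [abs_of_nonpos h]
      linarith [neg_pow_two s]
  intro s hs
  have hT0 : 0 < T := hδ.trans_le hT
  have hlog : 0 ≤ Real.log (T / δ) := Real.log_nonneg ((one_le_div hδ).2 hT)
  rcases le_total s δ with h | h
  · rw [dF2_of_lt (by rwa [abs_of_nonneg hs]), zero_mul]
    positivity
  · have hs' : 0 < s := hδ.trans_le h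
    rw [dF2_of_ge hδ h, Q1]
    have h1 := Real.log_le_rpow_div (x := s / T) (by positivity) hβ
    have h2 : Real.log s - Real.log δ = Real.log (T / δ) + Real.log (s / T) := by
      rw [Real.log_div hT0.ne' hδ.ne', Real.log_div hs'.ne' hT0.ne']; ring
    rw [Real.div_rpow hs'.le hT0.le] at h1
    rw [h2, Real.rpow_neg hT0.le, Real.rpow_add hs']
    have h3 : s ^ 2 * Real.log (s / T) ≤ s ^ 2 * (s ^ β / T ^ β / β) := by gcongr
    have h4 : 2 / β * (T ^ β)⁻¹ * (s ^ (2 : ℝ) * s ^ β) = 2 * (s ^ 2 * (s ^ β / T ^ β / β)) := by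
      rw [Real.rpow_two]; field_simp
    rw [h4]
    nlinarith

lemma dF2_sq_le (hδ : 0 < δ) {β : ℝ} (hβ : 0 < β) :
    ∃ C : ℝ, 0 ≤ C ∧ ∀ s, dF2 δ s ^ 2 ≤ C * |s| ^ (2 + β) := by
  refine ⟨(2 / (β / 2) * δ ^ (-(β / 2))) ^ 2, by positivity, fun s => ?_⟩
  have h1 := dF2_mul_le hδ (half_pos hβ) le_rfl s
  rw [div_self hδ.ne', Real.log_one, mul_zero, zero_mul, zero_add] at h1
  have h0 := dF2_mul_nonneg hδ s
  rcases eq_or_ne s 0 with rfl | hs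
  · rw [dF2_of_lt (by simpa using hδ.le)]
    simp only [ne_eq, OfNat.ofNat_ne_zero, not_false_eq_true, zero_pow]
    positivity
  · have hs' : 0 < |s| := abs_pos.2 hs
    have h2 : (dF2 δ s * s) ^ 2 ≤ (2 / (β / 2) * δ ^ (-(β / 2)) * |s| ^ (2 + β / 2)) ^ 2 := by
      gcongr
    have e : (|s| ^ (2 + β / 2)) ^ 2 = |s| ^ (2 + β) * s ^ 2 := by
      rw [← sq_abs s, ← Real.rpow_two, ← Real.rpow_two |s|, ← Real.rpow_mul hs'.le,
        ← Real.rpow_add hs']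
      congr 1; ring
    rw [mul_pow, mul_pow _ (|s| ^ (2 + β / 2)), e, ← mul_assoc] at h2
    exact le_of_mul_le_mul_right h2 (by positivity)

/-- `F₂ - ½ F₂' s` has quadratic growth: the logarithms cancel. -/
lemma F2_sub_half (hδ : 0 < δ) (s : ℝ) :
    F2 δ s - 1 / 2 * dF2 δ s * s = -(1 / 2) * (max |s| δ - δ) ^ 2 := by
  suffices H : ∀ s, 0 ≤ s → F2 δ s - 1 / 2 * dF2 δ s * s = -(1 / 2) * (max s δ - δ) ^ 2 by
    rcases le_total 0 s with h | h
    · rw [abs_of_nonneg h]; exact H s h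
    · rw [abs_of_nonpos h, ← H (-s) (neg_nonneg.2 h), dF2_neg, F2_eq hδ, F2_eq hδ]
      simp only [neg_neg]; ring
  intro s hs
  rcases lt_or_ge s δ with h | h
  · rw [dF2_of_lt (by rw [abs_of_nonneg hs]; exact h.le), F2_of_lt (by rwa [abs_of_nonneg hs]),
      max_eq_right h.le]
    ring
  · rw [dF2_of_ge hδ h, F2_of_ge hδ h, max_eq_left h, Q0, Q1]
    ring

/-- The derivative of `F₂ - ½ F₂' s`, times `s`. -/
lemma dF2_sub_ddF2 (hδ : 0 < δ) (s : ℝ) :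
    (dF2 δ s - ddF2 δ s * s) * s = -(2 * (max |s| δ - δ)) * |s| := by
  suffices H : ∀ s, 0 ≤ s → (dF2 δ s - ddF2 δ s * s) * s = -(2 * (max s δ - δ)) * s by
    rcases le_total 0 s with h | h
    · rw [abs_of_nonneg h]; exact H s h
    · rw [abs_of_nonpos h, ← H (-s) (neg_nonneg.2 h), dF2_neg, ddF2, ddF2]
      simp only [neg_neg]; ring
  intro s hs
  rcases lt_or_ge s δ with h | h
  · rw [dF2_of_lt (by rw [abs_of_nonneg hs]; exact h.le),
      ddF2_of_lt (by rw [abs_of_nonneg hs]; exact h.le), max_eq_right h.le]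
    ring
  · rw [dF2_of_ge hδ h, ddF2_of_ge hδ h, max_eq_left h, Q1, Q2]
    ring

/-- `F₂'(s) / s` is nondecreasing on `(0, ∞)`. -/
lemma dF2_div_mono (hδ : 0 < δ) : MonotoneOn (fun s => dF2 δ s / s) (Ioi 0) := by
  have hd : ∀ x, 0 < x → HasDerivAt (fun s => dF2 δ s / s)
      ((ddF2 δ x * x - dF2 δ x * 1) / x ^ 2) x := fun x hx =>
    (hasDerivAt_dF2 hδ x).div (hasDerivAt_id x) hx.ne'
  refine monotoneOn_of_deriv_nonneg (convex_Ioi 0)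
    (fun x hx => (hd x hx).continuousAt.continuousWithinAt) (fun x hx => ?_) (fun x hx => ?_)
  · rw [interior_Ioi] at hx
    exact (hd x hx).differentiableAt.differentiableWithinAt
  · rw [interior_Ioi] at hx
    have hx' : 0 < x := hx
    rw [(hd x hx).deriv]
    refine div_nonneg ?_ (sq_nonneg x)
    have h1 := dF2_sub_ddF2 hδ x
    rw [abs_of_pos hx'] at h1
    have h2 := mul_right_cancel₀ hx'.ne' h1
    linarith [le_max_right x δ]

/-! ### The growth function `M(s) = F₁(s) + s² + |s|^p` -/

/-- The function `M(s) = F₁(s) + s² + |s|^p`, which controls every nonlinearity of the problem. -/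
def growth (δ p s : ℝ) : ℝ := F1 δ s + s ^ 2 + |s| ^ p

/-- `M(s) / |s|`, with value `0` at `s = 0`. -/
def slope1 (δ p s : ℝ) : ℝ := growth δ p s / |s|

variable {p : ℝ}

lemma growth_abs (s : ℝ) : growth δ p |s| = growth δ p s := by simp [growth, F1_abs]

lemma growth_nonneg (hδ : 0 < δ) (hδ' : δ < Real.exp (-(3 / 2))) (s : ℝ) : 0 ≤ growth δ p s := by
  have := F1_nonneg' hδ hδ' s
  unfold growth; positivity

lemma growth_zero (hδ : 0 < δ) (hp : 2 ≤ p) : growth δ p 0 = 0 := by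
  simp [growth, F1_zero hδ, Real.zero_rpow (by linarith : p ≠ 0)]

lemma slope1_nonneg (hδ : 0 < δ) (hδ' : δ < Real.exp (-(3 / 2))) (s : ℝ) : 0 ≤ slope1 δ p s :=
  div_nonneg (growth_nonneg hδ hδ' s) (abs_nonneg s)

lemma slope1_mul (hδ : 0 < δ) (hp : 2 ≤ p) (s : ℝ) : slope1 δ p s * |s| = growth δ p s := by
  rcases eq_or_ne s 0 with rfl | hs
  · simp [growth_zero hδ hp]
  · exact div_mul_cancel₀ _ (abs_ne_zero.2 hs)

lemma continuous_F1 (hδ : 0 < δ) : Continuous (F1 δ) :=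
  continuous_iff_continuousAt.2 fun s => (hasDerivAt_dF1 hδ s).continuousAt

lemma measurable_growth : Measurable (growth δ p) := by
  unfold growth
  have : Measurable fun s : ℝ => |s| := measurable_norm
  exact (measurable_F1.add (measurable_id.pow_const 2)).add (this.pow_const p)

lemma measurable_slope1 : Measurable (slope1 δ p) := by
  unfold slope1
  exact measurable_growth.div measurable_norm

lemma hasDerivAt_growth (hδ : 0 < δ) {s : ℝ} (hs : 0 < s) :
    HasDerivAt (growth δ p) (dF1 δ s + 2 * s + p * s ^ (p - 1)) s := by
  have h := ((hasDerivAt_dF1 hδ s).add (hasDerivAt_pow 2 s)).add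
    (Real.hasDerivAt_rpow_const (p := p) (Or.inl hs.ne'))
  refine (h.congr_deriv (by simp)).congr_of_eventuallyEq ?_
  filter_upwards [Ioi_mem_nhds hs] with t ht
  simp [growth, abs_of_pos (show 0 < t from ht)]

/-- `M(s) / |s|` grows at least like a power. -/
lemma slope1_growth (hδ : 0 < δ) (hδ' : δ < Real.exp (-(3 / 2))) (hp : 2 ≤ p) {K s t : ℝ}
    (hK : 1 ≤ K) (hst : K * |s| ≤ |t|) :
    K ^ (1 / 3 : ℝ) * slope1 δ p s ≤ slope1 δ p t := by
  rcases eq_or_ne s 0 with rfl | hs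
  · simpa [slope1] using slope1_nonneg hδ hδ' t
  have hs' : 0 < |s| := abs_pos.2 hs
  have hK0 : 0 < K := by linarith
  have hst' : |s| ≤ |t| := (le_mul_of_one_le_left hs'.le hK).trans hst
  have ht' : 0 < |t| := hs'.trans_le hst'
  have h := rpow_mul_le_of_deriv (f := growth δ p)
    (f' := fun s => dF1 δ s + 2 * s + p * s ^ (p - 1)) (a := 4 / 3)
    (fun s hs => hasDerivAt_growth hδ hs) (fun s hs => ?_) hs' hst'
  · rw [growth_abs, growth_abs] at h
    unfold slope1
    have hq : K ≤ |t| / |s| := (le_div_iff₀ hs').2 hst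
    have h3 : K ^ (1 / 3 : ℝ) ≤ (|t| / |s|) ^ (1 / 3 : ℝ) := by gcongr
    have e : (|t| / |s|) ^ (4 / 3 : ℝ) = (|t| / |s|) ^ (1 / 3 : ℝ) * (|t| / |s|) := by
      rw [← Real.rpow_add_one (by positivity)]; norm_num
    rw [e] at h
    rw [le_div_iff₀ ht']
    calc K ^ (1 / 3 : ℝ) * (growth δ p s / |s|) * |t|
        ≤ (|t| / |s|) ^ (1 / 3 : ℝ) * (growth δ p s / |s|) * |t| := by
          have := growth_nonneg hδ hδ' (p := p) s
          gcongr
      _ = (|t| / |s|) ^ (1 / 3 : ℝ) * (|t| / |s|) * growth δ p s := by ring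
      _ ≤ _ := h
  · have h1 := dF1_mul_ge hδ hδ' hs
    have e : s ^ (p - 1) * s = s ^ p := by
      rw [← Real.rpow_add_one hs.ne']; congr 1; ring
    have h2 : 0 ≤ s ^ p := Real.rpow_nonneg hs.le p
    have h3 : (dF1 δ s + 2 * s + p * s ^ (p - 1)) * s = dF1 δ s * s + 2 * s ^ 2 + p * s ^ p := by
      rw [← e]; ring
    simp only [h3, growth, abs_of_pos hs]
    nlinarith

lemma slope1_mono (hδ : 0 < δ) (hδ' : δ < Real.exp (-(3 / 2))) (hp : 2 ≤ p) {s t : ℝ}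
    (hst : |s| ≤ |t|) : slope1 δ p s ≤ slope1 δ p t := by
  simpa using slope1_growth hδ hδ' hp le_rfl (by rwa [one_mul])

/-- The doubling condition for `M`. -/
lemma growth_two_mul (hδ : 0 < δ) (hδ' : δ < Real.exp (-(3 / 2))) (hp : 2 ≤ p) (s : ℝ) :
    growth δ p (2 * s) ≤ 2 ^ p * growth δ p s := by
  rcases eq_or_ne s 0 with rfl | hs
  · simp [growth_zero hδ hp]
  have hs' : 0 < |s| := abs_pos.2 hs
  have h := le_rpow_mul_of_deriv (f := growth δ p)
    (f' := fun s => dF1 δ s + 2 * s + p * s ^ (p - 1)) (a := p)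
    (fun s hs => hasDerivAt_growth hδ hs) (fun s hs => ?_) hs' (t := 2 * |s|) (by linarith)
  · rw [mul_div_cancel_right₀ _ hs'.ne', growth_abs, ← growth_abs, abs_mul, abs_abs, ← abs_mul,
      growth_abs] at h
    exact h
  · have h1 := dF1_mul_le hδ hs
    have e : s ^ (p - 1) * s = s ^ p := by
      rw [← Real.rpow_add_one hs.ne']; congr 1; ring
    have h3 : (dF1 δ s + 2 * s + p * s ^ (p - 1)) * s = dF1 δ s * s + 2 * s ^ 2 + p * s ^ p := by
      rw [← e]; ring
    have h4 := F1_nonneg hδ hδ' hs.le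
    simp only [h3, growth, abs_of_pos hs]
    nlinarith [sq_nonneg s]

end Scalar

/-! ### The truncated nonlinearity -/

namespace PenalizedProblem

variable {N : ℕ} (D : PenalizedProblem N)

lemma t₁_lt_t₂ : D.t₁ < D.t₂ := D.t₁_lt_a₀.trans D.a₀_lt_t₂

lemma F2bar'_of_le {s : ℝ} (h : s ≤ D.a₀) : F2bar' D.δ D.b₀ D.a₀ s = dF2 D.δ s := by
  rw [F2bar', if_pos h, deriv_F2 D.δ_pos]

lemma F2bar'_of_gt {s : ℝ} (h : D.a₀ < s) : F2bar' D.δ D.b₀ D.a₀ s = D.b₀ * s := by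
  rw [F2bar', if_neg (not_le.2 h)]

lemma F2tilde'_of_le {s : ℝ} (h : s ≤ D.t₁) : D.F2tilde' s = dF2 D.δ s := by
  unfold F2tilde'
  split_ifs with h1
  · have : s = D.t₁ := le_antisymm h h1.1
    rw [this, D.h_t₁, D.F2bar'_of_le D.t₁_lt_a₀.le]
  · exact D.F2bar'_of_le (h.trans D.t₁_lt_a₀.le)

lemma F2tilde'_of_mem {s : ℝ} (h : s ∈ Icc D.t₁ D.t₂) : D.F2tilde' s = D.h s := by
  unfold F2tilde'
  rw [if_pos h]

lemma F2tilde'_of_ge {s : ℝ} (h : D.t₂ ≤ s) : D.F2tilde' s = D.b₀ * s := by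
  unfold F2tilde'
  split_ifs with h1
  · have : s = D.t₂ := le_antisymm h1.2 h
    rw [this, D.h_t₂, D.F2bar'_of_gt D.a₀_lt_t₂]
  · exact D.F2bar'_of_gt (D.a₀_lt_t₂.trans_le h)

lemma derivWithin_h_t₁ : derivWithin D.h (Icc D.t₁ D.t₂) D.t₁ = ddF2 D.δ D.t₁ := by
  rw [D.deriv_h_t₁]
  refine ((hasDerivAt_dF2 D.δ_pos _).congr_of_eventuallyEq ?_).deriv
  filter_upwards [Iio_mem_nhds D.t₁_lt_a₀] with s hs using D.F2bar'_of_le (le_of_lt hs)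

lemma derivWithin_h_t₂ : derivWithin D.h (Icc D.t₁ D.t₂) D.t₂ = D.b₀ := by
  rw [D.deriv_h_t₂]
  have : HasDerivAt (fun s => D.b₀ * s) D.b₀ D.t₂ := by
    simpa using (hasDerivAt_id D.t₂).const_mul D.b₀
  refine (this.congr_of_eventuallyEq ?_).deriv
  filter_upwards [Ioi_mem_nhds D.a₀_lt_t₂] with s hs using D.F2bar'_of_gt hs

/-- The derivative of the truncated nonlinearity `F2tilde'`. -/
def dF2tilde' (s : ℝ) : ℝ :=
  if s ≤ D.t₁ then ddF2 D.δ s else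
    if s ≤ D.t₂ then IccExtend D.t₁_lt_t₂.le
      (fun t => derivWithin D.h (Icc D.t₁ D.t₂) t) s else D.b₀

lemma continuous_dF2tilde' : Continuous D.dF2tilde' := by
  unfold dF2tilde'
  refine Continuous.if_le (continuous_ddF2 D.δ_pos) ?_ continuous_id continuous_const ?_
  · refine Continuous.if_le ?_ continuous_const continuous_id continuous_const ?_
    · have := D.contDiffOn_h.continuousOn_derivWithin (uniqueDiffOn_Icc D.t₁_lt_t₂) le_rfl
      exact (continuousOn_iff_continuous_domRestrict.1 this).Icc_extend'
    · intro s hs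
      rw [hs, IccExtend_right]
      exact D.derivWithin_h_t₂
  · intro s hs
    rw [hs, if_pos D.t₁_lt_t₂.le, IccExtend_left]
    exact D.derivWithin_h_t₁.symm

lemma hasDerivAt_F2tilde' (s : ℝ) : HasDerivAt D.F2tilde' (D.dF2tilde' s) s := by
  have hh : ∀ s ∈ Icc D.t₁ D.t₂,
      HasDerivWithinAt D.F2tilde' (derivWithin D.h (Icc D.t₁ D.t₂) s) (Icc D.t₁ D.t₂) s := by
    intro s hs
    exact ((D.contDiffOn_h.differentiableOn one_ne_zero) s hs).hasDerivWithinAt.congr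
      (fun t ht => D.F2tilde'_of_mem ht) (D.F2tilde'_of_mem hs)
  have hb : ∀ s, HasDerivAt (fun s => D.b₀ * s) D.b₀ s := fun s => by
    simpa using (hasDerivAt_id s).const_mul D.b₀
  rcases lt_trichotomy s D.t₁ with h1 | h1 | h1
  · rw [dF2tilde', if_pos h1.le]
    refine (hasDerivAt_dF2 D.δ_pos s).congr_of_eventuallyEq ?_
    filter_upwards [Iio_mem_nhds h1] with t ht using D.F2tilde'_of_le (le_of_lt ht)
  · subst h1
    rw [dF2tilde', if_pos le_rfl]
    have l : HasDerivWithinAt D.F2tilde' (ddF2 D.δ D.t₁) (Iic D.t₁) D.t₁ :=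
      (hasDerivAt_dF2 D.δ_pos _).hasDerivWithinAt.congr (fun t ht => D.F2tilde'_of_le ht)
        (D.F2tilde'_of_le le_rfl)
    have r : HasDerivWithinAt D.F2tilde' (ddF2 D.δ D.t₁) (Ici D.t₁) D.t₁ := by
      rw [← D.derivWithin_h_t₁]
      exact (hh _ (left_mem_Icc.2 D.t₁_lt_t₂.le)).mono_of_mem_nhdsWithin
        (Icc_mem_nhdsGE D.t₁_lt_t₂)
    have := l.union r
    rwa [Iic_union_Ici, hasDerivWithinAt_univ] at this
  · rw [dF2tilde', if_neg (not_le.2 h1)]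
    rcases lt_trichotomy s D.t₂ with h2 | h2 | h2
    · rw [if_pos h2.le, IccExtend_of_mem _ _ (show s ∈ Icc D.t₁ D.t₂ from ⟨h1.le, h2.le⟩)]
      exact (hh s ⟨h1.le, h2.le⟩).hasDerivAt (Icc_mem_nhds h1 h2)
    · subst h2
      rw [if_pos le_rfl, IccExtend_right, D.derivWithin_h_t₂]
      have r : HasDerivWithinAt D.F2tilde' D.b₀ (Ici D.t₂) D.t₂ :=
        (hb _).hasDerivWithinAt.congr (fun t ht => D.F2tilde'_of_ge ht) (D.F2tilde'_of_ge le_rfl)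
      have l : HasDerivWithinAt D.F2tilde' D.b₀ (Iic D.t₂) D.t₂ := by
        rw [← D.derivWithin_h_t₂]
        exact (hh _ (right_mem_Icc.2 D.t₁_lt_t₂.le)).mono_of_mem_nhdsWithin
          (Icc_mem_nhdsLE D.t₁_lt_t₂)
      have := l.union r
      rwa [Iic_union_Ici, hasDerivWithinAt_univ] at this
    · rw [if_neg (not_le.2 h2)]
      refine (hb s).congr_of_eventuallyEq ?_
      filter_upwards [Ioi_mem_nhds h2] with t ht using D.F2tilde'_of_ge (le_of_lt ht)

/-- The truncated nonlinearity, extended to an odd function. -/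
def gt (s : ℝ) : ℝ := if 0 ≤ s then D.F2tilde' s else -D.F2tilde' (-s)

/-- The primitive of the odd extension of the truncated nonlinearity. -/
def Gt (s : ℝ) : ℝ := ∫ τ in (0 : ℝ)..s, D.gt τ

lemma gt_of_nonneg {s : ℝ} (hs : 0 ≤ s) : D.gt s = D.F2tilde' s := if_pos hs

lemma gt_of_neg {s : ℝ} (hs : s < 0) : D.gt s = -D.F2tilde' (-s) := if_neg (not_le.2 hs)

lemma gt_of_abs_le {s : ℝ} (hs : |s| ≤ D.t₁) : D.gt s = dF2 D.δ s := by
  rw [abs_le] at hs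
  unfold gt
  split_ifs
  · exact D.F2tilde'_of_le hs.2
  · rw [D.F2tilde'_of_le (by linarith), dF2_neg, neg_neg]

lemma gt_zero : D.gt 0 = 0 := by
  rw [D.gt_of_abs_le (by simpa using D.t₁_pos.le), dF2_of_lt (by simpa using D.δ_pos.le)]

lemma gt_neg (s : ℝ) : D.gt (-s) = -D.gt s := by
  rcases lt_trichotomy s 0 with h | h | h
  · rw [D.gt_of_neg h, D.gt_of_nonneg (by linarith), neg_neg]
  · subst h; simp [gt_zero]
  · rw [D.gt_of_neg (by linarith), D.gt_of_nonneg h.le, neg_neg]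

lemma hasDerivAt_gt (s : ℝ) : HasDerivAt D.gt (D.dF2tilde' |s|) s := by
  rcases lt_trichotomy s 0 with h | h | h
  · rw [abs_of_neg h]
    have := ((D.hasDerivAt_F2tilde' (-s)).comp s (hasDerivAt_neg s)).neg
    refine (this.congr_deriv (by simp)).congr_of_eventuallyEq ?_
    filter_upwards [Iio_mem_nhds h] with t ht using D.gt_of_neg ht
  · subst h
    have h0 : D.dF2tilde' |(0 : ℝ)| = ddF2 D.δ 0 := by
      rw [abs_zero, dF2tilde', if_pos D.t₁_pos.le]
    rw [h0]
    refine (hasDerivAt_dF2 D.δ_pos 0).congr_of_eventuallyEq ?_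
    filter_upwards [Ioo_mem_nhds (neg_lt_zero.2 D.t₁_pos) D.t₁_pos] with t ht
    exact D.gt_of_abs_le (abs_le.2 ⟨ht.1.le, ht.2.le⟩)
  · rw [abs_of_pos h]
    refine (D.hasDerivAt_F2tilde' s).congr_of_eventuallyEq ?_
    filter_upwards [Ioi_mem_nhds h] with t ht using D.gt_of_nonneg (le_of_lt ht)

lemma continuous_gt : Continuous D.gt :=
  continuous_iff_continuousAt.2 fun s => (D.hasDerivAt_gt s).continuousAt

lemma hasDerivAt_Gt (s : ℝ) : HasDerivAt D.Gt (D.gt s) s :=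
  D.continuous_gt.integral_hasStrictDerivAt 0 s |>.hasDerivAt

lemma Gt_zero : D.Gt 0 = 0 := by simp [Gt]

lemma exists_bound_dF2tilde' : ∃ C : ℝ, 0 ≤ C ∧ ∀ s, |D.dF2tilde' (|s|)| ≤ C := by
  obtain ⟨C, hC⟩ := isCompact_Icc.exists_bound_of_continuousOn (s := Icc 0 D.t₂)
    D.continuous_dF2tilde'.continuousOn
  refine ⟨max C D.b₀, le_max_of_le_right D.b₀_pos.le, fun s => ?_⟩
  rcases le_or_gt |s| D.t₂ with h | h
  · exact (hC _ ⟨abs_nonneg s, h⟩).trans (le_max_left _ _)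
  · rw [dF2tilde', if_neg (not_le.2 (D.t₁_lt_t₂.trans h)), if_neg (not_le.2 h),
      abs_of_pos D.b₀_pos]
    exact le_max_right _ _

/-- The truncated nonlinearity divided by `s` is nondecreasing on `(0, ∞)`. -/
lemma gt_div_mono : MonotoneOn (fun s => D.gt s / s) (Ioi 0) := by
  have h1 : MonotoneOn (fun s => D.gt s / s) (Ioc 0 D.t₁) := by
    refine ((dF2_div_mono D.δ_pos).mono Ioc_subset_Ioi_self).congr fun s hs => ?_
    simp only
    rw [D.gt_of_nonneg hs.1.le, D.F2tilde'_of_le hs.2]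
  have h2 : MonotoneOn (fun s => D.gt s / s) (Icc D.t₁ D.t₂) := by
    refine D.h_div_mono.congr fun s hs => ?_
    simp only
    rw [D.gt_of_nonneg (D.t₁_pos.le.trans hs.1), D.F2tilde'_of_mem hs]
  have h3 : MonotoneOn (fun s => D.gt s / s) (Ici D.t₂) := by
    refine (monotoneOn_const (c := D.b₀)).congr fun s hs => ?_
    have hs0 : 0 < s := (D.t₁_pos.trans D.t₁_lt_t₂).trans_le hs
    simp only
    rw [D.gt_of_nonneg hs0.le, D.F2tilde'_of_ge hs, mul_div_cancel_right₀ _ hs0.ne']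
  have h23 := h2.union_right h3 ⟨right_mem_Icc.2 D.t₁_lt_t₂.le, fun x hx => hx.2⟩
    ⟨mem_Ici.2 le_rfl, fun x hx => hx⟩
  rw [Icc_union_Ici_eq_Ici D.t₁_lt_t₂.le] at h23
  have := h1.union_right h23 ⟨right_mem_Ioc.2 D.t₁_pos, fun x hx => hx.2⟩
    ⟨mem_Ici.2 le_rfl, fun x hx => hx⟩
  rwa [Ioc_union_Ici_eq_Ioi D.t₁_pos] at this

lemma gt_mul_nonneg (s : ℝ) : 0 ≤ D.gt s * s := by
  suffices H : ∀ s, 0 < s → 0 ≤ D.gt s * s by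
    rcases lt_trichotomy s 0 with h | h | h
    · have := H (-s) (by linarith)
      rw [gt_neg] at this; linarith
    · simp [h]
    · exact H s h
  intro s hs
  rcases le_total s D.t₁ with h | h
  · rw [D.gt_of_abs_le (by rwa [abs_of_pos hs])]
    exact dF2_mul_nonneg D.δ_pos s
  · have h1 : D.gt D.t₁ / D.t₁ ≤ D.gt s / s := D.gt_div_mono D.t₁_pos hs h
    have h2 : 0 ≤ D.gt D.t₁ / D.t₁ := by
      rw [D.gt_of_abs_le (by rw [abs_of_pos D.t₁_pos])]
      exact div_nonneg (dF2_nonneg D.δ_pos D.t₁_pos.le) D.t₁_pos.le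
    have h3 := mul_nonneg (h2.trans h1) (mul_pos hs hs).le
    calc (0 : ℝ) ≤ _ := h3
      _ = _ := by field_simp

lemma gt_mul_le (s : ℝ) : D.gt s * s ≤ D.b₀ * s ^ 2 := by
  suffices H : ∀ s, 0 < s → D.gt s * s ≤ D.b₀ * s ^ 2 by
    rcases lt_trichotomy s 0 with h | h | h
    · have := H (-s) (by linarith)
      rw [gt_neg] at this; linarith [neg_sq s]
    · simp [h]
    · exact H s h
  intro s hs
  have ht := D.t₁_pos.trans D.t₁_lt_t₂
  have h1 : D.gt s / s ≤ D.gt (max s D.t₂) / max s D.t₂ :=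
    D.gt_div_mono hs (mem_Ioi.2 (hs.trans_le (le_max_left _ _))) (le_max_left _ _)
  have h0 : 0 < max s D.t₂ := lt_max_of_lt_left hs
  rw [D.gt_of_nonneg h0.le, D.F2tilde'_of_ge (le_max_right _ _),
    mul_div_cancel_right₀ _ h0.ne', div_le_iff₀ hs] at h1
  nlinarith

lemma abs_gt_le (s : ℝ) : |D.gt s| ≤ D.b₀ * |s| := by
  rcases eq_or_ne s 0 with rfl | hs
  · simp [gt_zero]
  · have h1 := D.gt_mul_le s
    have h2 := D.gt_mul_nonneg s
    have h3 : |D.gt s| * |s| ≤ D.b₀ * |s| * |s| := by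
      rw [← abs_mul, abs_of_nonneg h2, mul_assoc, ← sq, sq_abs]
      exact h1
    exact le_of_mul_le_mul_right h3 (abs_pos.2 hs)

/-- Monotonicity of `gt s / s` in differential form. -/
lemma gt_le_deriv (s : ℝ) : D.gt s * s ≤ D.dF2tilde' |s| * s * s := by
  suffices H : ∀ s, 0 < s → D.gt s * s ≤ D.dF2tilde' |s| * s * s by
    rcases lt_trichotomy s 0 with h | h | h
    · have := H (-s) (by linarith)
      rw [gt_neg, abs_neg] at this; linarith
    · simp [h]
    · exact H s h
  intro s hs
  have hd := (D.hasDerivAt_gt s).div (hasDerivAt_id s) hs.ne'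
  have h1 : 0 ≤ derivWithin (fun s => D.gt s / s) (Ioi 0) s := D.gt_div_mono.derivWithin_nonneg
  rw [derivWithin_of_mem_nhds (Ioi_mem_nhds hs)] at h1
  have e : deriv (fun s => D.gt s / s) s = _ := hd.deriv
  rw [e] at h1
  simp only [id, mul_one] at h1
  have h2 := mul_nonneg h1 (pow_pos hs 2).le
  rw [div_mul_cancel₀ _ (by positivity)] at h2
  nlinarith

lemma Gt_even (s : ℝ) : D.Gt (-s) = D.Gt s := by
  have h := intervalIntegral.integral_comp_neg (f := D.gt) (a := 0) (b := s)
  simp only [gt_neg, intervalIntegral.integral_neg, neg_zero] at h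
  unfold Gt
  rw [intervalIntegral.integral_symm (-s) 0, ← h, neg_neg]

lemma Gt_le_half (s : ℝ) : D.Gt s ≤ 1 / 2 * D.gt s * s := by
  suffices H : ∀ s, 0 ≤ s → D.Gt s ≤ 1 / 2 * D.gt s * s by
    rcases le_total 0 s with h | h
    · exact H s h
    · have := H (-s) (by linarith)
      rw [gt_neg, Gt_even] at this; linarith
  intro s hs
  have hd : ∀ s, HasDerivAt (fun s => 1 / 2 * D.gt s * s - D.Gt s)
      (1 / 2 * D.dF2tilde' |s| * s + 1 / 2 * D.gt s * 1 - D.gt s) s := fun s =>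
    (((D.hasDerivAt_gt s).const_mul (1 / 2)).mul (hasDerivAt_id s)).sub (D.hasDerivAt_Gt s)
  have hm : MonotoneOn (fun s => 1 / 2 * D.gt s * s - D.Gt s) (Ici 0) := by
    refine monotoneOn_of_deriv_nonneg (convex_Ici 0)
      (fun x _ => (hd x).continuousAt.continuousWithinAt)
      (fun x _ => (hd x).differentiableAt.differentiableWithinAt) fun x hx => ?_
    rw [interior_Ici] at hx
    have hx' : 0 < x := hx
    rw [(hd x).deriv]
    have h := le_of_mul_le_mul_right (D.gt_le_deriv x) hx'
    linarith
  have := hm (mem_Ici.2 le_rfl) (mem_Ici.2 hs) hs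
  simp only [gt_zero, Gt_zero] at this
  linarith

lemma g2_eq (x : EuclideanSpace ℝ (Fin N)) (t : ℝ) :
    D.g2 x t = D.Λ.indicator 1 x * dF2 D.δ t + (1 - D.Λ.indicator 1 x) * D.gt t := by
  unfold g2 g2pos gt
  rw [deriv_F2 D.δ_pos]
  split_ifs with h
  · rfl
  · rw [dF2_neg]; ring

lemma F2_zero {δ : ℝ} (hδ : 0 < δ) : F2 δ 0 = 0 := F2_of_lt (by simpa using hδ)

lemma G2_eq (x : EuclideanSpace ℝ (Fin N)) (t : ℝ) :
    D.G2 x t = D.Λ.indicator 1 x * F2 D.δ t + (1 - D.Λ.indicator 1 x) * D.Gt t := by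
  unfold G2 Gt
  simp only [g2_eq]
  rw [intervalIntegral.integral_add, intervalIntegral.integral_const_mul,
    intervalIntegral.integral_const_mul,
    intervalIntegral.integral_eq_sub_of_hasDerivAt (f := F2 D.δ)
      (fun s _ => hasDerivAt_F2 D.δ_pos s), F2_zero D.δ_pos, sub_zero]
  · exact (continuous_dF2 D.δ_pos).intervalIntegrable _ _
  · exact (continuous_const.mul (continuous_dF2 D.δ_pos)).intervalIntegrable _ _
  · exact (continuous_const.mul D.continuous_gt).intervalIntegrable _ _

end PenalizedProblem

/-! ### Regular level sets are hypersurfaces -/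

section Hypersurface

variable {E : Type*} [NormedAddCommGroup E] [NormedSpace ℝ E]

/-- The continuous linear automorphism `v ↦ v + l(v) e`, for `1 + l(e) ≠ 0`. -/
def rankOneEquiv (l : E →L[ℝ] ℝ) (e : E) (h : 1 + l e ≠ 0) : E ≃L[ℝ] E :=
  ContinuousLinearEquiv.equivOfInverse
    (ContinuousLinearMap.id ℝ E + l.smulRight e)
    (ContinuousLinearMap.id ℝ E - ((1 + l e)⁻¹ • l).smulRight e)
    (fun v => by
      simp only [add_apply, sub_apply, ContinuousLinearMap.smulRight_apply,
        ContinuousLinearMap.id_apply, smul_apply, map_add, map_smul, smul_eq_mul]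
      have h1 : l v - (1 + l e)⁻¹ * (l v + l v * l e) = 0 := by field_simp; ring
      calc _ = v + (l v - (1 + l e)⁻¹ * (l v + l v * l e)) • e := by module
        _ = v := by rw [h1, zero_smul, add_zero])
    (fun v => by
      simp only [add_apply, sub_apply, ContinuousLinearMap.smulRight_apply,
        ContinuousLinearMap.id_apply, smul_apply, map_sub, map_smul, smul_eq_mul]
      have h1 : l v - (1 + l e)⁻¹ * l v - (1 + l e)⁻¹ * l v * l e = 0 := by field_simp; ring
      calc _ = v + (l v - (1 + l e)⁻¹ * l v - (1 + l e)⁻¹ * l v * l e) • e := by module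
        _ = v := by rw [h1, zero_smul, add_zero])

/-- Two nonzero functionals are simultaneously nonzero at some vector. -/
lemma exists_apply_ne_zero_and {l k : E →L[ℝ] ℝ} (hl : l ≠ 0) (hk : k ≠ 0) :
    ∃ e, l e ≠ 0 ∧ k e ≠ 0 := by
  obtain ⟨a, ha⟩ : ∃ a, l a ≠ 0 := by
    by_contra! h; exact hl (ContinuousLinearMap.ext h)
  obtain ⟨b, hb⟩ : ∃ b, k b ≠ 0 := by
    by_contra! h; exact hk (ContinuousLinearMap.ext h)
  by_cases h1 : k a = 0
  · by_cases h2 : l b = 0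
    · exact ⟨a + b, by rwa [map_add, h2, add_zero], by rwa [map_add, h1, zero_add]⟩
    · exact ⟨b, h2, hb⟩
  · exact ⟨a, ha, h1⟩

/-- The regular part of the zero set of a `C¹` function on a nontrivial Banach space is a
hypersurface. With a fixed functional `l ≠ 0` and a vector `e` such that `l e = 1` and
`f'(u) e ≠ 0`, the map `x ↦ x - l(x) e + f(x) e` straightens `{f = 0}` to `ker l` near `u`. -/
lemma isC1Hypersurface_of_regular [CompleteSpace E] [Nontrivial E] {f : E → ℝ}
    (hf : ContDiff ℝ 1 f) {U S : Set E} (hU : IsOpen U) (hS : ∀ x ∈ U, x ∈ S ↔ f x = 0)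
    (hSU : S ⊆ U) (hreg : ∀ u ∈ S, fderiv ℝ f u ≠ 0) : IsC1Hypersurface S := by
  obtain ⟨w, hw⟩ := exists_ne (0 : E)
  obtain ⟨l, hl⟩ := SeparatingDual.exists_ne_zero (R := ℝ) hw
  have hl0 : l ≠ 0 := by rintro rfl; simp at hl
  refine ⟨LinearMap.ker (l : E →ₗ[ℝ] ℝ), l.isClosed_ker, ?_, ?_⟩
  · have hsurj : Function.Surjective (l : E →ₗ[ℝ] ℝ) := by
      apply LinearMap.surjective
      intro h
      apply hl
      have := LinearMap.congr_fun h w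
      simpa using this
    rw [((l : E →ₗ[ℝ] ℝ).quotKerEquivOfSurjective hsurj).finrank_eq, Module.finrank_self]
  intro u hu
  obtain ⟨e₀, he₀, hfe₀⟩ := exists_apply_ne_zero_and hl0 (hreg u hu)
  set e : E := (l e₀)⁻¹ • e₀ with he
  have hle : l e = 1 := by simp [he, he₀]
  have hfe : fderiv ℝ f u e ≠ 0 := by simp [he, he₀, hfe₀]
  set φ : E → E := fun x => x + (f x - l x) • e with hφ
  have hφC : ContDiff ℝ 1 φ := contDiff_id.add ((hf.sub l.contDiff).smul contDiff_const)
  have hφd : ∀ x, HasFDerivAt φ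
      (ContinuousLinearMap.id ℝ E + (fderiv ℝ f x - l).smulRight e) x := fun x =>
    (hasFDerivAt_id x).add
      ((((hf.differentiable one_ne_zero) x).hasFDerivAt.sub l.hasFDerivAt).smul_const e)
  have hinv : ∀ x, fderiv ℝ f x e ≠ 0 → 1 + (fderiv ℝ f x - l) e ≠ 0 := by
    intro x hx
    rw [sub_apply, hle]
    simpa using hx
  have hlφ : ∀ x, l (φ x) = f x := fun x => by simp [hφ, hle]
  have hd : HasFDerivAt φ (rankOneEquiv (fderiv ℝ f u - l) e (hinv u hfe) : E →L[ℝ] E) u := hφd u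
  set Φ := hφC.contDiffAt.toOpenPartialHomeomorph φ hd one_ne_zero with hΦ
  have hΦφ : (Φ : E → E) = φ := rfl
  have hV : IsOpen (U ∩ {x | fderiv ℝ f x e ≠ 0}) := by
    refine hU.inter ?_
    exact isOpen_ne_fun ((hf.continuous_fderiv one_ne_zero).clm_apply continuous_const)
      continuous_const
  refine ⟨Φ.restrOpen _ hV, ?_, ?_, ?_, ?_⟩
  · rw [OpenPartialHomeomorph.restrOpen_source]
    exact ⟨hφC.contDiffAt.mem_toOpenPartialHomeomorph_source hd one_ne_zero, hSU hu, hfe⟩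
  · exact hφC.contDiffOn
  · intro y hy
    refine ContDiffAt.contDiffWithinAt ?_
    have hx := (Φ.restrOpen _ hV).map_target hy
    rw [OpenPartialHomeomorph.restrOpen_source] at hx
    refine (Φ.restrOpen _ hV).contDiffAt_symm (f₀' := rankOneEquiv (fderiv ℝ f _ - l) e
      (hinv _ hx.2.2)) hy ?_ ?_
    · exact hφd _
    · exact hφC.contDiffAt
  · intro x hx
    rw [OpenPartialHomeomorph.restrOpen_source] at hx
    rw [hS x hx.2.1]
    change _ ↔ l (φ x) = 0
    rw [hlφ]

end Hypersurface

/-! ### Translations and averages of functions with a weak gradient -/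

section Average

variable {N : ℕ}

lemma eLpNorm_two_sq {α F : Type*} [MeasurableSpace α] [NormedAddCommGroup F] (ν : Measure α)
    (f : α → F) : eLpNorm f 2 ν ^ 2 = ∫⁻ x, ‖f x‖ₑ ^ 2 ∂ν := by
  have := eLpNorm_nnreal_pow_eq_lintegral (μ := ν) (f := f) (p := 2) two_ne_zero
  simpa using this

lemma lintegral_Lp_sq {α F : Type*} [MeasurableSpace α] [NormedAddCommGroup F] {ν : Measure α}
    (f : Lp F 2 ν) : ∫⁻ x, ‖f x‖ₑ ^ 2 ∂ν = ENNReal.ofReal (‖f‖ ^ 2) := by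
  rw [← eLpNorm_two_sq, Lp.norm_def, ENNReal.ofReal_pow ENNReal.toReal_nonneg,
    ENNReal.ofReal_toReal (Lp.eLpNorm_ne_top f)]

/-- Jensen's inequality for the square. -/
lemma enorm_integral_sq_le {α : Type*} [MeasurableSpace α] {ν : Measure α}
    [IsProbabilityMeasure ν] {f : α → ℝ} (hf : AEStronglyMeasurable f ν) :
    ‖∫ y, f y ∂ν‖ₑ ^ 2 ≤ ∫⁻ y, ‖f y‖ₑ ^ 2 ∂ν := by
  rw [← eLpNorm_two_sq]
  gcongr
  refine (enorm_integral_le_lintegral_enorm f).trans ?_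
  rw [← eLpNorm_one_eq_lintegral_enorm]
  exact eLpNorm_le_eLpNorm_of_exponent_le one_le_two hf

lemma abs_integral_mul_le {α : Type*} [MeasurableSpace α] {ν : Measure α} {f h : α → ℝ}
    (hf : MemLp f 2 ν) (hh : MemLp h 2 ν) :
    |∫ x, f x * h x ∂ν| ≤ (eLpNorm f 2 ν).toReal * (eLpNorm h 2 ν).toReal := by
  have h1 := abs_real_inner_le_norm (hf.toLp f) (hh.toLp h)
  rw [L2.inner_def, Lp.norm_toLp, Lp.norm_toLp] at h1
  refine le_of_eq_of_le ?_ h1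
  congr 1
  refine integral_congr_ae ?_
  filter_upwards [hf.coeFn_toLp, hh.coeFn_toLp] with x hx hy
  rw [hx, hy]
  simp [mul_comm]

/-- Testing against a translated function: the weak form of
`u(x + y) - u(x) = ∫₀¹ ⟨∇u(x + t y), y⟩ dt`. -/
lemma HasWeakGradient.abs_integral_translate_le {u : EuclideanSpace ℝ (Fin N) → ℝ}
    {g : EuclideanSpace ℝ (Fin N) → EuclideanSpace ℝ (Fin N)}
    (h : HasWeakGradient u g) (hu : MemLp u 2) (hg : MemLp g 2)
    {φ : EuclideanSpace ℝ (Fin N) → ℝ} (hφ : ContDiff ℝ ∞ φ) (hφc : HasCompactSupport φ)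
    (y : EuclideanSpace ℝ (Fin N)) :
    |∫ x, (u (x + y) - u x) * φ x| ≤
      ‖y‖ * (eLpNorm g 2).toReal * (eLpNorm φ 2).toReal := by
  have hul : LocallyIntegrable u := hu.locallyIntegrable (by norm_num)
  have hφ2 : MemLp φ 2 := hφ.continuous.memLp_of_hasCompactSupport hφc
  set ψ : EuclideanSpace ℝ (Fin N) → ℝ := fun w => φ (-w) with hψ
  have hψC : ContDiff ℝ 1 ψ := (hφ.of_le (by simp)).comp contDiff_neg
  have hψc : HasCompactSupport ψ := hφc.comp_homeomorph (Homeomorph.neg _)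
  set L := ContinuousLinearMap.mul ℝ ℝ with hL
  -- as a convolution, `c` is differentiable even though `u` need not be; the derivative falls on
  -- `φ` and is moved to `g` by the definition of the weak gradient
  set c : ℝ → ℝ := fun t => ∫ x, u x * φ (x - t • y) with hc
  have hcψ : ∀ t, c t = (convolution u ψ L volume) (t • y) := by
    intro t
    simp only [hc, convolution_def, hψ, hL, ContinuousLinearMap.mul_apply', neg_sub]
  have hfd : ∀ w, fderiv ℝ ψ w = -(fderiv ℝ φ (-w)) := by
    intro w
    have h1 : HasFDerivAt φ (fderiv ℝ φ (-w)) (-w) :=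
      ((hφ.differentiable (by simp)) (-w)).hasFDerivAt
    have h2 := h1.comp w (hasFDerivAt_id w).neg
    rw [show ψ = φ ∘ fun w => -w from rfl]
    refine h2.fderiv.trans ?_
    ext; simp
  have hd : ∀ t, HasDerivAt c (∫ x, ⟪g x, y⟫_ℝ * φ (x - t • y)) t := by
    intro t
    have h1 := hψc.hasFDerivAt_convolution_right L hul hψC (μ := volume) (t • y)
    have h2 : HasDerivAt (fun t : ℝ => t • y) y t := by
      simpa using (hasDerivAt_id t).smul_const y
    have h3 := h1.comp_hasDerivAt t h2
    have e : c = (convolution u ψ L volume) ∘ fun t => t • y := funext hcψ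
    rw [e]
    refine h3.congr_deriv ?_
    rw [convolution_precompR_apply L hul (hψc.fderiv (𝕜 := ℝ))
      (hψC.continuous_fderiv (by simp)), convolution_def]
    have h4 := h (fun x => φ (x - t • y)) (hφ.comp (contDiff_id.sub contDiff_const))
      (hφc.comp_homeomorph (Homeomorph.subRight (t • y))) y
    rw [← neg_eq_iff_eq_neg] at h4
    rw [← h4, ← integral_neg]
    refine integral_congr_ae (ae_of_all _ fun x => ?_)
    have h5 : fderiv ℝ (fun x => φ (x - t • y)) x = fderiv ℝ φ (x - t • y) :=
      fderiv_comp_sub (f := φ) (t • y)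
    simp only [hL, ContinuousLinearMap.mul_apply', hfd, h5, neg_sub, neg_apply]
    ring
  have hbound : ∀ t : ℝ, ‖(∫ x, ⟪g x, y⟫_ℝ * φ (x - t • y))‖ ≤
      ‖y‖ * (eLpNorm g 2).toReal * (eLpNorm φ 2).toReal := by
    intro t
    have hmp := measurePreserving_sub_right (volume : Measure (EuclideanSpace ℝ (Fin N))) (t • y)
    have hφt : MemLp (fun x => φ (x - t • y)) 2 := hφ2.comp_measurePreserving hmp
    have hgy : MemLp (fun x => ⟪g x, y⟫_ℝ) 2 := hg.inner_const y
    refine (abs_integral_mul_le hgy hφt).trans ?_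
    have e1 : eLpNorm (fun x => φ (x - t • y)) 2 = eLpNorm φ 2 :=
      eLpNorm_comp_measurePreserving hφ2.1 hmp
    have e2 : eLpNorm (fun x => ⟪g x, y⟫_ℝ) 2 volume ≤ ENNReal.ofReal ‖y‖ * eLpNorm g 2 := by
      refine eLpNorm_le_mul_eLpNorm_of_ae_le_mul (ae_of_all _ fun x => ?_) 2
      rw [mul_comm]; exact norm_inner_le_norm _ _
    rw [e1]
    gcongr
    rw [← ENNReal.toReal_ofReal (norm_nonneg y), ← ENNReal.toReal_mul]
    exact ENNReal.toReal_mono (ENNReal.mul_ne_top ENNReal.ofReal_ne_top hg.2.ne) e2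
  have hmv := (convex_univ : Convex ℝ (univ : Set ℝ)).norm_image_sub_le_of_norm_hasDerivWithin_le
    (fun t _ => (hd t).hasDerivWithinAt) (fun t _ => hbound t) (mem_univ 0) (mem_univ 1)
  have e3 : ∫ x, (u (x + y) - u x) * φ x = c 1 - c 0 := by
    have i1 : ∫ x, u (x + y) * φ x = ∫ x, u x * φ (x - y) := by
      rw [← integral_sub_right_eq_self (fun x => u (x + y) * φ x) y]
      simp
    have I2 : Integrable fun x => u x * φ x := by
      simpa [mul_comm] using hul.integrable_smul_left_of_hasCompactSupport hφ.continuous hφc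
    have I1 : Integrable fun x => u (x + y) * φ x := by
      have hu' : MemLp (fun x => u (x + y)) 2 :=
        hu.comp_measurePreserving (measurePreserving_add_right _ y)
      exact hu'.integrable_mul hφ2
    simp only [sub_mul]
    rw [integral_sub I1 I2, i1]
    simp [hc]
  rw [e3]
  simpa using hmv

/-- A function with a square integrable weak gradient is Lipschitz under translations in `L²`. -/
lemma HasWeakGradient.eLpNorm_translate_le {u : EuclideanSpace ℝ (Fin N) → ℝ}
    {g : EuclideanSpace ℝ (Fin N) → EuclideanSpace ℝ (Fin N)}
    (h : HasWeakGradient u g) (hu : MemLp u 2) (hg : MemLp g 2) (y : EuclideanSpace ℝ (Fin N)) :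
    eLpNorm (fun x => u (x + y) - u x) 2 ≤ ENNReal.ofReal (‖y‖ * (eLpNorm g 2).toReal) := by
  have hd : MemLp (fun x => u (x + y) - u x) 2 :=
    (hu.comp_measurePreserving (measurePreserving_add_right _ y)).sub hu
  set d := hd.toLp _ with hd'
  set C := ‖y‖ * (eLpNorm g 2).toReal with hC
  have hC0 : 0 ≤ C := by positivity
  -- the bound on pairings with test functions extends by density to the pairing of `d` with itself
  have hcl : IsClosed {w : Lp ℝ 2 (volume : Measure (EuclideanSpace ℝ (Fin N))) |
      ⟪d, w⟫_ℝ ≤ C * ‖w‖} :=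
    isClosed_le (continuous_const.inner continuous_id) (continuous_const.mul continuous_norm)
  have hall : d ∈ {w : Lp ℝ 2 (volume : Measure (EuclideanSpace ℝ (Fin N))) |
      ⟪d, w⟫_ℝ ≤ C * ‖w‖} := by
    refine hcl.closure_subset_iff.2 ?_ (Lp.dense_hasCompactSupport_contDiff (by simp) d)
    rintro w ⟨φ, hwφ, hφc, hφ⟩
    have h1 := h.abs_integral_translate_le hu hg hφ hφc y
    have e1 : ⟪d, w⟫_ℝ = ∫ x, (u (x + y) - u x) * φ x := by
      rw [L2.inner_def]
      refine integral_congr_ae ?_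
      filter_upwards [hd.coeFn_toLp, hwφ] with x hx hx'
      rw [hx, hx']
      simp [mul_comm]
    have e2 : ‖w‖ = (eLpNorm φ 2).toReal := by
      rw [Lp.norm_def, eLpNorm_congr_ae hwφ]
    rw [mem_ofPred_eq, e1, e2]
    exact (le_abs_self _).trans h1
  have h2 : ‖d‖ * ‖d‖ ≤ C * ‖d‖ := by
    rw [← real_inner_self_eq_norm_mul_norm]; exact hall
  have h3 : ‖d‖ ≤ C := by
    rcases (norm_nonneg d).eq_or_lt with h0 | h0
    · rw [← h0]; exact hC0
    · exact le_of_mul_le_mul_right h2 h0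
  rw [hd', Lp.norm_toLp] at h3
  rw [← ENNReal.ofReal_toReal hd.2.ne]
  exact ENNReal.ofReal_le_ofReal h3

/-- The average of `u` around `x` with respect to the probability measure `ν`. -/
def avg (ν : Measure (EuclideanSpace ℝ (Fin N))) (u : EuclideanSpace ℝ (Fin N) → ℝ)
    (x : EuclideanSpace ℝ (Fin N)) : ℝ := ∫ y, u (x + y) ∂ν

variable {ν : Measure (EuclideanSpace ℝ (Fin N))}

lemma lintegral_translate_le {κ : ℝ≥0∞} (hν : ν ≤ κ • volume)
    (u : Lp ℝ 2 (volume : Measure (EuclideanSpace ℝ (Fin N)))) (x : EuclideanSpace ℝ (Fin N)) :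
    ∫⁻ y, ‖u (x + y)‖ₑ ^ 2 ∂ν ≤ κ * ENNReal.ofReal (‖u‖ ^ 2) := by
  refine (lintegral_mono' hν le_rfl).trans ?_
  rw [lintegral_smul_measure, ← lintegral_Lp_sq,
    lintegral_add_left_eq_self (fun y => ‖u y‖ₑ ^ 2) x, smul_eq_mul]

lemma stronglyMeasurable_translate
    (u : Lp ℝ 2 (volume : Measure (EuclideanSpace ℝ (Fin N)))) (x : EuclideanSpace ℝ (Fin N)) :
    StronglyMeasurable fun y => u (x + y) :=
  (Lp.stronglyMeasurable u).comp_measurable (measurable_const_add x)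

lemma integrable_translate [IsProbabilityMeasure ν] {κ : ℝ≥0∞} (hκ : κ ≠ ⊤) (hν : ν ≤ κ • volume)
    (u : Lp ℝ 2 (volume : Measure (EuclideanSpace ℝ (Fin N)))) (x : EuclideanSpace ℝ (Fin N)) :
    Integrable (fun y => u (x + y)) ν := by
  have : MemLp (fun y => u (x + y)) 2 ν := by
    refine ⟨(stronglyMeasurable_translate u x).aestronglyMeasurable, ?_⟩
    have h1 := lintegral_translate_le hν u x
    rw [← eLpNorm_two_sq] at h1
    have h2 := h1.trans_lt (ENNReal.mul_lt_top hκ.lt_top ENNReal.ofReal_lt_top)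
    by_contra h3
    rw [not_lt_top_iff] at h3
    simp [h3] at h2
  exact this.integrable one_le_two

/-- Averages are bounded pointwise by the norm in `L²`. -/
lemma enorm_avg_sq_le [IsProbabilityMeasure ν] {κ : ℝ≥0∞} (hν : ν ≤ κ • volume)
    (u : Lp ℝ 2 (volume : Measure (EuclideanSpace ℝ (Fin N)))) (x : EuclideanSpace ℝ (Fin N)) :
    ‖avg ν u x‖ₑ ^ 2 ≤ κ * ENNReal.ofReal (‖u‖ ^ 2) :=
  (enorm_integral_sq_le (stronglyMeasurable_translate u x).aestronglyMeasurable).trans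
    (lintegral_translate_le hν u x)

lemma measurable_avg [SFinite ν] (u : Lp ℝ 2 (volume : Measure (EuclideanSpace ℝ (Fin N)))) :
    Measurable (avg ν u) := by
  have h : StronglyMeasurable fun q : EuclideanSpace ℝ (Fin N) × EuclideanSpace ℝ (Fin N) =>
      u (q.1 + q.2) := (Lp.stronglyMeasurable u).comp_measurable measurable_add
  exact h.integral_prod_right.measurable

/-- Averages over balls of radius `r` are close in `L²` to a function with a weak gradient. -/
lemma HasWeakGradient.lintegral_sub_avg_le [IsProbabilityMeasure ν] {κ : ℝ≥0∞} (hκ : κ ≠ ⊤)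
    (hν : ν ≤ κ • volume) {r : ℝ}
    (hr : ∀ᵐ y ∂ν, ‖y‖ ≤ r) {u : Lp ℝ 2 (volume : Measure (EuclideanSpace ℝ (Fin N)))}
    {g : Lp (EuclideanSpace ℝ (Fin N)) 2 (volume : Measure (EuclideanSpace ℝ (Fin N)))}
    (h : HasWeakGradient u g) :
    ∫⁻ x, ‖u x - avg ν u x‖ₑ ^ 2 ≤ ENNReal.ofReal ((r * ‖g‖) ^ 2) := by
  have h1 : ∀ x, ‖u x - avg ν u x‖ₑ ^ 2 ≤ ∫⁻ y, ‖u (x + y) - u x‖ₑ ^ 2 ∂ν := by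
    intro x
    have hm : AEStronglyMeasurable (fun y => u (x + y) - u x) ν :=
      ((stronglyMeasurable_translate u x).sub stronglyMeasurable_const).aestronglyMeasurable
    refine le_trans (le_of_eq ?_) (enorm_integral_sq_le hm)
    rw [integral_sub (integrable_translate hκ hν u x) (integrable_const _), integral_const]
    simp only [probReal_univ, one_smul]
    rw [← enorm_neg, neg_sub]
    rfl
  refine (lintegral_mono h1).trans ?_
  rw [lintegral_lintegral_swap]
  · have h2 : ∀ᵐ y ∂ν, ∫⁻ x, ‖u (x + y) - u x‖ₑ ^ 2 ≤ ENNReal.ofReal ((r * ‖g‖) ^ 2) := by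
      filter_upwards [hr] with y hy
      rw [← eLpNorm_two_sq, ENNReal.ofReal_pow (by have := (norm_nonneg y).trans hy; positivity)]
      gcongr
      refine (h.eLpNorm_translate_le (Lp.memLp u) (Lp.memLp g) y).trans ?_
      rw [← Lp.norm_def]
      gcongr
    refine (lintegral_mono_ae h2).trans ?_
    simp
  · have h3 : StronglyMeasurable fun q : EuclideanSpace ℝ (Fin N) × EuclideanSpace ℝ (Fin N) =>
        u (q.1 + q.2) - u q.1 :=
      ((Lp.stronglyMeasurable u).comp_measurable measurable_add).sub
        ((Lp.stronglyMeasurable u).comp_measurable measurable_fst)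
    exact (h3.enorm.pow_const 2).aemeasurable

end Average

/-! ### Sobolev embedding and local compactness -/

section Embedding

variable {N : ℕ}

lemma enorm_sq_eq (a : ℝ) : ‖a‖ₑ ^ 2 = ENNReal.ofReal (a ^ 2) := by
  rw [← ofReal_norm, ← ENNReal.ofReal_pow (norm_nonneg _), Real.norm_eq_abs, sq_abs]

/-- The uniform probability measure on the ball of radius `r`. -/
def ballMeasure (N : ℕ) (r : ℝ) : Measure (EuclideanSpace ℝ (Fin N)) :=
  ProbabilityTheory.cond volume (Metric.ball 0 r)

lemma volume_ball_ne_zero {r : ℝ} (hr : 0 < r) :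
    (volume : Measure (EuclideanSpace ℝ (Fin N))) (Metric.ball 0 r) ≠ 0 :=
  (Metric.measure_ball_pos volume 0 hr).ne'

lemma isProbabilityMeasure_ballMeasure {r : ℝ} (hr : 0 < r) :
    IsProbabilityMeasure (ballMeasure N r) :=
  ProbabilityTheory.cond_isProbabilityMeasure_of_finite (volume_ball_ne_zero hr)
    measure_ball_lt_top.ne

lemma ballMeasure_le (r : ℝ) :
    ballMeasure N r ≤ (volume (Metric.ball (0 : EuclideanSpace ℝ (Fin N)) r))⁻¹ • volume := by
  unfold ballMeasure ProbabilityTheory.cond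
  exact smul_le_smul_left _ Measure.restrict_le_self

lemma ae_ballMeasure (r : ℝ) : ∀ᵐ y ∂(ballMeasure N r), ‖y‖ ≤ r := by
  unfold ballMeasure
  filter_upwards [ProbabilityTheory.ae_cond_mem (μ := volume) measurableSet_ball] with y hy
  exact (mem_ball_zero_iff.1 hy).le

/-- Large values of a function with bounded `H¹` norm carry little mass: at the level `t` the
function is compared with its averages at a scale on which these stay below `t / 2`. -/
lemma exists_tail_bound (hN : 1 ≤ N) : ∃ A : ℝ, 0 ≤ A ∧
    ∀ (u : Lp ℝ 2 (volume : Measure (EuclideanSpace ℝ (Fin N))))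
      (g : Lp (EuclideanSpace ℝ (Fin N)) 2 (volume : Measure (EuclideanSpace ℝ (Fin N)))),
      HasWeakGradient u g → ‖u‖ ≤ 1 → ‖g‖ ≤ 1 → ∀ t : ℝ, 0 < t →
        ∫⁻ x in {x | t ≤ |u x|}, ‖u x‖ₑ ^ 2 ≤ ENNReal.ofReal (A * t ^ (-(4 / N : ℝ))) := by
  set v₁ : ℝ := (volume (Metric.ball (0 : EuclideanSpace ℝ (Fin N)) 1)).toReal with hv
  have v_pos : 0 < v₁ := ENNReal.toReal_pos (volume_ball_ne_zero one_pos) measure_ball_lt_top.ne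
  have hN0 : (0 : ℝ) < N := by exact_mod_cast hN
  refine ⟨4 * ((4 / v₁) ^ (1 / N : ℝ)) ^ 2, by positivity, fun u g h hu hg t ht => ?_⟩
  -- the ball of radius `r` has volume `4 / t²`, so by Cauchy-Schwarz averages are at most `t / 2`
  set r : ℝ := (4 / (v₁ * t ^ 2)) ^ (1 / N : ℝ) with hr
  have hr0 : 0 < r := by positivity
  have hrN : r ^ N = 4 / (v₁ * t ^ 2) := by
    rw [hr, ← Real.rpow_natCast, ← Real.rpow_mul (by positivity), one_div_mul_cancel hN0.ne',
      Real.rpow_one]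
  have := isProbabilityMeasure_ballMeasure (N := N) hr0
  have hball : volume (Metric.ball (0 : EuclideanSpace ℝ (Fin N)) r) =
      ENNReal.ofReal (4 / t ^ 2) := by
    rw [Measure.addHaar_ball_of_pos _ _ hr0, finrank_euclideanSpace_fin, hrN,
      ← ENNReal.ofReal_toReal measure_ball_lt_top.ne, ← hv,
      ← ENNReal.ofReal_mul (by positivity)]
    congr 1
    field_simp
  have hle := ballMeasure_le (N := N) r
  rw [hball, ← ENNReal.ofReal_inv_of_pos (by positivity), inv_div] at hle
  have havg : ∀ x, |avg (ballMeasure N r) u x| ≤ t / 2 := by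
    intro x
    have h1 := enorm_avg_sq_le hle u x
    rw [← ENNReal.ofReal_mul (by positivity), ← ofReal_norm, ← ENNReal.ofReal_pow (norm_nonneg _),
      ENNReal.ofReal_le_ofReal_iff (by positivity), Real.norm_eq_abs] at h1
    have h2 : ‖u‖ ^ 2 ≤ 1 := pow_le_one₀ (norm_nonneg _) hu
    refine abs_le_of_sq_le_sq' ?_ (by positivity) |> fun h => abs_le.2 h
    rw [sq_abs] at h1
    nlinarith [sq_nonneg t]
  have h3 := h.lintegral_sub_avg_le ENNReal.ofReal_ne_top hle (ae_ballMeasure r)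
  have hmeas : MeasurableSet {x | t ≤ |u x|} :=
    measurableSet_le measurable_const (Lp.stronglyMeasurable u).measurable.norm
  calc ∫⁻ x in {x | t ≤ |u x|}, ‖u x‖ₑ ^ 2
      ≤ ∫⁻ x in {x | t ≤ |u x|}, 4 * ‖u x - avg (ballMeasure N r) u x‖ₑ ^ 2 := by
        refine setLIntegral_mono' hmeas fun x hx => ?_
        have hx' : t ≤ |u x| := hx
        have h4 := havg x
        have h5 : |u x| ≤ 2 * |u x - avg (ballMeasure N r) u x| := by
          have := abs_sub_abs_le_abs_sub (u x) (avg (ballMeasure N r) u x)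
          linarith
        rw [enorm_sq_eq, enorm_sq_eq,
          show (4 : ℝ≥0∞) = ENNReal.ofReal 4 by norm_num, ← ENNReal.ofReal_mul (by norm_num)]
        refine ENNReal.ofReal_le_ofReal ?_
        rw [← sq_abs (u x), ← sq_abs (u x - _)]
        nlinarith [abs_nonneg (u x)]
    _ ≤ ∫⁻ x, 4 * ‖u x - avg (ballMeasure N r) u x‖ₑ ^ 2 := setLIntegral_le_lintegral _ _
    _ = 4 * ∫⁻ x, ‖u x - avg (ballMeasure N r) u x‖ₑ ^ 2 := by
        rw [lintegral_const_mul' _ _ (by norm_num)]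
    _ ≤ 4 * ENNReal.ofReal ((r * ‖g‖) ^ 2) := by gcongr
    _ ≤ _ := by
        rw [show (4 : ℝ≥0∞) = ENNReal.ofReal 4 by norm_num, ← ENNReal.ofReal_mul (by norm_num)]
        refine ENNReal.ofReal_le_ofReal ?_
        have e : ((4 / v₁) ^ (1 / N : ℝ)) ^ 2 * t ^ (-(4 / N : ℝ)) = r ^ 2 := by
          have e1 : r = (4 / v₁) ^ (1 / N : ℝ) / (t ^ 2) ^ (1 / N : ℝ) := by
            rw [hr, ← div_div, Real.div_rpow (by positivity) (by positivity)]
          have e2 : t ^ (-(4 / N : ℝ)) = (((t ^ 2) ^ (1 / N : ℝ)) ^ 2)⁻¹ := by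
            rw [← Real.rpow_two t, ← Real.rpow_mul ht.le, ← Real.rpow_two (t ^ _),
              ← Real.rpow_mul ht.le, ← Real.rpow_neg ht.le]
            congr 1; ring
          rw [e1, e2, div_pow, ← div_eq_mul_inv]
        rw [mul_assoc 4, e]
        have : (r * ‖g‖) ^ 2 ≤ r ^ 2 := by
          gcongr
          exact mul_le_of_le_one_right hr0.le hg
        linarith

/-- The Sobolev exponent `2 + 2/N` used for the embedding of `H¹(ℝ^N)`. -/
def sobExp (N : ℕ) : ℝ := 2 + 2 / N

lemma two_lt_sobExp (hN : 1 ≤ N) : 2 < sobExp N := by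
  have hN0 : (0 : ℝ) < N := by exact_mod_cast hN
  unfold sobExp
  have : (0 : ℝ) < 2 / N := by positivity
  linarith

/-- The Sobolev embedding of the unit ball of `H¹(ℝ^N)` into `L^{2+2/N}`, by summing the bounds for
the mass of the dyadic level sets. -/
lemma exists_sobolev_unit (hN : 1 ≤ N) : ∃ C : ℝ, 0 ≤ C ∧
    ∀ (u : Lp ℝ 2 (volume : Measure (EuclideanSpace ℝ (Fin N))))
      (g : Lp (EuclideanSpace ℝ (Fin N)) 2 (volume : Measure (EuclideanSpace ℝ (Fin N)))),
      HasWeakGradient u g → ‖u‖ ≤ 1 → ‖g‖ ≤ 1 →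
        ∫⁻ x, ENNReal.ofReal (|u x| ^ sobExp N) ≤ ENNReal.ofReal C := by
  obtain ⟨A, hA, htail⟩ := exists_tail_bound hN
  have hN0 : (0 : ℝ) < N := by exact_mod_cast hN
  set β : ℝ := 2 / N with hβ
  have hβ0 : 0 < β := by positivity
  set q : ℝ := 2 ^ β with hq
  have hq1 : 1 < q := Real.one_lt_rpow one_lt_two hβ0
  have hq0 : 0 < q := by positivity
  have hsum : Summable fun k : ℕ => q * A * (q⁻¹) ^ k :=
    (summable_geometric_of_lt_one (by positivity) (inv_lt_one_of_one_lt₀ hq1)).mul_left _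
  refine ⟨1 + ∑' k : ℕ, q * A * (q⁻¹) ^ k, by positivity, fun u g h hu hg => ?_⟩
  have hmeas : ∀ t : ℝ, MeasurableSet {x | t ≤ |u x|} := fun t =>
    measurableSet_le measurable_const (Lp.stronglyMeasurable u).measurable.norm
  have hm2 : Measurable fun x => ‖u x‖ₑ ^ 2 :=
    (Lp.stronglyMeasurable u).measurable.enorm.pow_const 2
  have hpt : ∀ x, ENNReal.ofReal (|u x| ^ sobExp N) ≤ ‖u x‖ₑ ^ 2 +
      ∑' k : ℕ, ENNReal.ofReal (q ^ (k + 1)) *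
        ({x | (2 : ℝ) ^ k ≤ |u x|}.indicator (fun x => ‖u x‖ₑ ^ 2) x) := by
    intro x
    have hexp : |u x| ^ sobExp N = |u x| ^ β * |u x| ^ 2 := by
      unfold sobExp
      rw [← hβ, Real.rpow_add_of_nonneg (abs_nonneg _) (by norm_num) hβ0.le, Real.rpow_two,
        mul_comm]
    have he : ‖u x‖ₑ ^ 2 = ENNReal.ofReal (|u x| ^ 2) := by
      rw [enorm_sq_eq, sq_abs]
    rcases le_total |u x| 1 with h1 | h1
    · refine le_trans ?_ le_self_add
      rw [he, hexp]
      refine ENNReal.ofReal_le_ofReal ?_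
      exact mul_le_of_le_one_left (sq_nonneg _) (Real.rpow_le_one (abs_nonneg _) h1 hβ0.le)
    · obtain ⟨k, hk, hk'⟩ := exists_nat_pow_near h1 one_lt_two
      refine le_trans ?_ (le_trans (ENNReal.le_tsum k) le_add_self)
      rw [indicator_of_mem (show x ∈ {x | (2 : ℝ) ^ k ≤ |u x|} from hk), he,
        ← ENNReal.ofReal_mul (by positivity), hexp]
      refine ENNReal.ofReal_le_ofReal ?_
      gcongr
      calc |u x| ^ β ≤ ((2 : ℝ) ^ (k + 1)) ^ β := by gcongr
        _ = q ^ (k + 1) := by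
          rw [hq, ← Real.rpow_natCast, ← Real.rpow_natCast, ← Real.rpow_mul (by norm_num),
            ← Real.rpow_mul (by norm_num), mul_comm]
  have hterm : ∀ k : ℕ, ∫⁻ x, ENNReal.ofReal (q ^ (k + 1)) *
        ({x | (2 : ℝ) ^ k ≤ |u x|}.indicator (fun x => ‖u x‖ₑ ^ 2) x) ≤
      ENNReal.ofReal (q * A * (q⁻¹) ^ k) := by
    intro k
    rw [lintegral_const_mul' _ _ ENNReal.ofReal_ne_top, lintegral_indicator (hmeas _)]
    refine (mul_le_mul_right (htail u g h hu hg (2 ^ k) (by positivity)) _).trans ?_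
    rw [← ENNReal.ofReal_mul (by positivity)]
    refine ENNReal.ofReal_le_ofReal (le_of_eq ?_)
    have e : ((2 : ℝ) ^ k) ^ (-(4 / N : ℝ)) = (q⁻¹) ^ k * (q⁻¹) ^ k := by
      rw [← mul_pow, ← Real.rpow_natCast 2 k, ← Real.rpow_mul (by norm_num), hq,
        ← Real.rpow_neg (by norm_num), ← Real.rpow_add (by norm_num), ← Real.rpow_natCast _ k,
        ← Real.rpow_mul (by norm_num)]
      congr 1
      rw [hβ]; ring
    rw [e, pow_succ]
    have e2 : q ^ k * (q⁻¹) ^ k = 1 := by rw [← mul_pow, mul_inv_cancel₀ hq0.ne', one_pow]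
    calc _ = (q ^ k * (q⁻¹) ^ k) * (q * A * (q⁻¹) ^ k) := by ring
      _ = _ := by rw [e2, one_mul]
  calc ∫⁻ x, ENNReal.ofReal (|u x| ^ sobExp N)
      ≤ ∫⁻ x, (‖u x‖ₑ ^ 2 + ∑' k : ℕ, ENNReal.ofReal (q ^ (k + 1)) *
        ({x | (2 : ℝ) ^ k ≤ |u x|}.indicator (fun x => ‖u x‖ₑ ^ 2) x)) := lintegral_mono hpt
    _ = (∫⁻ x, ‖u x‖ₑ ^ 2) + ∑' k : ℕ, ∫⁻ x, ENNReal.ofReal (q ^ (k + 1)) *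
        ({x | (2 : ℝ) ^ k ≤ |u x|}.indicator (fun x => ‖u x‖ₑ ^ 2) x) := by
        rw [lintegral_add_left hm2, lintegral_tsum]
        exact fun k => ((hm2.indicator (hmeas _)).const_mul _).aemeasurable
    _ ≤ ENNReal.ofReal 1 + ∑' k : ℕ, ENNReal.ofReal (q * A * (q⁻¹) ^ k) := by
        gcongr with k
        · rw [lintegral_Lp_sq]
          exact ENNReal.ofReal_le_ofReal (pow_le_one₀ (norm_nonneg _) hu)
        · exact hterm k
    _ = _ := by
        rw [← ENNReal.ofReal_tsum_of_nonneg (fun k => by positivity) hsum,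
          ← ENNReal.ofReal_add zero_le_one (by positivity)]

/-- The Sobolev embedding of `H¹(ℝ^N)` into `L^{2+2/N}(ℝ^N)`. -/
lemma exists_sobolev (hN : 1 ≤ N) : ∃ C : ℝ, 0 ≤ C ∧
    ∀ (u : Lp ℝ 2 (volume : Measure (EuclideanSpace ℝ (Fin N))))
      (g : Lp (EuclideanSpace ℝ (Fin N)) 2 (volume : Measure (EuclideanSpace ℝ (Fin N)))),
      HasWeakGradient u g → ∀ a : ℝ, 0 < a → ‖u‖ ≤ a → ‖g‖ ≤ a →
        ∫⁻ x, ENNReal.ofReal (|u x| ^ sobExp N) ≤ ENNReal.ofReal (C * a ^ sobExp N) := by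
  obtain ⟨C, hC, hCu⟩ := exists_sobolev_unit hN
  refine ⟨C, hC, fun u g h a ha hu hg => ?_⟩
  have h1 := hCu (a⁻¹ • u) (a⁻¹ • g)
    ((h.smul a⁻¹).congr (Lp.coeFn_smul a⁻¹ u).symm (Lp.coeFn_smul a⁻¹ g).symm)
    (by rw [norm_smul, norm_inv, Real.norm_of_nonneg ha.le, inv_mul_le_iff₀ ha, mul_one]; exact hu)
    (by rw [norm_smul, norm_inv, Real.norm_of_nonneg ha.le, inv_mul_le_iff₀ ha, mul_one]; exact hg)
  have h2 : ∫⁻ x, ENNReal.ofReal (|u x| ^ sobExp N) = ENNReal.ofReal (a ^ sobExp N) *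
      ∫⁻ x, ENNReal.ofReal (|(a⁻¹ • u : Lp ℝ 2 (volume : Measure (EuclideanSpace ℝ (Fin N)))) x|
        ^ sobExp N) := by
    rw [← lintegral_const_mul' _ _ ENNReal.ofReal_ne_top]
    refine lintegral_congr_ae ?_
    filter_upwards [Lp.coeFn_smul a⁻¹ u] with x hx
    rw [hx, ← ENNReal.ofReal_mul (by positivity), ← Real.mul_rpow ha.le (abs_nonneg _)]
    congr 2
    rw [Pi.smul_apply, smul_eq_mul, abs_mul, abs_inv, abs_of_pos ha, mul_inv_cancel_left₀ ha.ne']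
  rw [h2, mul_comm C, ENNReal.ofReal_mul (by positivity)]
  gcongr

/-- Local compactness: weak convergence to `0` in `L²` with bounded weak gradients implies strong
convergence in `L²` of every ball. Averages converge pointwise by weak convergence, and the
functions are uniformly close to their averages. -/
lemma tendsto_lintegral_ball {ι : Type*} {l : Filter ι} [l.IsCountablyGenerated] {M : ℝ}
    (w : ι → Lp ℝ 2 (volume : Measure (EuclideanSpace ℝ (Fin N))))
    (g : ι → Lp (EuclideanSpace ℝ (Fin N)) 2 (volume : Measure (EuclideanSpace ℝ (Fin N))))
    (h : ∀ i, HasWeakGradient (w i) (g i)) (hw : ∀ i, ‖w i‖ ≤ M) (hg : ∀ i, ‖g i‖ ≤ M)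
    (hweak : ∀ f : Lp ℝ 2 (volume : Measure (EuclideanSpace ℝ (Fin N))),
      Tendsto (fun i => ⟪f, w i⟫_ℝ) l (𝓝 0)) (R : ℝ) :
    Tendsto (fun i => ∫⁻ x in Metric.ball 0 R, ‖w i x‖ₑ ^ 2) l (𝓝 0) := by
  rcases l.eq_or_neBot with rfl | hl
  · exact tendsto_bot
  have hM : 0 ≤ M := by
    obtain ⟨i⟩ := hl.nonempty
    exact (norm_nonneg _).trans (hw i)
  rw [ENNReal.tendsto_nhds_zero]
  intro η hη
  -- a scale at which every `w i` is close to its averages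
  obtain ⟨r, hr, hrη⟩ : ∃ r : ℝ, 0 < r ∧ 2 * ENNReal.ofReal ((r * M) ^ 2) ≤ η / 2 := by
    have hc : Tendsto (fun r : ℝ => 2 * ENNReal.ofReal ((r * M) ^ 2)) (𝓝[>] 0) (𝓝 0) := by
      have h1 : Tendsto (fun r : ℝ => (r * M) ^ 2) (𝓝[>] 0) (𝓝 0) := by
        have : Continuous fun r : ℝ => (r * M) ^ 2 := by fun_prop
        have h2 := this.tendsto 0
        simp only [zero_mul, ne_eq, OfNat.ofNat_ne_zero, not_false_eq_true, zero_pow] at h2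
        exact h2.mono_left nhdsWithin_le_nhds
      have h3 := ENNReal.Tendsto.const_mul (a := 2) (ENNReal.tendsto_ofReal h1)
        (Or.inr (by norm_num))
      simpa using h3
    have h4 := (ENNReal.tendsto_nhds_zero.1 hc (η / 2) (ENNReal.half_pos hη.ne')).and
      self_mem_nhdsWithin
    obtain ⟨r, hr1, hr2⟩ := h4.exists
    exact ⟨r, hr2, hr1⟩
  have := isProbabilityMeasure_ballMeasure (N := N) hr
  set B := Metric.ball (0 : EuclideanSpace ℝ (Fin N)) r with hB
  have hle := ballMeasure_le (N := N) r
  have hκ : (volume B)⁻¹ ≠ ⊤ := ENNReal.inv_ne_top.2 (volume_ball_ne_zero hr)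
  -- an average is the pairing with the indicator of a ball
  have hpt : ∀ x, Tendsto (fun i => avg (ballMeasure N r) (w i) x) l (𝓝 0) := by
    intro x
    have hBx : volume (Metric.ball x r) ≠ ⊤ := measure_ball_lt_top.ne
    have h1 := (hweak (indicatorConstLp 2 measurableSet_ball hBx (1 : ℝ))).const_mul
      ((volume B)⁻¹).toReal
    rw [mul_zero] at h1
    refine h1.congr fun i => ?_
    rw [L2.inner_indicatorConstLp_one]
    unfold avg ballMeasure ProbabilityTheory.cond
    rw [integral_smul_measure, smul_eq_mul]
    congr 1
    have h2 := (measurePreserving_add_left (volume : Measure (EuclideanSpace ℝ (Fin N)))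
      x).setIntegral_preimage_emb (measurableEmbedding_addLeft x) (w i) (Metric.ball x r)
    rw [← h2]
    congr 2
    ext y
    simp
  have hdct : Tendsto (fun i => ∫⁻ x in Metric.ball 0 R, ‖avg (ballMeasure N r) (w i) x‖ₑ ^ 2) l
      (𝓝 0) := by
    have := tendsto_lintegral_filter_of_dominated_convergence
      (μ := (volume : Measure (EuclideanSpace ℝ (Fin N))).restrict (Metric.ball 0 R))
      (F := fun i x => ‖avg (ballMeasure N r) (w i) x‖ₑ ^ 2) (f := fun _ => 0) (l := l)
      (fun _ => (volume B)⁻¹ * ENNReal.ofReal (M ^ 2)) ?_ ?_ ?_ ?_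
    · simpa using this
    · exact Eventually.of_forall fun i => (measurable_avg (w i)).enorm.pow_const 2
    · refine Eventually.of_forall fun i => ae_of_all _ fun x => ?_
      refine (enorm_avg_sq_le hle (w i) x).trans ?_
      gcongr
      exact hw i
    · rw [setLIntegral_const]
      exact ENNReal.mul_ne_top (ENNReal.mul_ne_top hκ ENNReal.ofReal_ne_top)
        measure_ball_lt_top.ne
    · refine ae_of_all _ fun x => ?_
      simpa using ENNReal.Tendsto.pow (n := 2) (hpt x).enorm
  have hdct2 := ENNReal.Tendsto.const_mul (a := 2) hdct (Or.inr (by norm_num))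
  rw [mul_zero] at hdct2
  filter_upwards [ENNReal.tendsto_nhds_zero.1 hdct2 (η / 2) (ENNReal.half_pos hη.ne')] with i hi
  have hsq : ∀ a b : ℝ, ‖a‖ₑ ^ 2 ≤ 2 * ‖a - b‖ₑ ^ 2 + 2 * ‖b‖ₑ ^ 2 := by
    intro a b
    rw [enorm_sq_eq, enorm_sq_eq, enorm_sq_eq,
      show (2 : ℝ≥0∞) = ENNReal.ofReal 2 by norm_num, ← ENNReal.ofReal_mul (by norm_num),
      ← ENNReal.ofReal_mul (by norm_num), ← ENNReal.ofReal_add (by positivity) (by positivity)]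
    exact ENNReal.ofReal_le_ofReal (by nlinarith [sq_nonneg (a - 2 * b)])
  calc ∫⁻ x in Metric.ball 0 R, ‖w i x‖ₑ ^ 2
      ≤ ∫⁻ x in Metric.ball 0 R, (2 * ‖w i x - avg (ballMeasure N r) (w i) x‖ₑ ^ 2 +
          2 * ‖avg (ballMeasure N r) (w i) x‖ₑ ^ 2) := lintegral_mono fun x => hsq _ _
    _ = 2 * (∫⁻ x in Metric.ball 0 R, ‖w i x - avg (ballMeasure N r) (w i) x‖ₑ ^ 2) +
          2 * ∫⁻ x in Metric.ball 0 R, ‖avg (ballMeasure N r) (w i) x‖ₑ ^ 2 := by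
        rw [lintegral_add_right _ (((measurable_avg (w i)).enorm.pow_const 2).const_mul _),
          lintegral_const_mul' _ _ (by norm_num), lintegral_const_mul' _ _ (by norm_num)]
    _ ≤ 2 * ENNReal.ofReal ((r * M) ^ 2) + η / 2 := by
        gcongr
        refine (setLIntegral_le_lintegral _ _).trans
          (((h i).lintegral_sub_avg_le hκ hle (ae_ballMeasure r)).trans ?_)
        gcongr
        exact hg i
    _ ≤ η / 2 + η / 2 := by gcongr
    _ = η := ENNReal.add_halves η

end Embedding

/-! ### The space `X_ε` -/

/-- Weak gradients pass to limits in `L²`. -/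
lemma HasWeakGradient.of_tendsto {N : ℕ}
    {u : ℕ → Lp ℝ 2 (volume : Measure (EuclideanSpace ℝ (Fin N)))}
    {g : ℕ → Lp (EuclideanSpace ℝ (Fin N)) 2 (volume : Measure (EuclideanSpace ℝ (Fin N)))}
    {U : Lp ℝ 2 (volume : Measure (EuclideanSpace ℝ (Fin N)))}
    {G : Lp (EuclideanSpace ℝ (Fin N)) 2 (volume : Measure (EuclideanSpace ℝ (Fin N)))}
    (h : ∀ n, HasWeakGradient (u n) (g n)) (hu : Tendsto u atTop (𝓝 U))
    (hg : Tendsto g atTop (𝓝 G)) : HasWeakGradient U G := by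
  intro φ hφ hφc v
  have hA : MemLp (fun x => fderiv ℝ φ x v) 2
      (volume : Measure (EuclideanSpace ℝ (Fin N))) :=
    ((hφ.continuous_fderiv (by simp)).clm_apply continuous_const).memLp_of_hasCompactSupport
      (hφc.fderiv_apply (𝕜 := ℝ) v)
  have hB : MemLp (fun x => φ x • v) 2 (volume : Measure (EuclideanSpace ℝ (Fin N))) :=
    (hφ.continuous.smul continuous_const).memLp_of_hasCompactSupport hφc.smul_right
  have eA : ∀ w : Lp ℝ 2 (volume : Measure (EuclideanSpace ℝ (Fin N))),
      ∫ x, w x * fderiv ℝ φ x v = ⟪w, hA.toLp _⟫_ℝ := by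
    intro w
    rw [L2.inner_def]
    refine integral_congr_ae ?_
    filter_upwards [hA.coeFn_toLp] with x hx
    rw [hx]; simp [mul_comm]
  have eB : ∀ w : Lp (EuclideanSpace ℝ (Fin N)) 2
      (volume : Measure (EuclideanSpace ℝ (Fin N))),
      ∫ x, ⟪w x, v⟫_ℝ * φ x = ⟪w, hB.toLp _⟫_ℝ := by
    intro w
    rw [L2.inner_def]
    refine integral_congr_ae ?_
    filter_upwards [hB.coeFn_toLp] with x hx
    rw [hx, inner_smul_right, mul_comm]
  rw [eA, eB]
  have h1 := hu.inner (tendsto_const_nhds (x := hA.toLp _) (f := atTop)) (𝕜 := ℝ)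
  have h2 := (hg.inner (tendsto_const_nhds (x := hB.toLp _) (f := atTop)) (𝕜 := ℝ)).neg
  refine tendsto_nhds_unique h1 (h2.congr fun n => ?_)
  rw [← eA, ← eB, h n φ hφ hφc v]

namespace PenalizedProblem

variable {N : ℕ} {D : PenalizedProblem N} {ε : ℝ}

/-- The lower bound `inf V + 1 > 0` of the weight. -/
def wt (D : PenalizedProblem N) : ℝ := (⨅ x, D.V x) + 1

lemma wt_pos (D : PenalizedProblem N) : 0 < D.wt := by
  unfold wt; linarith [D.neg_one_lt_iInf_V]

lemma wt_le (D : PenalizedProblem N) (y : EuclideanSpace ℝ (Fin N)) : D.wt ≤ D.V y + 1 := by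
  unfold wt; linarith [ciInf_le D.bddBelow_V y]

lemma aestronglyMeasurable_coe (u : D.X ε) : AEStronglyMeasurable u volume :=
  Lp.aestronglyMeasurable (toL2 u)

lemma aemeasurable_coe (u : D.X ε) : AEMeasurable u volume :=
  (aestronglyMeasurable_coe u).aemeasurable

lemma integrable_sq (u : D.X ε) : Integrable fun x => (u x) ^ 2 :=
  (Lp.memLp (toL2 u)).integrable_sq

lemma integrable_grad_sq (u : D.X ε) : Integrable fun x => ‖grad u x‖ ^ 2 :=
  (Lp.memLp (grad u)).integrable_norm_pow (by simp)

lemma coe_sub (u v : D.X ε) : (u - v : D.X ε) =ᵐ[volume] fun x => u x - v x :=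
  Lp.coeFn_sub (toL2 u) (toL2 v)

lemma normH_nonneg (u : D.X ε) : 0 ≤ D.normH ε u := Real.sqrt_nonneg _

lemma normH_le_norm (u : D.X ε) : D.normH ε u ≤ ‖u‖ := by
  rw [norm_def]; linarith [luxemburgNorm_nonneg (Φ := F1 D.δ) (u := u)]

lemma luxemburg_le_norm (u : D.X ε) : luxemburgNorm (F1 D.δ) u ≤ ‖u‖ := by
  rw [norm_def]; linarith [normH_nonneg u]

lemma integral_energy_nonneg (u : D.X ε) :
    0 ≤ ∫ x, (‖grad u x‖ ^ 2 + (D.V (ε • x) + 1) * (u x) ^ 2) :=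
  integral_nonneg fun x => by have := (V_add_one_pos D (ε • x)).le; positivity

lemma normH_sq (u : D.X ε) : D.normH ε u ^ 2 =
    ∫ x, (‖grad u x‖ ^ 2 + (D.V (ε • x) + 1) * (u x) ^ 2) :=
  Real.sq_sqrt (integral_energy_nonneg u)

lemma normH_sq' (u : D.X ε) : D.normH ε u ^ 2 =
    ‖grad u‖ ^ 2 + ∫ x, (D.V (ε • x) + 1) * (u x) ^ 2 := by
  rw [normH_sq, integral_add (integrable_grad_sq u) (integrable_weight u), L2_norm_sq]

lemma integral_weight_nonneg (u : D.X ε) : 0 ≤ ∫ x, (D.V (ε • x) + 1) * (u x) ^ 2 :=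
  integral_nonneg fun x => mul_nonneg (V_add_one_pos D (ε • x)).le (sq_nonneg _)

lemma norm_grad_le (u : D.X ε) : ‖grad u‖ ≤ D.normH ε u := by
  refine abs_le_of_sq_le_sq' ?_ (normH_nonneg u) |>.2
  rw [normH_sq']
  linarith [integral_weight_nonneg u]

lemma norm_toL2_sq (u : D.X ε) : ‖toL2 u‖ ^ 2 = ∫ x, (u x) ^ 2 := by
  rw [L2_norm_sq]
  simp

lemma wt_mul_integral_sq_le (u : D.X ε) : D.wt * ∫ x, (u x) ^ 2 ≤ D.normH ε u ^ 2 := by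
  rw [normH_sq', ← integral_const_mul]
  have : ∫ x, D.wt * (u x) ^ 2 ≤ ∫ x, (D.V (ε • x) + 1) * (u x) ^ 2 := by
    refine integral_mono ((integrable_sq u).const_mul _) (integrable_weight u) fun x => ?_
    exact mul_le_mul_of_nonneg_right (D.wt_le _) (sq_nonneg _)
  linarith [sq_nonneg ‖grad u‖]

/-- A constant for the embeddings of `H_ε` into `H¹`. -/
def embC (D : PenalizedProblem N) : ℝ := 1 + D.wt⁻¹

lemma embC_pos (D : PenalizedProblem N) : 0 < D.embC := by
  have := D.wt_pos; unfold embC; positivity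

lemma norm_toL2_le (u : D.X ε) : ‖toL2 u‖ ≤ D.embC * D.normH ε u := by
  refine abs_le_of_sq_le_sq' ?_ (mul_nonneg D.embC_pos.le (normH_nonneg u)) |>.2
  have h1 := wt_mul_integral_sq_le u
  have hw := D.wt_pos
  rw [← norm_toL2_sq, mul_comm, ← le_div_iff₀ hw, div_eq_mul_inv, mul_comm] at h1
  rw [mul_pow]
  refine h1.trans ?_
  gcongr
  unfold embC
  have : 0 ≤ D.wt⁻¹ := by positivity
  nlinarith

/-- The Hilbert space in which `H_ε` is realized. -/
abbrev HilbertModel (N : ℕ) : Type := WithLp 2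
    (Lp (EuclideanSpace ℝ (Fin N)) 2 (volume : Measure (EuclideanSpace ℝ (Fin N))) ×
      Lp ℝ 2 (volume : Measure (EuclideanSpace ℝ (Fin N))))

/-- The map `embed` as a bounded linear map. -/
def embedL (D : PenalizedProblem N) (ε : ℝ) : D.X ε →L[ℝ] HilbertModel N :=
  LinearMap.mkContinuous ⟨⟨embed, embed_add⟩, embed_smul⟩ 1 fun u => by
    rw [one_mul]; exact (normH_eq u).symm.le.trans (normH_le_norm u)

lemma embedL_apply (u : D.X ε) : embedL D ε u = embed u := rfl

lemma normH_eq' (u : D.X ε) : D.normH ε u = ‖embedL D ε u‖ := normH_eq u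

/-- The inclusion of `X_ε` in `L²` as a bounded linear map. -/
def toL2L (D : PenalizedProblem N) (ε : ℝ) :
    D.X ε →L[ℝ] Lp ℝ 2 (volume : Measure (EuclideanSpace ℝ (Fin N))) :=
  LinearMap.mkContinuous ⟨⟨toL2, fun _ _ => rfl⟩, fun _ _ => rfl⟩ D.embC fun u =>
    (norm_toL2_le u).trans (mul_le_mul_of_nonneg_left (normH_le_norm u) D.embC_pos.le)

lemma toL2L_apply (u : D.X ε) : toL2L D ε u = toL2 u := rfl

lemma toL2_injective : Function.Injective (toL2 : D.X ε → _) := fun _ _ h => Subtype.ext h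

lemma normH_pos {u : D.X ε} (hu : u ≠ 0) : 0 < D.normH ε u := by
  refine (normH_nonneg u).lt_of_ne fun h => hu ?_
  have h1 := norm_toL2_le u
  rw [← h, mul_zero] at h1
  exact toL2_injective (norm_le_zero_iff.1 h1)

/-- Every sequence converging in `X_ε` has a subsequence converging almost everywhere. -/
lemma exists_subseq_ae {u : ℕ → D.X ε} {v : D.X ε} (h : Tendsto u atTop (𝓝 v)) :
    ∃ k : ℕ → ℕ, StrictMono k ∧ ∀ᵐ x, Tendsto (fun n => u (k n) x) atTop (𝓝 (v x)) :=
  (tendstoInMeasure_of_tendsto_Lp (((toL2L D ε).continuous.tendsto v).comp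
    h)).exists_seq_tendsto_ae

/-- The Sobolev embedding on `X_ε`. -/
lemma exists_sobolev_X (hN : 1 ≤ N) (D : PenalizedProblem N) (ε : ℝ) :
    ∃ C : ℝ, 0 ≤ C ∧ ∀ u : D.X ε, ∫⁻ x, ENNReal.ofReal (|u x| ^ sobExp N) ≤
      ENNReal.ofReal (C * D.normH ε u ^ sobExp N) := by
  obtain ⟨C, hC, h⟩ := exists_sobolev hN
  have hp := two_lt_sobExp hN
  refine ⟨C * (1 + D.embC) ^ sobExp N, mul_nonneg hC (Real.rpow_nonneg
    (by linarith [D.embC_pos]) _), fun u => ?_⟩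
  rcases eq_or_ne u 0 with rfl | hu
  · have h0 : (fun x => ENNReal.ofReal (|(0 : D.X ε) x| ^ sobExp N)) =ᵐ[volume] fun _ => 0 := by
      filter_upwards [Lp.coeFn_zero ℝ 2 (volume : Measure (EuclideanSpace ℝ (Fin N)))] with x hx
      have hx' : (0 : D.X ε) x = 0 := hx
      rw [hx', abs_zero, Real.zero_rpow (by linarith), ENNReal.ofReal_zero]
    rw [lintegral_congr_ae h0]
    simp
  · have h1 := normH_pos hu
    have h2 := D.embC_pos
    have h3 := h (toL2 u) (grad u) (hasWeakGradient_grad u) ((1 + D.embC) * D.normH ε u)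
      (by positivity) ((norm_toL2_le u).trans (by nlinarith))
      ((norm_grad_le u).trans (by nlinarith))
    rwa [Real.mul_rpow (by positivity) h1.le, ← mul_assoc] at h3

lemma measurable_F1_comp (u : D.X ε) : AEMeasurable (fun x => F1 D.δ (u x)) volume :=
  measurable_F1.comp_aemeasurable (aemeasurable_coe u)

lemma modular_eq (u : EuclideanSpace ℝ (Fin N) → ℝ) {l : ℝ} (hl : 0 < l) :
    modular (F1 D.δ) u l = ∫⁻ x, ENNReal.ofReal (F1 D.δ (l⁻¹ * u x)) := by
  unfold modular
  refine lintegral_congr fun x => ?_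
  rw [← F1_abs (l⁻¹ * u x), abs_mul, abs_of_pos (inv_pos.2 hl), div_eq_inv_mul]

/-- The modular of `F₁` is small on small balls of `X_ε`. -/
lemma lintegral_F1_le (u : D.X ε) {l : ℝ} (hl : luxemburgNorm (F1 D.δ) u < l) (hl1 : l ≤ 1) :
    ∫⁻ x, ENNReal.ofReal (F1 D.δ (u x)) ≤ ENNReal.ofReal l := by
  obtain ⟨k, ⟨hk, hk1⟩, hkl⟩ := exists_lt_of_csInf_lt
    ((memOrlicz u).exists_le_one (convexOn_F1 D.δ_pos D.δ_small) (F1_zero D.δ_pos)) hl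
  rw [modular_eq _ hk] at hk1
  calc ∫⁻ x, ENNReal.ofReal (F1 D.δ (u x))
      ≤ ∫⁻ x, ENNReal.ofReal k * ENNReal.ofReal (F1 D.δ (k⁻¹ * u x)) := by
        refine lintegral_mono fun x => ?_
        rw [← ENNReal.ofReal_mul hk.le]
        refine ENNReal.ofReal_le_ofReal ?_
        have := F1_scale D.δ_pos D.δ_small hk.le (hkl.le.trans hl1) (k⁻¹ * u x)
        rwa [mul_inv_cancel_left₀ hk.ne'] at this
    _ = ENNReal.ofReal k * ∫⁻ x, ENNReal.ofReal (F1 D.δ (k⁻¹ * u x)) :=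
        lintegral_const_mul' _ _ ENNReal.ofReal_ne_top
    _ ≤ ENNReal.ofReal l * 1 := by gcongr
    _ = _ := mul_one _

lemma luxemburg_le_of_modular {w : EuclideanSpace ℝ (Fin N) → ℝ} {l : ℝ} (hl : 0 < l)
    (h : modular (F1 D.δ) w l ≤ 1) : luxemburgNorm (F1 D.δ) w ≤ l :=
  csInf_le ⟨0, fun _ hl => hl.1.le⟩ ⟨hl, h⟩

lemma luxemburg_le_of_small {w : EuclideanSpace ℝ (Fin N) → ℝ} {l : ℝ} (hl : 0 < l) (hl1 : l ≤ 1)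
    (h : ∫⁻ x, ENNReal.ofReal (F1 D.δ (w x)) ≤ ENNReal.ofReal (l ^ 2)) :
    luxemburgNorm (F1 D.δ) w ≤ l := by
  refine luxemburg_le_of_modular hl ?_
  rw [modular_eq _ hl]
  calc ∫⁻ x, ENNReal.ofReal (F1 D.δ (l⁻¹ * w x))
      ≤ ∫⁻ x, ENNReal.ofReal ((l⁻¹) ^ 2) * ENNReal.ofReal (F1 D.δ (w x)) := by
        refine lintegral_mono fun x => ?_
        rw [← ENNReal.ofReal_mul (by positivity)]
        exact ENNReal.ofReal_le_ofReal (F1_mul_le D.δ_pos ((one_le_inv₀ hl).2 hl1) _)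
    _ = ENNReal.ofReal ((l⁻¹) ^ 2) * ∫⁻ x, ENNReal.ofReal (F1 D.δ (w x)) :=
        lintegral_const_mul' _ _ ENNReal.ofReal_ne_top
    _ ≤ ENNReal.ofReal ((l⁻¹) ^ 2) * ENNReal.ofReal (l ^ 2) := by gcongr
    _ = 1 := by
        rw [← ENNReal.ofReal_mul (by positivity), ← mul_pow, inv_mul_cancel₀ hl.ne', one_pow,
          ENNReal.ofReal_one]

lemma luxemburg_le_of_large {w : EuclideanSpace ℝ (Fin N) → ℝ} {l : ℝ} (hl : 1 ≤ l)
    (h : ∫⁻ x, ENNReal.ofReal (F1 D.δ (w x)) ≤ ENNReal.ofReal l) :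
    luxemburgNorm (F1 D.δ) w ≤ l := by
  have hl0 : 0 < l := by linarith
  refine luxemburg_le_of_modular hl0 ?_
  rw [modular_eq _ hl0]
  calc ∫⁻ x, ENNReal.ofReal (F1 D.δ (l⁻¹ * w x))
      ≤ ∫⁻ x, ENNReal.ofReal (l⁻¹) * ENNReal.ofReal (F1 D.δ (w x)) := by
        refine lintegral_mono fun x => ?_
        rw [← ENNReal.ofReal_mul (by positivity)]
        exact ENNReal.ofReal_le_ofReal (F1_scale D.δ_pos D.δ_small (by positivity)
          (inv_le_one_of_one_le₀ hl) _)
    _ = ENNReal.ofReal (l⁻¹) * ∫⁻ x, ENNReal.ofReal (F1 D.δ (w x)) :=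
        lintegral_const_mul' _ _ ENNReal.ofReal_ne_top
    _ ≤ ENNReal.ofReal (l⁻¹) * ENNReal.ofReal l := by gcongr
    _ = 1 := by
        rw [← ENNReal.ofReal_mul (by positivity), inv_mul_cancel₀ hl0.ne', ENNReal.ofReal_one]

lemma modular_antitone (w : EuclideanSpace ℝ (Fin N) → ℝ) {k l : ℝ} (hk : 0 < k) (hkl : k ≤ l) :
    modular (F1 D.δ) w l ≤ modular (F1 D.δ) w k := by
  refine lintegral_mono fun x => ENNReal.ofReal_le_ofReal (F1_mono D.δ_pos D.δ_small ?_)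
  rw [abs_div, abs_div, abs_of_pos hk, abs_of_pos (hk.trans_le hkl)]
  gcongr

/-- An element of `X_ε` from a function in `L²` and its weak gradient. -/
def mkX (u : Lp ℝ 2 (volume : Measure (EuclideanSpace ℝ (Fin N))))
    (g : Lp (EuclideanSpace ℝ (Fin N)) 2 (volume : Measure (EuclideanSpace ℝ (Fin N))))
    (hw : HasWeakGradient u g) (hV : Integrable (fun x => D.V (ε • x) * (u x) ^ 2))
    (hO : MemOrlicz (F1 D.δ) u) : D.X ε :=
  (⟨u, ⟨g, hw⟩, hV, hO⟩ : D.energySubmodule ε)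

lemma grad_eq_of_hasWeakGradient {u : D.X ε}
    {g : Lp (EuclideanSpace ℝ (Fin N)) 2 (volume : Measure (EuclideanSpace ℝ (Fin N)))}
    (h : HasWeakGradient u g) : grad u = g :=
  Lp.ext ((hasWeakGradient_grad u).unique h (locallyIntegrable_grad _) (locallyIntegrable_grad _))

lemma continuous_V_smul (D : PenalizedProblem N) (ε : ℝ) :
    Continuous fun x : EuclideanSpace ℝ (Fin N) => D.V (ε • x) :=
  D.continuous_V.comp (continuous_const_smul ε)

lemma integrable_V_of_weighted {u : Lp ℝ 2 (volume : Measure (EuclideanSpace ℝ (Fin N)))}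
    (h : Integrable fun x => (D.V (ε • x) + 1) * (u x) ^ 2) :
    Integrable fun x => D.V (ε • x) * (u x) ^ 2 := by
  refine (h.sub (Lp.memLp u).integrable_sq).congr (ae_of_all _ fun x => ?_)
  simp only [Pi.sub_apply]; ring

instance : CompleteSpace (D.X ε) := by
  refine Metric.complete_of_cauchySeq_tendsto fun u hu => ?_
  obtain ⟨Z, hZ⟩ := cauchySeq_tendsto_of_complete ((embedL D ε).uniformContinuous.comp_cauchySeq hu)
  obtain ⟨U, hU⟩ := cauchySeq_tendsto_of_complete ((toL2L D ε).uniformContinuous.comp_cauchySeq hu)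
  have hG : Tendsto (fun n => grad (u n)) atTop (𝓝 Z.fst) :=
    ((WithLp.fstL 2 ℝ _ _).continuous.tendsto Z).comp hZ
  have hW : Tendsto (fun n => (memLp_weighted (u n)).toLp _) atTop (𝓝 Z.snd) :=
    ((WithLp.sndL 2 ℝ _ _).continuous.tendsto Z).comp hZ
  have hwg : HasWeakGradient U Z.fst :=
    HasWeakGradient.of_tendsto (fun n => hasWeakGradient_grad (u n)) hU hG
  obtain ⟨k, hk, hkU⟩ := (tendstoInMeasure_of_tendsto_Lp hU).exists_seq_tendsto_ae
  obtain ⟨j, hj, hjW⟩ := (tendstoInMeasure_of_tendsto_Lp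
    (hW.comp hk.tendsto_atTop)).exists_seq_tendsto_ae
  have hWU : Z.snd =ᵐ[volume] fun x => Real.sqrt (D.V (ε • x) + 1) * U x := by
    have h1 : ∀ᵐ x, ∀ n, (memLp_weighted (u n)).toLp _ x =
        Real.sqrt (D.V (ε • x) + 1) * u n x :=
      ae_all_iff.2 fun n => (memLp_weighted (u n)).coeFn_toLp
    filter_upwards [hkU, hjW, h1] with x hx1 hx2 hx3
    refine tendsto_nhds_unique hx2 ?_
    have h2 := (hx1.comp hj.tendsto_atTop).const_mul (Real.sqrt (D.V (ε • x) + 1))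
    refine h2.congr fun n => ?_
    exact (hx3 _).symm
  have hV : Integrable fun x => (D.V (ε • x) + 1) * (U x) ^ 2 := by
    refine (Lp.memLp Z.snd).integrable_sq.congr ?_
    filter_upwards [hWU] with x hx
    rw [hx, mul_pow, Real.sq_sqrt (V_add_one_pos D _).le]
  -- Fatou's lemma for the modular of the differences
  have hmod : ∀ η : ℝ, 0 < η → ∃ n₀, ∀ n ≥ n₀,
      modular (F1 D.δ) (fun x => U x - u n x) η ≤ 1 := by
    intro η hη
    obtain ⟨n₀, hn₀⟩ := Metric.cauchySeq_iff.1 hu η hη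
    refine ⟨n₀, fun n hn => ?_⟩
    have h1 : ∀ m ≥ n₀, modular (F1 D.δ) (fun x => u m x - u n x) η ≤ 1 := by
      intro m hm
      have h2 := hn₀ m hm n hn
      rw [dist_eq_norm] at h2
      obtain ⟨l, ⟨hl, hl1⟩, hlη⟩ := exists_lt_of_csInf_lt
        ((memOrlicz (u m - u n)).exists_le_one (convexOn_F1 D.δ_pos D.δ_small)
          (F1_zero D.δ_pos)) ((luxemburg_le_norm _).trans_lt h2)
      rw [modular_congr (coe_sub (u m) (u n))] at hl1
      exact (modular_antitone _ hl hlη.le).trans hl1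
    calc modular (F1 D.δ) (fun x => U x - u n x) η
        = ∫⁻ x, liminf (fun i => ENNReal.ofReal (F1 D.δ (|u (k i) x - u n x| / η))) atTop := by
          refine lintegral_congr_ae ?_
          filter_upwards [hkU] with x hx
          refine (Tendsto.liminf_eq ?_).symm
          refine ENNReal.tendsto_ofReal (((continuous_F1 D.δ_pos).tendsto _).comp ?_)
          exact ((hx.sub_const _).abs).div_const _
      _ ≤ liminf (fun i => modular (F1 D.δ) (fun x => u (k i) x - u n x) η) atTop := by
          refine lintegral_liminf_le' fun i => ?_
          have h3 : AEMeasurable (fun x => |u (k i) x - u n x| / η) volume :=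
            ((aemeasurable_coe (u (k i))).sub (aemeasurable_coe (u n))).norm.div_const η
          exact (measurable_F1.comp_aemeasurable h3).ennreal_ofReal
      _ ≤ 1 := by
          refine liminf_le_of_le (by isBoundedDefault) fun b hb => ?_
          obtain ⟨i, hi1, hi2⟩ := (hb.and (eventually_ge_atTop n₀)).exists
          exact hi1.trans (h1 _ (hi2.trans (hk.id_le i)))
  have hO : MemOrlicz (F1 D.δ) U := by
    obtain ⟨n, hn⟩ := hmod 1 one_pos
    have h1 : MemOrlicz (F1 D.δ) fun x => U x - u n x :=
      ⟨((Lp.memLp U).sub (Lp.memLp (toL2 (u n)))).locallyIntegrable (by norm_num), 1, one_pos,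
        (hn n le_rfl).trans_lt ENNReal.one_lt_top⟩
    have h2 := h1.add measurable_F1 (convexOn_F1 D.δ_pos D.δ_small) (F1_zero D.δ_pos)
      (fun t ht => F1_nonneg D.δ_pos D.δ_small ht) (memOrlicz (u n))
    simpa using h2
  set w : D.X ε := mkX U Z.fst hwg (integrable_V_of_weighted hV) hO with hw
  have hwU : toL2 w = U := rfl
  have hwZ : embedL D ε w = Z := by
    have h1 : grad w = Z.fst := grad_eq_of_hasWeakGradient hwg
    have h2 : (memLp_weighted w).toLp _ = Z.snd :=
      Lp.ext ((memLp_weighted w).coeFn_toLp.trans hWU.symm)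
    rw [embedL_apply, embed, h1, h2]
    rfl
  refine ⟨w, ?_⟩
  rw [Metric.tendsto_atTop]
  intro η hη
  rw [← hwZ] at hZ
  obtain ⟨n₁, hn₁⟩ := Metric.tendsto_atTop.1 hZ (η / 2) (half_pos hη)
  obtain ⟨n₂, hn₂⟩ := hmod (η / 4) (by positivity)
  refine ⟨max n₁ n₂, fun n hn => ?_⟩
  have h1 := hn₁ n ((le_max_left _ _).trans hn)
  rw [dist_eq_norm, Function.comp_apply, ← map_sub, ← normH_eq'] at h1
  have h2 := luxemburg_le_of_modular (by positivity) (hn₂ n ((le_max_right _ _).trans hn))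
  have h3 : luxemburgNorm (F1 D.δ) (u n - w) = luxemburgNorm (F1 D.δ) fun x => U x - u n x := by
    rw [luxemburgNorm_congr (coe_sub (u n) w)]
    have h4 := luxemburgNorm_smul (u := fun x => U x - u n x) (F1_zero D.δ_pos) (-1)
    rw [abs_neg, abs_one, one_mul] at h4
    rw [← h4]
    congr 1
    ext x
    change u n x - U x = _
    ring
  rw [dist_eq_norm, norm_def, h3]
  linarith

/-- The space `X_ε` contains the smooth bump functions. -/
instance : Nontrivial (D.X ε) := by
  let φ : ContDiffBump (0 : EuclideanSpace ℝ (Fin N)) := default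
  have hφC : ContDiff ℝ ∞ φ := φ.contDiff
  have hφc : HasCompactSupport φ := φ.hasCompactSupport
  have hφ2 : MemLp φ 2 (volume : Measure (EuclideanSpace ℝ (Fin N))) :=
    hφC.continuous.memLp_of_hasCompactSupport hφc
  set G : EuclideanSpace ℝ (Fin N) → EuclideanSpace ℝ (Fin N) := fun x =>
    (InnerProductSpace.toDual ℝ _).symm (fderiv ℝ φ x) with hG
  have hGC : Continuous G :=
    (InnerProductSpace.toDual ℝ _).symm.continuous.comp (hφC.continuous_fderiv (by simp))
  have hGc : HasCompactSupport G := (hφc.fderiv (𝕜 := ℝ)).comp_left (map_zero _)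
  have hG2 : MemLp G 2 (volume : Measure (EuclideanSpace ℝ (Fin N))) :=
    hGC.memLp_of_hasCompactSupport hGc
  have hw : HasWeakGradient φ G := by
    intro ψ hψ hψc v
    have hd : Continuous fun x => fderiv ℝ φ x v :=
      (hφC.continuous_fderiv (by simp)).clm_apply continuous_const
    have hd' : Continuous fun x => fderiv ℝ ψ x v :=
      (hψ.continuous_fderiv (by simp)).clm_apply continuous_const
    have h1 := integral_mul_fderiv_eq_neg_fderiv_mul_of_integrable
      (μ := (volume : Measure (EuclideanSpace ℝ (Fin N)))) (f := φ) (g := ψ) (v := v)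
      ((hd.mul hψ.continuous).integrable_of_hasCompactSupport hψc.mul_left)
      ((hφC.continuous.mul hd').integrable_of_hasCompactSupport hφc.mul_right)
      ((hφC.continuous.mul hψ.continuous).integrable_of_hasCompactSupport hψc.mul_left)
      (fun x _ => (hφC.differentiable (by simp)) x) (fun x _ => (hψ.differentiable (by simp)) x)
    rw [h1]
    congr 1
    refine integral_congr_ae (ae_of_all _ fun x => ?_)
    simp [hG]
  have hV : Integrable fun x => D.V (ε • x) * (hφ2.toLp φ x) ^ 2 := by
    have h1 : Integrable fun x => D.V (ε • x) * (φ x) ^ 2 := by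
      refine Continuous.integrable_of_hasCompactSupport
        ((D.continuous_V_smul ε).mul (hφC.continuous.pow 2)) ?_
      have : HasCompactSupport fun x => φ x ^ 2 :=
        hφc.comp_left (g := fun t : ℝ => t ^ 2) (by simp)
      exact this.mul_left
    refine h1.congr ?_
    filter_upwards [hφ2.coeFn_toLp] with x hx
    rw [hx]
  have hO : MemOrlicz (F1 D.δ) φ := by
    refine ⟨hφC.continuous.locallyIntegrable, 1, one_pos, ?_⟩
    rw [modular_eq _ one_pos]
    have h1 : Integrable fun x => F1 D.δ (φ x) :=
      ((continuous_F1 D.δ_pos).comp hφC.continuous).integrable_of_hasCompactSupport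
        (hφc.comp_left (F1_zero D.δ_pos))
    simp only [inv_one, one_mul]
    exact h1.lintegral_lt_top
  let w : D.X ε := mkX (hφ2.toLp φ) (hG2.toLp G)
    (hw.congr hφ2.coeFn_toLp.symm hG2.coeFn_toLp.symm) hV (hO.congr hφ2.coeFn_toLp.symm)
  refine ⟨⟨w, 0, fun h => ?_⟩⟩
  have h1 : hφ2.toLp φ = 0 := congrArg toL2 h
  have h2 : (φ : EuclideanSpace ℝ (Fin N) → ℝ) =ᵐ[volume] 0 := by
    have h3 := hφ2.coeFn_toLp
    rw [h1] at h3
    exact h3.symm.trans (Lp.coeFn_zero ℝ 2 volume)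
  have h3 := (hφC.continuous.ae_eq_iff_eq volume continuous_zero).1 h2
  have h4 := φ.one_of_mem_closedBall (x := 0) (by simp [φ.rIn_pos.le])
  rw [h3] at h4
  simp at h4

end PenalizedProblem

/-! ### Superposition operators on `X_ε` -/

section Scalar

variable {δ p : ℝ}

lemma growth_pow_mul (hδ : 0 < δ) (hδ' : δ < Real.exp (-(3 / 2))) (hp : 2 ≤ p) (j : ℕ) (s : ℝ) :
    growth δ p (2 ^ j * s) ≤ (2 ^ p) ^ j * growth δ p s := by
  induction j with
  | zero => simp
  | succ j ih =>
    have h1 := growth_two_mul hδ hδ' hp (2 ^ j * s)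
    have h2 : (0 : ℝ) < 2 ^ p := by positivity
    calc growth δ p (2 ^ (j + 1) * s) = growth δ p (2 * (2 ^ j * s)) := by rw [pow_succ]; ring_nf
      _ ≤ 2 ^ p * growth δ p (2 ^ j * s) := h1
      _ ≤ 2 ^ p * ((2 ^ p) ^ j * growth δ p s) := by gcongr
      _ = _ := by rw [pow_succ]; ring

lemma slope1_add_le (hδ : 0 < δ) (hδ' : δ < Real.exp (-(3 / 2))) (hp : 2 ≤ p) {a b τ : ℝ}
    (h : |τ| ≤ |a| + |b|) : slope1 δ p τ ≤ 2 ^ p * (slope1 δ p a + slope1 δ p b) := by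
  have key : ∀ c, |τ| ≤ 2 * |c| → slope1 δ p τ ≤ 2 ^ p * slope1 δ p c := by
    intro c hc
    have h1 : |τ| ≤ |2 * c| := by rwa [abs_mul, abs_two]
    refine (slope1_mono hδ hδ' hp h1).trans ?_
    have hg := growth_nonneg hδ hδ' (p := p) c
    have h3 : (0 : ℝ) < 2 ^ p := by positivity
    unfold slope1
    rw [← mul_div_assoc, abs_mul, abs_two]
    have h2 : growth δ p (2 * c) / (2 * |c|) ≤ 2 ^ p * growth δ p c / (2 * |c|) := by
      gcongr
      exact growth_two_mul hδ hδ' hp c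
    refine h2.trans ?_
    rcases eq_or_ne c 0 with rfl | hc0
    · simp
    · have : 0 < |c| := abs_pos.2 hc0
      gcongr
      linarith
  have h3 : (0 : ℝ) < 2 ^ p := by positivity
  rcases le_total |a| |b| with hab | hab
  · have := key b (by linarith)
    nlinarith [slope1_nonneg hδ hδ' (p := p) a]
  · have := key a (by linarith)
    nlinarith [slope1_nonneg hδ hδ' (p := p) b]

/-- The interpolation inequality behind the estimates in the dual norm: either `|v|` is comparable
to `|s|`, or the slope of the growth function at `s` is small compared with that at `v`. -/
lemma slope1_mul_le (hδ : 0 < δ) (hδ' : δ < Real.exp (-(3 / 2))) (hp : 2 ≤ p) {K : ℝ} (hK : 1 ≤ K)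
    {a C : ℝ} (ha : 0 ≤ a) (hC : 0 ≤ C) (s v : ℝ) (haC : a ≤ C * slope1 δ p s) :
    a * |v| ≤ K * (a * |s|) + C / K ^ (1 / 3 : ℝ) * growth δ p v := by
  have hK0 : 0 < K := by linarith
  have hKp : 0 < K ^ (1 / 3 : ℝ) := by positivity
  have hg := growth_nonneg hδ hδ' (p := p) v
  rcases le_total |v| (K * |s|) with h | h
  · have : 0 ≤ C / K ^ (1 / 3 : ℝ) * growth δ p v := by positivity
    nlinarith [mul_le_mul_of_nonneg_left h ha]
  · have h1 := slope1_growth hδ hδ' hp hK h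
    have h3 : 0 ≤ K * (a * |s|) := by positivity
    have h4 : a * |v| ≤ C / K ^ (1 / 3 : ℝ) * growth δ p v := by
      rw [← slope1_mul hδ hp v, div_mul_eq_mul_div, le_div_iff₀ hKp]
      calc a * |v| * K ^ (1 / 3 : ℝ) ≤ C * slope1 δ p s * |v| * K ^ (1 / 3 : ℝ) := by gcongr
        _ = C * (K ^ (1 / 3 : ℝ) * slope1 δ p s) * |v| := by ring
        _ ≤ C * slope1 δ p v * |v| := by gcongr
        _ = _ := by ring
    linarith

/-- The mean value inequality under the growth condition. -/
lemma abs_add_sub_le {f f' : ℝ → ℝ} (hδ : 0 < δ) (hδ' : δ < Real.exp (-(3 / 2))) (hp : 2 ≤ p)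
    {C : ℝ} (hC : 0 ≤ C) (hf : ∀ s, HasDerivAt f (f' s) s)
    (hb : ∀ s, |f' s| ≤ C * slope1 δ p s) (a b : ℝ) :
    |f (a + b) - f a| ≤ C * (2 ^ p * (slope1 δ p a + slope1 δ p b)) * |b| := by
  have hb' : ∀ τ ∈ Icc (-(|a| + |b|)) (|a| + |b|),
      ‖f' τ‖ ≤ C * (2 ^ p * (slope1 δ p a + slope1 δ p b)) := by
    intro τ hτ
    refine (hb τ).trans ?_
    gcongr
    exact slope1_add_le hδ hδ' hp (abs_le.2 hτ)
  have h := (convex_Icc (-(|a| + |b|)) (|a| + |b|)).norm_image_sub_le_of_norm_hasDerivWithin_le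
    (fun τ _ => (hf τ).hasDerivWithinAt) hb' (x := a) (y := a + b)
    (abs_le.1 (by linarith [abs_nonneg b])) (abs_le.1 (abs_add_le a b))
  simpa using h

end Scalar

lemma eventually_of_subseq {ι : Type*} {l : Filter ι} [l.IsCountablyGenerated] {P : ι → Prop}
    (h : ∀ z : ℕ → ι, Tendsto z atTop l →
      ∃ k : ℕ → ℕ, StrictMono k ∧ ∀ᶠ n in atTop, P (z (k n))) : ∀ᶠ x in l, P x := by
  by_contra hn
  obtain ⟨z, hz, hzP⟩ := exists_seq_forall_of_frequently (not_eventually.1 hn)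
  obtain ⟨k, -, hk⟩ := h z hz
  obtain ⟨n, hn⟩ := hk.exists
  exact hzP _ hn

namespace PenalizedProblem

variable {N : ℕ} {D : PenalizedProblem N} {ε : ℝ}

/-- The growth function of the problem. -/
def gr (D : PenalizedProblem N) (s : ℝ) : ℝ := growth D.δ (sobExp N) s

/-- The slope of the growth function of the problem. -/
def sl (D : PenalizedProblem N) (s : ℝ) : ℝ := slope1 D.δ (sobExp N) s

lemma gr_nonneg (D : PenalizedProblem N) (s : ℝ) : 0 ≤ D.gr s := growth_nonneg D.δ_pos D.δ_small s

lemma sl_nonneg (D : PenalizedProblem N) (s : ℝ) : 0 ≤ D.sl s := slope1_nonneg D.δ_pos D.δ_small s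

lemma sl_mul (hN : 1 ≤ N) (D : PenalizedProblem N) (s : ℝ) : D.sl s * |s| = D.gr s :=
  slope1_mul D.δ_pos (two_lt_sobExp hN).le s

lemma aemeasurable_gr (u : D.X ε) : AEMeasurable (fun x => D.gr (u x)) volume :=
  measurable_growth.comp_aemeasurable (aemeasurable_coe u)

lemma aemeasurable_sl (u : D.X ε) : AEMeasurable (fun x => D.sl (u x)) volume :=
  measurable_slope1.comp_aemeasurable (aemeasurable_coe u)

/-- The modular of the growth function is small near the origin of `X_ε`. -/
lemma exists_lintegral_gr_le (hN : 1 ≤ N) (D : PenalizedProblem N) (ε : ℝ) :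
    ∃ C : ℝ, 0 ≤ C ∧ ∀ u : D.X ε, ‖u‖ ≤ 1 / 2 →
      ∫⁻ x, ENNReal.ofReal (D.gr (u x)) ≤ ENNReal.ofReal (C * ‖u‖) := by
  obtain ⟨C, hC, hS⟩ := exists_sobolev_X hN D ε
  have hp := two_lt_sobExp hN
  have hw := D.wt_pos
  refine ⟨2 + D.wt⁻¹ + C, by positivity, fun u hu => ?_⟩
  have hu0 := norm_nonneg u
  have hHu := normH_le_norm u
  have hH0 := normH_nonneg u
  have h1 : ∫⁻ x, ENNReal.ofReal (F1 D.δ (u x)) ≤ ENNReal.ofReal (2 * ‖u‖) := by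
    rcases eq_or_ne u 0 with rfl | h0
    · have h0 : (fun x => ENNReal.ofReal (F1 D.δ ((0 : D.X ε) x))) =ᵐ[volume] fun _ => 0 := by
        filter_upwards [Lp.coeFn_zero ℝ 2 (volume : Measure (EuclideanSpace ℝ (Fin N)))] with x hx
        have hx' : (0 : D.X ε) x = 0 := hx
        rw [hx', F1_zero D.δ_pos, ENNReal.ofReal_zero]
      rw [lintegral_congr_ae h0]
      simp
    · have h3 : 0 < ‖u‖ := norm_pos_iff.2 h0
      exact lintegral_F1_le u ((luxemburg_le_norm u).trans_lt (by linarith)) (by linarith)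
  have h2 : ∫⁻ x, ENNReal.ofReal ((u x) ^ 2) ≤ ENNReal.ofReal (D.wt⁻¹ * ‖u‖) := by
    rw [← ofReal_integral_eq_lintegral_ofReal (integrable_sq u) (ae_of_all _ fun x => sq_nonneg _)]
    refine ENNReal.ofReal_le_ofReal ?_
    have h3 := wt_mul_integral_sq_le u
    rw [le_inv_mul_iff₀ hw]
    nlinarith
  have h3 : ∫⁻ x, ENNReal.ofReal (|u x| ^ sobExp N) ≤ ENNReal.ofReal (C * ‖u‖) := by
    refine (hS u).trans (ENNReal.ofReal_le_ofReal ?_)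
    gcongr
    calc D.normH ε u ^ sobExp N ≤ ‖u‖ ^ sobExp N := by gcongr
      _ ≤ ‖u‖ ^ (1 : ℝ) := Real.rpow_le_rpow_of_exponent_ge' hu0 (by linarith) zero_le_one
          (by linarith)
      _ = ‖u‖ := Real.rpow_one _
  calc ∫⁻ x, ENNReal.ofReal (D.gr (u x))
      = ∫⁻ x, (ENNReal.ofReal (F1 D.δ (u x)) + ENNReal.ofReal ((u x) ^ 2) +
          ENNReal.ofReal (|u x| ^ sobExp N)) := by
        refine lintegral_congr fun x => ?_
        have h4 := F1_nonneg' D.δ_pos D.δ_small (u x)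
        unfold gr growth
        rw [ENNReal.ofReal_add (by positivity) (by positivity),
          ENNReal.ofReal_add h4 (by positivity)]
    _ = (∫⁻ x, ENNReal.ofReal (F1 D.δ (u x))) + (∫⁻ x, ENNReal.ofReal ((u x) ^ 2)) +
          ∫⁻ x, ENNReal.ofReal (|u x| ^ sobExp N) := by
        rw [lintegral_add_left', lintegral_add_left']
        · exact (measurable_F1_comp u).ennreal_ofReal
        · exact (measurable_F1_comp u).ennreal_ofReal.add
            ((aemeasurable_coe u).pow_const 2).ennreal_ofReal
    _ ≤ ENNReal.ofReal (2 * ‖u‖) + ENNReal.ofReal (D.wt⁻¹ * ‖u‖) + ENNReal.ofReal (C * ‖u‖) := by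
        gcongr
    _ = _ := by
        rw [← ENNReal.ofReal_add (by positivity) (by positivity),
          ← ENNReal.ofReal_add (by positivity) (by positivity)]
        congr 1; ring

/-- The modular of the growth function is bounded on bounded subsets of `X_ε`. -/
lemma exists_lintegral_gr_le_of_norm_le (hN : 1 ≤ N) (D : PenalizedProblem N) (ε M : ℝ) :
    ∃ B : ℝ, 0 ≤ B ∧ ∀ u : D.X ε, ‖u‖ ≤ M →
      ∫⁻ x, ENNReal.ofReal (D.gr (u x)) ≤ ENNReal.ofReal B := by
  obtain ⟨C, hC, hG⟩ := exists_lintegral_gr_le hN D ε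
  obtain ⟨j, hj⟩ := pow_unbounded_of_one_lt (2 * M) one_lt_two
  have hj0 : (0 : ℝ) < 2 ^ j := by positivity
  have h2p : (0 : ℝ) < 2 ^ sobExp N := by positivity
  refine ⟨(2 ^ sobExp N) ^ j * (C * (1 / 2)), by positivity, fun u hu => ?_⟩
  have hu2 : ‖((2 : ℝ) ^ j)⁻¹ • u‖ ≤ 1 / 2 := by
    rw [norm_smul, norm_inv, Real.norm_of_nonneg hj0.le, inv_mul_le_iff₀ hj0]
    linarith
  have h1 := hG (((2 : ℝ) ^ j)⁻¹ • u) hu2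
  calc ∫⁻ x, ENNReal.ofReal (D.gr (u x))
      ≤ ∫⁻ x, ENNReal.ofReal ((2 ^ sobExp N) ^ j) *
          ENNReal.ofReal (D.gr ((((2 : ℝ) ^ j)⁻¹ • u : D.X ε) x)) := by
        refine lintegral_mono_ae ?_
        filter_upwards [coe_smul ((2 : ℝ) ^ j)⁻¹ u] with x hx
        rw [← ENNReal.ofReal_mul (by positivity), hx]
        refine ENNReal.ofReal_le_ofReal ?_
        have h3 := growth_pow_mul D.δ_pos D.δ_small (two_lt_sobExp hN).le j
          (((2 : ℝ) ^ j)⁻¹ * u x)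
        rwa [mul_inv_cancel_left₀ hj0.ne'] at h3
    _ = ENNReal.ofReal ((2 ^ sobExp N) ^ j) *
          ∫⁻ x, ENNReal.ofReal (D.gr ((((2 : ℝ) ^ j)⁻¹ • u : D.X ε) x)) :=
        lintegral_const_mul' _ _ ENNReal.ofReal_ne_top
    _ ≤ ENNReal.ofReal ((2 ^ sobExp N) ^ j) * ENNReal.ofReal (C * (1 / 2)) := by
        gcongr
        exact h1.trans (ENNReal.ofReal_le_ofReal (by gcongr))
    _ = _ := (ENNReal.ofReal_mul (by positivity)).symm

lemma integrable_gr (hN : 1 ≤ N) (u : D.X ε) : Integrable fun x => D.gr (u x) := by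
  obtain ⟨B, -, hB⟩ := exists_lintegral_gr_le_of_norm_le hN D ε ‖u‖
  refine ⟨(aemeasurable_gr u).aestronglyMeasurable, ?_⟩
  rw [hasFiniteIntegral_iff_ofReal (ae_of_all _ fun x => D.gr_nonneg _)]
  exact (hB u le_rfl).trans_lt ENNReal.ofReal_lt_top

/-- Reduction of an estimate of `∫ |d v|` by `‖v‖` to a sphere. -/
lemma lintegral_mul_le_of_sphere {d : EuclideanSpace ℝ (Fin N) → ℝ} {B : ℝ}
    (h : ∀ v : D.X ε, ‖v‖ = 1 / 2 → ∫⁻ x, ‖d x * v x‖ₑ ≤ ENNReal.ofReal (B / 2)) (v : D.X ε) :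
    ∫⁻ x, ‖d x * v x‖ₑ ≤ ENNReal.ofReal (B * ‖v‖) := by
  rcases eq_or_ne v 0 with rfl | hv
  · have h0 : (fun x => ‖d x * (0 : D.X ε) x‖ₑ) =ᵐ[volume] fun _ => 0 := by
      filter_upwards [Lp.coeFn_zero ℝ 2 (volume : Measure (EuclideanSpace ℝ (Fin N)))] with x hx
      have hx' : (0 : D.X ε) x = 0 := hx
      rw [hx', mul_zero, enorm_zero]
    rw [lintegral_congr_ae h0]
    simp
  · have hv0 : 0 < ‖v‖ := norm_pos_iff.2 hv
    have h1 := h ((2 * ‖v‖)⁻¹ • v) (by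
      rw [norm_smul, norm_inv, Real.norm_of_nonneg (by positivity)]; field_simp)
    have h2 : ∫⁻ x, ‖d x * v x‖ₑ = ENNReal.ofReal (2 * ‖v‖) *
        ∫⁻ x, ‖d x * ((2 * ‖v‖)⁻¹ • v : D.X ε) x‖ₑ := by
      rw [← lintegral_const_mul' _ _ ENNReal.ofReal_ne_top]
      refine lintegral_congr_ae ?_
      filter_upwards [coe_smul (2 * ‖v‖)⁻¹ v] with x hx
      rw [hx, ← Real.enorm_of_nonneg (by positivity : 0 ≤ 2 * ‖v‖), ← enorm_mul]
      congr 1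
      field_simp
    rw [h2]
    calc _ ≤ ENNReal.ofReal (2 * ‖v‖) * ENNReal.ofReal (B / 2) := by gcongr
      _ = _ := by
        rw [← ENNReal.ofReal_mul (by positivity)]
        congr 1; ring

/-- Functions bounded by the slope of the growth function at an element of `X_ε` define bounded
functionals on `X_ε`, with norms that are bounded as long as the element is. -/
lemma exists_lintegral_mul_le (hN : 1 ≤ N) (D : PenalizedProblem N) (ε M : ℝ) {C : ℝ}
    (hC : 0 ≤ C) :
    ∃ B : ℝ, 0 ≤ B ∧ ∀ u : D.X ε, ‖u‖ ≤ M → ∀ d : EuclideanSpace ℝ (Fin N) → ℝ,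
      (∀ x, |d x| ≤ C * D.sl (u x)) →
      ∀ v : D.X ε, ∫⁻ x, ‖d x * v x‖ₑ ≤ ENNReal.ofReal (B * ‖v‖) := by
  obtain ⟨C₀, hC₀, hG⟩ := exists_lintegral_gr_le hN D ε
  obtain ⟨I, hI, hIu⟩ := exists_lintegral_gr_le_of_norm_le hN D ε M
  have hp := two_lt_sobExp hN
  refine ⟨2 * (C * I + C * (C₀ * (1 / 2))), by positivity, fun u hu d hb =>
    lintegral_mul_le_of_sphere fun v hv => ?_⟩
  have hpt : ∀ x, ‖d x * v x‖ₑ ≤ ENNReal.ofReal C * ENNReal.ofReal (D.gr (u x)) +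
      ENNReal.ofReal C * ENNReal.ofReal (D.gr (v x)) := by
    intro x
    have h1 := slope1_mul_le D.δ_pos D.δ_small hp.le le_rfl (abs_nonneg (d x)) hC (u x) (v x) (hb x)
    rw [Real.one_rpow, div_one, one_mul] at h1
    have h2 : |d x| * |u x| ≤ C * D.gr (u x) := by
      rw [← sl_mul hN, ← mul_assoc]
      exact mul_le_mul_of_nonneg_right (hb x) (abs_nonneg _)
    rw [← ENNReal.ofReal_mul hC, ← ENNReal.ofReal_mul hC,
      ← ENNReal.ofReal_add (mul_nonneg hC (D.gr_nonneg _)) (mul_nonneg hC (D.gr_nonneg _)),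
      ← ofReal_norm, Real.norm_eq_abs, abs_mul]
    exact ENNReal.ofReal_le_ofReal (h1.trans (by simpa [gr] using h2))
  refine (lintegral_mono hpt).trans ?_
  rw [lintegral_add_left' ((aemeasurable_gr u).ennreal_ofReal.const_mul _),
    lintegral_const_mul' _ _ ENNReal.ofReal_ne_top, lintegral_const_mul' _ _ ENNReal.ofReal_ne_top]
  have h3 := hG v hv.le
  rw [hv] at h3
  calc _ ≤ ENNReal.ofReal C * ENNReal.ofReal I +
        ENNReal.ofReal C * ENNReal.ofReal (C₀ * (1 / 2)) := by gcongr; exact hIu u hu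
    _ = _ := by
      rw [← ENNReal.ofReal_mul hC, ← ENNReal.ofReal_mul hC,
        ← ENNReal.ofReal_add (by positivity) (by positivity)]
      congr 1; ring

/-- Dominated convergence in the dual norm of `X_ε`: functions `d_n` tending to `0` almost
everywhere and bounded by the slopes of the growth function at a fixed element and at a null
sequence of `X_ε` define functionals tending to `0` in norm. -/
lemma eventually_lintegral_mul_le (hN : 1 ≤ N) (u : D.X ε) {z : ℕ → D.X ε}
    (hz : Tendsto z atTop (𝓝 0)) {d : ℕ → EuclideanSpace ℝ (Fin N) → ℝ}
    (hd : ∀ n, AEMeasurable (d n) volume) {C : ℝ} (hC : 0 ≤ C)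
    (hb : ∀ n, ∀ᵐ x, |d n x| ≤ C * (D.sl (u x) + D.sl (z n x)))
    (hlim : ∀ᵐ x, Tendsto (fun n => d n x) atTop (𝓝 0)) {η : ℝ} (hη : 0 < η) :
    ∀ᶠ n in atTop, ∀ v : D.X ε, ∫⁻ x, ‖d n x * v x‖ₑ ≤ ENNReal.ofReal (η * ‖v‖) := by
  obtain ⟨C₀, hC₀, hG⟩ := exists_lintegral_gr_le hN D ε
  have hp := two_lt_sobExp hN
  -- `slope1_mul_le` with the factor `K` leaves `C / K ^ (1 / 3)` times the modular of `v`, once for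
  -- each of the two slopes; `κ = K ^ (1 / 3)` is chosen so that these terms stay below `η / 8`
  set κ : ℝ := 1 + 8 * C * C₀ / η with hκ
  have hκ1 : 1 ≤ κ := by
    have : 0 ≤ 8 * C * C₀ / η := by positivity
    linarith
  have hκ0 : 0 < κ := by linarith
  set K : ℝ := κ ^ 3 with hK
  have hK1 : 1 ≤ K := one_le_pow₀ hκ1
  have hK0 : 0 < K := by linarith
  have hKκ : K ^ (1 / 3 : ℝ) = κ := by
    rw [hK, ← Real.rpow_natCast, ← Real.rpow_mul hκ0.le]; norm_num
  have hsmall : 2 * C / κ * (C₀ * (1 / 2)) ≤ η / 8 := by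
    rw [div_mul_eq_mul_div, div_le_iff₀ hκ0, hκ]
    have h1 : η / 8 * (1 + 8 * C * C₀ / η) = η / 8 + C * C₀ := by field_simp
    rw [h1]; linarith
  -- the part of `d n` controlled by the fixed element
  set a : ℕ → EuclideanSpace ℝ (Fin N) → ℝ := fun n x => min |d n x| (C * D.sl (u x)) with ha
  have ha0 : ∀ n x, 0 ≤ a n x := fun n x => le_min (abs_nonneg _) (mul_nonneg hC (D.sl_nonneg _))
  have ham : ∀ n, AEMeasurable (a n) volume := fun n =>
    (hd n).norm.min ((aemeasurable_sl u).const_mul C)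
  have h1 : Tendsto (fun n => ∫⁻ x, ENNReal.ofReal (K * (a n x * |u x|))) atTop (𝓝 0) := by
    have := tendsto_lintegral_of_dominated_convergence'
      (μ := (volume : Measure (EuclideanSpace ℝ (Fin N))))
      (F := fun n x => ENNReal.ofReal (K * (a n x * |u x|))) (f := fun _ => 0)
      (fun x => ENNReal.ofReal (K * (C * D.gr (u x)))) ?_ ?_ ?_ ?_
    · simpa using this
    · exact fun n => (((ham n).mul (aemeasurable_coe u).norm).const_mul K).ennreal_ofReal
    · refine fun n => ae_of_all _ fun x => ENNReal.ofReal_le_ofReal ?_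
      rw [← sl_mul hN, ← mul_assoc C]
      gcongr
      exact min_le_right _ _
    · exact (((integrable_gr hN u).const_mul C).const_mul K).lintegral_lt_top.ne
    · filter_upwards [hlim] with x hx
      have h2 : Tendsto (fun n => a n x) atTop (𝓝 0) := by
        refine tendsto_of_tendsto_of_tendsto_of_le_of_le tendsto_const_nhds
          (by simpa using hx.abs) (fun n => ha0 n x) fun n => min_le_left _ _
      have h3 := ((h2.mul_const |u x|).const_mul K)
      simpa using ENNReal.tendsto_ofReal h3
  have h2 : Tendsto (fun n => ENNReal.ofReal (K * C * (C₀ * ‖z n‖))) atTop (𝓝 0) := by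
    have h3 := ((tendsto_norm_zero.comp hz).const_mul C₀).const_mul (K * C)
    simpa using ENNReal.tendsto_ofReal h3
  have hη8 : 0 < ENNReal.ofReal (η / 8) := ENNReal.ofReal_pos.2 (by positivity)
  have hzs : ∀ᶠ n in atTop, ‖z n‖ ≤ 1 / 2 := by
    have h3 := (tendsto_norm_zero.comp hz).eventually (Iic_mem_nhds (by norm_num : (0 : ℝ) < 1 / 2))
    exact h3
  filter_upwards [ENNReal.tendsto_nhds_zero.1 h1 _ hη8, ENNReal.tendsto_nhds_zero.1 h2 _ hη8, hzs]
    with n hn1 hn2 hn3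
  refine lintegral_mul_le_of_sphere fun v hv => ?_
  have hpt : ∀ᵐ x, ‖d n x * v x‖ₑ ≤ ENNReal.ofReal (K * (a n x * |u x|)) +
      ENNReal.ofReal (K * C) * ENNReal.ofReal (D.gr (z n x)) +
      ENNReal.ofReal (2 * C / κ) * ENNReal.ofReal (D.gr (v x)) := by
    filter_upwards [hb n] with x hx
    have hgz := D.gr_nonneg (z n x)
    have hgv := D.gr_nonneg (v x)
    have e1 := slope1_mul_le D.δ_pos D.δ_small hp.le hK1 (ha0 n x) hC (u x) (v x) (min_le_right _ _)
    have e2 := slope1_mul_le D.δ_pos D.δ_small hp.le hK1 (mul_nonneg hC (D.sl_nonneg (z n x))) hC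
      (z n x) (v x) le_rfl
    rw [hKκ] at e1 e2
    have e3 : |d n x| ≤ a n x + C * D.sl (z n x) := by
      rcases le_total |d n x| (C * D.sl (u x)) with h | h
      · have : a n x = |d n x| := min_eq_left h
        have h5 := mul_nonneg hC (D.sl_nonneg (z n x))
        linarith
      · have : a n x = C * D.sl (u x) := min_eq_right h
        rw [this]; linarith
    have e4 : C * D.sl (z n x) * |z n x| = C * D.gr (z n x) := by rw [mul_assoc, sl_mul hN]
    rw [e4] at e2
    rw [← ENNReal.ofReal_mul (by positivity), ← ENNReal.ofReal_mul (by positivity),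
      ← ENNReal.ofReal_add (mul_nonneg hK0.le (mul_nonneg (ha0 n x) (abs_nonneg _)))
        (by positivity),
      ← ENNReal.ofReal_add (add_nonneg (mul_nonneg hK0.le (mul_nonneg (ha0 n x) (abs_nonneg _)))
        (by positivity)) (by positivity), ← ofReal_norm, Real.norm_eq_abs, abs_mul]
    refine ENNReal.ofReal_le_ofReal ?_
    have e5 : |d n x| * |v x| ≤ a n x * |v x| + C * D.sl (z n x) * |v x| := by
      rw [← add_mul]
      exact mul_le_mul_of_nonneg_right e3 (abs_nonneg _)
    have e6 : 2 * C / κ * D.gr (v x) = C / κ * D.gr (v x) + C / κ * D.gr (v x) := by ring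
    have e7 : D.gr (v x) = growth D.δ (sobExp N) (v x) := rfl
    rw [e6, e7]
    linarith
  have hv3 := hG v hv.le
  rw [hv] at hv3
  calc ∫⁻ x, ‖d n x * v x‖ₑ
      ≤ ∫⁻ x, (ENNReal.ofReal (K * (a n x * |u x|)) +
        ENNReal.ofReal (K * C) * ENNReal.ofReal (D.gr (z n x)) +
        ENNReal.ofReal (2 * C / κ) * ENNReal.ofReal (D.gr (v x))) := lintegral_mono_ae hpt
    _ = (∫⁻ x, ENNReal.ofReal (K * (a n x * |u x|))) +
        ENNReal.ofReal (K * C) * (∫⁻ x, ENNReal.ofReal (D.gr (z n x))) +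
        ENNReal.ofReal (2 * C / κ) * ∫⁻ x, ENNReal.ofReal (D.gr (v x)) := by
        have m1 : AEMeasurable (fun x => ENNReal.ofReal (K * (a n x * |u x|))) volume :=
          (((ham n).mul (aemeasurable_coe u).norm).const_mul K).ennreal_ofReal
        rw [lintegral_add_left', lintegral_add_left' m1,
          lintegral_const_mul' _ _ ENNReal.ofReal_ne_top,
          lintegral_const_mul' _ _ ENNReal.ofReal_ne_top]
        exact m1.add ((aemeasurable_gr (z n)).ennreal_ofReal.const_mul _)
    _ ≤ ENNReal.ofReal (η / 8) + ENNReal.ofReal (K * C) * ENNReal.ofReal (C₀ * ‖z n‖) +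
        ENNReal.ofReal (2 * C / κ) * ENNReal.ofReal (C₀ * (1 / 2)) := by
        gcongr
        exact hG (z n) hn3
    _ ≤ ENNReal.ofReal (η / 8) + ENNReal.ofReal (η / 8) + ENNReal.ofReal (η / 8) := by
        rw [← ENNReal.ofReal_mul (by positivity), ← ENNReal.ofReal_mul (by positivity)]
        gcongr
    _ ≤ ENNReal.ofReal (η / 2) := by
        rw [← ENNReal.ofReal_add (by positivity) (by positivity),
          ← ENNReal.ofReal_add (by positivity) (by positivity)]
        exact ENNReal.ofReal_le_ofReal (by linarith)

end PenalizedProblem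

/-! ### Differentiability of superposition operators -/

namespace PenalizedProblem

variable {N : ℕ} {D : PenalizedProblem N} {ε : ℝ}

/-- The nonlinearities `f` with derivative `f'` for which `u ↦ ∫ ρ f(u)` is of class `C¹` on
`X_ε`: the derivative is bounded by the slope of the growth function. -/
structure Admissible (D : PenalizedProblem N) (f f' : ℝ → ℝ) : Prop where
  hasDerivAt : ∀ s, HasDerivAt f (f' s) s
  continuous : Continuous f'
  zero : f 0 = 0
  bound : ∃ C : ℝ, 0 ≤ C ∧ ∀ s, |f' s| ≤ C * D.sl s

/-- Measurable weights bounded by `1`. -/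
structure IsWeight (ρ : EuclideanSpace ℝ (Fin N) → ℝ) : Prop where
  measurable : Measurable ρ
  abs_le_one : ∀ x, |ρ x| ≤ 1

lemma Admissible.continuous_self {f f' : ℝ → ℝ} (h : D.Admissible f f') : Continuous f :=
  continuous_iff_continuousAt.2 fun s => (h.hasDerivAt s).continuousAt

lemma Admissible.abs_le (hN : 1 ≤ N) {f f' : ℝ → ℝ} (h : D.Admissible f f') :
    ∃ C : ℝ, 0 ≤ C ∧ ∀ s, |f s| ≤ C * D.gr s := by
  obtain ⟨C, hC, hb⟩ := h.bound
  have h2 : (0 : ℝ) < 2 ^ sobExp N := by positivity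
  refine ⟨C * 2 ^ sobExp N, by positivity, fun s => ?_⟩
  have h1 := abs_add_sub_le D.δ_pos D.δ_small (two_lt_sobExp hN).le hC h.hasDerivAt hb 0 s
  have h3 : slope1 D.δ (sobExp N) 0 = 0 := by simp [slope1]
  rw [zero_add, h.zero, sub_zero, h3, zero_add, mul_assoc, mul_assoc] at h1
  have h4 := sl_mul hN D s
  unfold sl at h4
  rwa [h4, ← mul_assoc] at h1

lemma IsWeight.norm_mul_le {ρ : EuclideanSpace ℝ (Fin N) → ℝ} (hρ : IsWeight ρ)
    (x : EuclideanSpace ℝ (Fin N)) (a : ℝ) : |ρ x * a| ≤ |a| := by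
  rw [abs_mul]
  exact mul_le_of_le_one_left (abs_nonneg a) (hρ.abs_le_one x)

lemma Admissible.integrable (hN : 1 ≤ N) {f f' : ℝ → ℝ} (h : D.Admissible f f')
    {ρ : EuclideanSpace ℝ (Fin N) → ℝ} (hρ : IsWeight ρ) (u : D.X ε) :
    Integrable fun x => ρ x * f (u x) := by
  obtain ⟨C, hC, hb⟩ := h.abs_le hN
  refine ((integrable_gr hN u).const_mul C).mono' ?_ (ae_of_all _ fun x => ?_)
  · exact (hρ.measurable.aemeasurable.mul
      (h.continuous_self.measurable.comp_aemeasurable (aemeasurable_coe u))).aestronglyMeasurable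
  · exact (hρ.norm_mul_le x _).trans (hb _)

lemma Admissible.aemeasurable_deriv {f f' : ℝ → ℝ} (h : D.Admissible f f')
    {ρ : EuclideanSpace ℝ (Fin N) → ℝ} (hρ : IsWeight ρ) (u : D.X ε) :
    AEMeasurable (fun x => ρ x * f' (u x)) volume :=
  hρ.measurable.aemeasurable.mul
    (h.continuous.measurable.comp_aemeasurable (aemeasurable_coe u))

lemma Admissible.exists_lintegral_le (hN : 1 ≤ N) {f f' : ℝ → ℝ} (h : D.Admissible f f')
    {ρ : EuclideanSpace ℝ (Fin N) → ℝ} (hρ : IsWeight ρ) (ε M : ℝ) :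
    ∃ B : ℝ, 0 ≤ B ∧ ∀ u : D.X ε, ‖u‖ ≤ M →
      ∀ v : D.X ε, ∫⁻ x, ‖ρ x * f' (u x) * v x‖ₑ ≤ ENNReal.ofReal (B * ‖v‖) := by
  obtain ⟨C, hC, hb⟩ := h.bound
  obtain ⟨B, hB0, hB⟩ := exists_lintegral_mul_le hN D ε M hC
  exact ⟨B, hB0, fun u hu => hB u hu (fun x => ρ x * f' (u x))
    fun x => (hρ.norm_mul_le x _).trans (hb _)⟩

lemma Admissible.integrable_deriv (hN : 1 ≤ N) {f f' : ℝ → ℝ} (h : D.Admissible f f')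
    {ρ : EuclideanSpace ℝ (Fin N) → ℝ} (hρ : IsWeight ρ) (u v : D.X ε) :
    Integrable fun x => ρ x * f' (u x) * v x := by
  obtain ⟨B, -, hB⟩ := h.exists_lintegral_le hN hρ ε ‖u‖
  exact ⟨((h.aemeasurable_deriv hρ u).mul (aemeasurable_coe v)).aestronglyMeasurable,
    (hB u le_rfl v).trans_lt ENNReal.ofReal_lt_top⟩

lemma abs_integral_le_of_lintegral {g : EuclideanSpace ℝ (Fin N) → ℝ} {B : ℝ} (hB : 0 ≤ B)
    (h : ∫⁻ x, ‖g x‖ₑ ≤ ENNReal.ofReal B) : |∫ x, g x| ≤ B := by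
  have h1 := (enorm_integral_le_lintegral_enorm g).trans h
  rwa [← ofReal_norm, ENNReal.ofReal_le_ofReal_iff hB] at h1

/-- The functional `v ↦ ∫ ρ f'(u) v`. -/
lemma Admissible.exists_clm (hN : 1 ≤ N) {f f' : ℝ → ℝ} (h : D.Admissible f f')
    {ρ : EuclideanSpace ℝ (Fin N) → ℝ} (hρ : IsWeight ρ) (u : D.X ε) :
    ∃ L : D.X ε →L[ℝ] ℝ, ∀ v, L v = ∫ x, ρ x * f' (u x) * v x := by
  obtain ⟨B, hB0, hB⟩ := h.exists_lintegral_le hN hρ ε ‖u‖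
  refine ⟨LinearMap.mkContinuous
    { toFun := fun v => ∫ x, ρ x * f' (u x) * v x
      map_add' := fun v w => ?_
      map_smul' := fun c v => ?_ } B fun v => ?_, fun v => rfl⟩
  · rw [← integral_add (h.integrable_deriv hN hρ u v) (h.integrable_deriv hN hρ u w)]
    refine integral_congr_ae ?_
    filter_upwards [coe_add v w] with x hx
    rw [hx]; ring
  · simp only [RingHom.id_apply, smul_eq_mul]
    rw [← integral_const_mul]
    refine integral_congr_ae ?_
    filter_upwards [coe_smul c v] with x hx
    rw [hx]; ring
  · exact abs_integral_le_of_lintegral (by positivity) (hB u le_rfl v)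

/-- The functional `u ↦ ∫ ρ f(u)` is of class `C¹` on `X_ε`. -/
lemma Admissible.exists_hasFDerivAt (hN : 1 ≤ N) {f f' : ℝ → ℝ} (h : D.Admissible f f')
    {ρ : EuclideanSpace ℝ (Fin N) → ℝ} (hρ : IsWeight ρ) :
    ∃ L : D.X ε → D.X ε →L[ℝ] ℝ, Continuous L ∧
      (∀ u, HasFDerivAt (fun u : D.X ε => ∫ x, ρ x * f (u x)) (L u) u) ∧
      ∀ u v, L u v = ∫ x, ρ x * f' (u x) * v x := by
  choose L hL using fun u : D.X ε => h.exists_clm hN hρ u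
  obtain ⟨C, hC, hb⟩ := h.bound
  have hp := two_lt_sobExp hN
  set A : ℝ := 2 ^ sobExp N with hA
  have hA0 : 0 < A := by positivity
  refine ⟨L, ?_, ?_, hL⟩
  · rw [continuous_iff_continuousAt]
    intro u
    rw [ContinuousAt, Metric.tendsto_nhds]
    intro η hη
    -- along a subsequence, convergence in `X_ε` gives convergence almost everywhere
    refine eventually_of_subseq fun z hz => ?_
    obtain ⟨k, hk, hkae⟩ := exists_subseq_ae hz
    have hz0 : Tendsto (fun n => z (k n) - u) atTop (𝓝 0) := by
      have := (hz.comp hk.tendsto_atTop).sub_const u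
      rwa [sub_self] at this
    refine ⟨k, hk, ?_⟩
    have key := eventually_lintegral_mul_le hN u hz0
      (d := fun n x => ρ x * f' (z (k n) x) - ρ x * f' (u x))
      (fun n => (h.aemeasurable_deriv hρ _).sub (h.aemeasurable_deriv hρ u))
      (C := C * A + C) (by positivity) (fun n => ?_) ?_ (half_pos hη)
    · filter_upwards [key] with n hn
      rw [dist_eq_norm]
      refine (ContinuousLinearMap.opNorm_le_bound _ (half_pos hη).le fun v => ?_).trans_lt
        (half_lt_self hη)
      rw [sub_apply, hL, hL, ← integral_sub (h.integrable_deriv hN hρ _ v)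
        (h.integrable_deriv hN hρ u v)]
      refine abs_integral_le_of_lintegral (by positivity) ?_
      simpa only [sub_mul] using hn v
    · filter_upwards [coe_sub (z (k n)) u] with x hx
      have h1 : |z (k n) x| ≤ |u x| + |(z (k n) - u : D.X ε) x| := by
        rw [hx]
        have := abs_add_le (u x) (z (k n) x - u x)
        rwa [add_sub_cancel] at this
      have h2 := slope1_add_le D.δ_pos D.δ_small hp.le h1
      have h3 := hb (z (k n) x)
      have h4 := hb (u x)
      have h5 := D.sl_nonneg ((z (k n) - u : D.X ε) x)
      have h6 : |f' (z (k n) x)| ≤ C * (A * (D.sl (u x) + D.sl ((z (k n) - u : D.X ε) x))) :=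
        h3.trans (mul_le_mul_of_nonneg_left h2 hC)
      calc |ρ x * f' (z (k n) x) - ρ x * f' (u x)|
          ≤ |ρ x * f' (z (k n) x)| + |ρ x * f' (u x)| := abs_sub _ _
        _ ≤ |f' (z (k n) x)| + |f' (u x)| :=
            add_le_add (hρ.norm_mul_le x _) (hρ.norm_mul_le x _)
        _ ≤ _ := by nlinarith [mul_nonneg hC h5]
    · filter_upwards [hkae] with x hx
      have h1 := (((h.continuous.tendsto _).comp hx).const_mul (ρ x)).sub_const (ρ x * f' (u x))
      rw [sub_self] at h1
      exact h1
  · intro u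
    rw [hasFDerivAt_iff_isLittleO_nhds_zero, Asymptotics.isLittleO_iff]
    intro η hη
    refine eventually_of_subseq fun z hz => ?_
    obtain ⟨k, hk, hkae⟩ := exists_subseq_ae hz
    have hz0 : Tendsto (fun n => z (k n)) atTop (𝓝 0) := hz.comp hk.tendsto_atTop
    refine ⟨k, hk, ?_⟩
    -- the difference quotients of `f` minus the derivative, with value `0` where `z n = 0`
    set d : ℕ → EuclideanSpace ℝ (Fin N) → ℝ := fun n x =>
      ρ x * ((f (u x + z (k n) x) - f (u x) - z (k n) x • f' (u x)) / z (k n) x) with hd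
    have hdm : ∀ n, AEMeasurable (d n) volume := by
      intro n
      have m1 := aemeasurable_coe u
      have m2 := aemeasurable_coe (z (k n))
      have mf := h.continuous_self.measurable
      have mf' := h.continuous.measurable
      exact hρ.measurable.aemeasurable.mul ((((mf.comp_aemeasurable (m1.add m2)).sub
        (mf.comp_aemeasurable m1)).sub (m2.mul (mf'.comp_aemeasurable m1))).div m2)
    have key := eventually_lintegral_mul_le hN u hz0 hdm
      (C := C * A + C) (by positivity) (fun n => ae_of_all _ fun x => ?_) ?_ hη
    · filter_upwards [key] with n hn
      have e : (∫ x, ρ x * f ((u + z (k n) : D.X ε) x)) - (∫ x, ρ x * f (u x)) - L u (z (k n)) =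
          ∫ x, d n x * z (k n) x := by
        have i1 : Integrable fun x =>
            ρ x * f ((u + z (k n) : D.X ε) x) - ρ x * f (u x) :=
          (h.integrable hN hρ _).sub (h.integrable hN hρ u)
        rw [hL, ← integral_sub (h.integrable hN hρ _) (h.integrable hN hρ u),
          ← integral_sub i1 (h.integrable_deriv hN hρ u _)]
        refine integral_congr_ae ?_
        filter_upwards [coe_add u (z (k n))] with x hx
        simp only [hd, hx, smul_eq_mul]
        rcases eq_or_ne (z (k n) x) 0 with h0 | h0
        · simp [h0]
        · field_simp
      rw [e]
      exact abs_integral_le_of_lintegral (by positivity) (hn _)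
    · refine (hρ.norm_mul_le x _).trans ?_
      have h5 := D.sl_nonneg (z (k n) x)
      have h6 := D.sl_nonneg (u x)
      rcases eq_or_ne (z (k n) x) 0 with h0 | h0
      · rw [h0, div_zero, abs_zero]
        rw [h0] at h5
        positivity
      · have h7 : 0 < |z (k n) x| := abs_pos.2 h0
        rw [abs_div, div_le_iff₀ h7]
        have h1 := abs_add_sub_le D.δ_pos D.δ_small hp.le hC h.hasDerivAt hb (u x) (z (k n) x)
        have h2 := mul_le_mul_of_nonneg_right (hb (u x)) h7.le
        have h3 : 0 ≤ C * D.sl (z (k n) x) * |z (k n) x| := by positivity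
        calc |f (u x + z (k n) x) - f (u x) - z (k n) x • f' (u x)|
            ≤ |f (u x + z (k n) x) - f (u x)| + |z (k n) x • f' (u x)| := abs_sub _ _
          _ ≤ C * (A * (D.sl (u x) + D.sl (z (k n) x))) * |z (k n) x| +
              C * D.sl (u x) * |z (k n) x| := by
              refine add_le_add h1 ?_
              rw [smul_eq_mul, abs_mul, mul_comm]
              exact h2
          _ ≤ _ := by linarith
    · filter_upwards [hkae, Lp.coeFn_zero ℝ 2 (volume : Measure (EuclideanSpace ℝ (Fin N)))]
        with x hx hx0
      have hx0' : (0 : D.X ε) x = 0 := hx0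
      rw [hx0'] at hx
      have h1 := ((hasDerivAt_iff_isLittleO_nhds_zero.1
        (h.hasDerivAt (u x))).tendsto_div_nhds_zero.comp hx).const_mul (ρ x)
      rw [mul_zero] at h1
      exact h1

lemma Admissible.contDiff (hN : 1 ≤ N) {f f' : ℝ → ℝ} (h : D.Admissible f f')
    {ρ : EuclideanSpace ℝ (Fin N) → ℝ} (hρ : IsWeight ρ) :
    ContDiff ℝ 1 fun u : D.X ε => ∫ x, ρ x * f (u x) := by
  obtain ⟨L, hL, hd, -⟩ := h.exists_hasFDerivAt hN hρ (ε := ε)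
  exact contDiff_one_iff_hasFDerivAt.2 ⟨L, hL, hd⟩

lemma Admissible.fderiv_apply (hN : 1 ≤ N) {f f' : ℝ → ℝ} (h : D.Admissible f f')
    {ρ : EuclideanSpace ℝ (Fin N) → ℝ} (hρ : IsWeight ρ) (u v : D.X ε) :
    fderiv ℝ (fun u : D.X ε => ∫ x, ρ x * f (u x)) u v = ∫ x, ρ x * f' (u x) * v x := by
  obtain ⟨L, -, hd, he⟩ := h.exists_hasFDerivAt hN hρ (ε := ε)
  rw [(hd u).fderiv, he]

end PenalizedProblem

/-! ### The functionals `J_ε` and `Ψ_ε` -/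

namespace PenalizedProblem

variable {N : ℕ} {D : PenalizedProblem N} {ε : ℝ}

lemma abs_le_sl_of_mul (hN : 1 ≤ N) (D : PenalizedProblem N) {C a s : ℝ} (h0 : s = 0 → a = 0)
    (hC : 0 ≤ C) (h : |a * s| ≤ C * D.gr s) : |a| ≤ C * D.sl s := by
  rcases eq_or_ne s 0 with hs | hs
  · rw [h0 hs, abs_zero]
    exact mul_nonneg hC (D.sl_nonneg _)
  · rw [← sl_mul hN, ← mul_assoc, abs_mul] at h
    exact le_of_mul_le_mul_right h (abs_pos.2 hs)

lemma sq_le_gr (D : PenalizedProblem N) (s : ℝ) : s ^ 2 ≤ D.gr s := by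
  have h1 := F1_nonneg' D.δ_pos D.δ_small s
  have h2 : 0 ≤ |s| ^ sobExp N := by positivity
  unfold gr growth
  linarith

lemma F1_le_gr (D : PenalizedProblem N) (s : ℝ) : F1 D.δ s ≤ D.gr s := by
  have h2 : 0 ≤ |s| ^ sobExp N := by positivity
  unfold gr growth
  linarith [sq_nonneg s]

lemma rpow_le_gr (D : PenalizedProblem N) (s : ℝ) : |s| ^ sobExp N ≤ D.gr s := by
  have h1 := F1_nonneg' D.δ_pos D.δ_small s
  unfold gr growth
  linarith [sq_nonneg s]

lemma dF1_mul_nonneg (D : PenalizedProblem N) (s : ℝ) : 0 ≤ dF1 D.δ s * s :=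
  (F1_nonneg' D.δ_pos D.δ_small s).trans (F1_le_dF1 D.δ_pos D.δ_small s)

lemma dF1_mul_le_two (D : PenalizedProblem N) (s : ℝ) : dF1 D.δ s * s ≤ 2 * F1 D.δ s := by
  rcases lt_trichotomy s 0 with h | rfl | h
  · have := dF1_mul_le D.δ_pos (neg_pos.2 h)
    rw [dF1_neg, ← F1_abs, abs_neg, F1_abs] at this
    linarith
  · simp [F1_zero D.δ_pos]
  · exact dF1_mul_le D.δ_pos h

lemma admissible_F1 (hN : 1 ≤ N) (D : PenalizedProblem N) :
    D.Admissible (F1 D.δ) (dF1 D.δ) where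
  hasDerivAt := hasDerivAt_dF1 D.δ_pos
  continuous := continuous_dF1 D.δ_pos
  zero := F1_zero D.δ_pos
  bound := by
    refine ⟨2, zero_le_two, fun s => abs_le_sl_of_mul hN D
      (by rintro rfl; exact dF1_zero) zero_le_two ?_⟩
    rw [abs_of_nonneg (D.dF1_mul_nonneg s)]
    linarith [D.dF1_mul_le_two s, D.F1_le_gr s]

lemma dF2_mul_le_rpow (hN : 1 ≤ N) (D : PenalizedProblem N) :
    ∃ C : ℝ, 0 < C ∧ ∀ T, D.δ ≤ T → ∀ s, dF2 D.δ s * s ≤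
      2 * Real.log (T / D.δ) * s ^ 2 + C * T ^ (-(2 / (N : ℝ))) * |s| ^ sobExp N := by
  have hN0 : (0 : ℝ) < N := by exact_mod_cast hN
  exact ⟨2 / (2 / (N : ℝ)), by positivity, fun T hT s => dF2_mul_le D.δ_pos (by positivity) hT s⟩

lemma admissible_F2 (hN : 1 ≤ N) (D : PenalizedProblem N) :
    D.Admissible (F2 D.δ) (dF2 D.δ) where
  hasDerivAt := hasDerivAt_F2 D.δ_pos
  continuous := continuous_dF2 D.δ_pos
  zero := F2_zero D.δ_pos
  bound := by
    obtain ⟨C, hC, h⟩ := dF2_mul_le_rpow hN D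
    have hδ := D.δ_pos
    refine ⟨C * D.δ ^ (-(2 / (N : ℝ))), by positivity, fun s => abs_le_sl_of_mul hN D
      (by rintro rfl; exact dF2_of_lt (by simpa using hδ.le)) (by positivity) ?_⟩
    have h1 := h D.δ le_rfl s
    rw [div_self hδ.ne', Real.log_one, mul_zero, zero_mul, zero_add] at h1
    rw [abs_of_nonneg (dF2_mul_nonneg hδ s)]
    exact h1.trans (mul_le_mul_of_nonneg_left (D.rpow_le_gr s) (by positivity))

lemma admissible_Gt (hN : 1 ≤ N) (D : PenalizedProblem N) : D.Admissible D.Gt D.gt where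
  hasDerivAt := D.hasDerivAt_Gt
  continuous := D.continuous_gt
  zero := D.Gt_zero
  bound := by
    have hb := D.b₀_pos
    refine ⟨D.b₀, hb.le, fun s => abs_le_sl_of_mul hN D (by rintro rfl; exact D.gt_zero) hb.le ?_⟩
    rw [abs_of_nonneg (D.gt_mul_nonneg s)]
    exact (D.gt_mul_le s).trans (mul_le_mul_of_nonneg_left (D.sq_le_gr s) hb.le)

/-- The integrand by which `Ψ_ε(u)` and `J_ε(u) - ∫ u² / 2` differ outside `Λ_ε`. -/
def kk (D : PenalizedProblem N) (s : ℝ) : ℝ :=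
  F2 D.δ s - 1 / 2 * dF2 D.δ s * s + 1 / 2 * D.gt s * s - D.Gt s

/-- The derivative of `kk`. -/
def dkk (D : PenalizedProblem N) (s : ℝ) : ℝ :=
  1 / 2 * (dF2 D.δ s - ddF2 D.δ s * s) + 1 / 2 * (D.dF2tilde' |s| * s - D.gt s)

lemma hasDerivAt_kk (D : PenalizedProblem N) (s : ℝ) : HasDerivAt D.kk (D.dkk s) s := by
  have h := (((hasDerivAt_F2 D.δ_pos s).sub (((hasDerivAt_dF2 D.δ_pos s).const_mul (1 / 2)).mul
    (hasDerivAt_id s))).add (((D.hasDerivAt_gt s).const_mul (1 / 2)).mul (hasDerivAt_id s))).sub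
    (D.hasDerivAt_Gt s)
  refine h.congr_deriv ?_
  simp only [dkk, id]
  ring

lemma max_sub_nonneg (D : PenalizedProblem N) (s : ℝ) : 0 ≤ max |s| D.δ - D.δ :=
  sub_nonneg.2 (le_max_right _ _)

lemma max_sub_le (D : PenalizedProblem N) (s : ℝ) : max |s| D.δ - D.δ ≤ |s| := by
  have := D.δ_pos
  rcases max_cases |s| D.δ with h | h <;> rw [h.1]
  · linarith
  · simp

lemma admissible_kk (hN : 1 ≤ N) (D : PenalizedProblem N) : D.Admissible D.kk D.dkk where
  hasDerivAt := D.hasDerivAt_kk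
  continuous := by
    have h1 : Continuous fun s : ℝ => D.dF2tilde' |s| := D.continuous_dF2tilde'.comp continuous_abs
    exact (continuous_const.mul ((continuous_dF2 D.δ_pos).sub
      ((continuous_ddF2 D.δ_pos).mul continuous_id))).add
      (continuous_const.mul ((h1.mul continuous_id).sub D.continuous_gt))
  zero := by simp [kk, F2_zero D.δ_pos, D.Gt_zero]
  bound := by
    obtain ⟨C, hC, h⟩ := D.exists_bound_dF2tilde'
    have hb := D.b₀_pos
    refine ⟨1 + (C + D.b₀) / 2, by positivity, fun s => abs_le_sl_of_mul hN D ?_ (by positivity) ?_⟩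
    · rintro rfl
      have : dF2 D.δ 0 = 0 := dF2_of_lt (by simpa using D.δ_pos.le)
      simp [dkk, this, D.gt_zero]
    · have e : D.dkk s * s = 1 / 2 * ((dF2 D.δ s - ddF2 D.δ s * s) * s) +
          1 / 2 * (D.dF2tilde' |s| * s ^ 2 - D.gt s * s) := by unfold dkk; ring
      have h1 : |(dF2 D.δ s - ddF2 D.δ s * s) * s| ≤ 2 * s ^ 2 := by
        rw [dF2_sub_ddF2 D.δ_pos, abs_mul, abs_neg, abs_abs,
          abs_of_nonneg (mul_nonneg zero_le_two (D.max_sub_nonneg s)), ← sq_abs s]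
        nlinarith [D.max_sub_le s, abs_nonneg s]
      have h2 : |D.dF2tilde' |s| * s ^ 2| ≤ C * s ^ 2 := by
        rw [abs_mul, abs_of_nonneg (sq_nonneg s)]
        exact mul_le_mul_of_nonneg_right (h s) (sq_nonneg s)
      have h3 := D.gt_mul_le s
      have h4 := D.gt_mul_nonneg s
      have h5 : |D.dkk s * s| ≤ (1 + (C + D.b₀) / 2) * s ^ 2 := by
        rw [e, abs_le]
        rw [abs_le] at h1 h2
        constructor <;> nlinarith [sq_nonneg s]
      exact h5.trans (mul_le_mul_of_nonneg_left (D.sq_le_gr s) (by positivity))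

/-- The characteristic function of `Λ_ε = ε⁻¹ Λ`. -/
def chi (D : PenalizedProblem N) (ε : ℝ) (x : EuclideanSpace ℝ (Fin N)) : ℝ :=
  D.Λ.indicator 1 (ε • x)

lemma chi_cases (D : PenalizedProblem N) (ε : ℝ) (x : EuclideanSpace ℝ (Fin N)) :
    D.chi ε x = 0 ∨ D.chi ε x = 1 := by
  unfold chi
  by_cases h : ε • x ∈ D.Λ
  · right; simp [h]
  · left; simp [h]

lemma chi_nonneg (D : PenalizedProblem N) (ε : ℝ) (x : EuclideanSpace ℝ (Fin N)) :
    0 ≤ D.chi ε x := by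
  rcases D.chi_cases ε x with h | h <;> simp [h]

lemma chi_le_one (D : PenalizedProblem N) (ε : ℝ) (x : EuclideanSpace ℝ (Fin N)) :
    D.chi ε x ≤ 1 := by
  rcases D.chi_cases ε x with h | h <;> simp [h]

lemma isWeight_one : IsWeight fun _ : EuclideanSpace ℝ (Fin N) => (1 : ℝ) :=
  ⟨measurable_const, by simp⟩

lemma isWeight_chi (D : PenalizedProblem N) (ε : ℝ) : IsWeight (D.chi ε) where
  measurable := (measurable_one.indicator D.isOpen_Λ.measurableSet).comp (measurable_const_smul ε)
  abs_le_one x := by rw [abs_of_nonneg (D.chi_nonneg ε x)]; exact D.chi_le_one ε x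

lemma isWeight_one_sub_chi (D : PenalizedProblem N) (ε : ℝ) :
    IsWeight fun x => 1 - D.chi ε x where
  measurable := measurable_const.sub (D.isWeight_chi ε).measurable
  abs_le_one x := by
    rw [abs_le]; constructor <;> linarith [D.chi_nonneg ε x, D.chi_le_one ε x]

lemma J_eq (hN : 1 ≤ N) (u : D.X ε) : D.J ε u = 1 / 2 * ‖embedL D ε u‖ ^ 2 +
    (∫ x, 1 * F1 D.δ (u x)) - (∫ x, D.chi ε x * F2 D.δ (u x)) -
      ∫ x, (1 - D.chi ε x) * D.Gt (u x) := by
  have h : ∫ x, D.G2 (ε • x) (u x) =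
      (∫ x, D.chi ε x * F2 D.δ (u x)) + ∫ x, (1 - D.chi ε x) * D.Gt (u x) := by
    rw [← integral_add ((admissible_F2 hN D).integrable hN (D.isWeight_chi ε) u)
      ((admissible_Gt hN D).integrable hN (D.isWeight_one_sub_chi ε) u)]
    exact integral_congr_ae (ae_of_all _ fun x => D.G2_eq _ _)
  rw [J, ← normH_sq, normH_eq', h]
  simp only [one_mul]
  ring

lemma Psi_eq (u : D.X ε) : D.Ψ ε u = D.J ε u - 1 / 2 * ‖toL2L D ε u‖ ^ 2 -
    ∫ x, (1 - D.chi ε x) * D.kk (u x) := by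
  have h : ∀ x, F2 D.δ (u x) - (1 / 2) * deriv (F2 D.δ) (u x) * u x +
      (1 / 2) * D.g2 (ε • x) (u x) * u x - D.G2 (ε • x) (u x) =
      (1 - D.chi ε x) * D.kk (u x) := by
    intro x
    rw [deriv_F2 D.δ_pos, g2_eq, G2_eq]
    change _ - _ + 1 / 2 * (D.chi ε x * _ + (1 - D.chi ε x) * _) * _ -
      (D.chi ε x * _ + (1 - D.chi ε x) * _) = _
    unfold kk
    ring
  rw [Ψ, toL2L_apply, norm_toL2_sq]
  simp only [h]

lemma contDiff_J (hN : 1 ≤ N) (D : PenalizedProblem N) (ε : ℝ) : ContDiff ℝ 1 (D.J ε) := by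
  rw [funext fun u => J_eq hN u]
  exact (((contDiff_const.mul ((embedL D ε).contDiff.norm_sq ℝ)).add
    ((admissible_F1 hN D).contDiff hN isWeight_one)).sub
    ((admissible_F2 hN D).contDiff hN (D.isWeight_chi ε))).sub
    ((admissible_Gt hN D).contDiff hN (D.isWeight_one_sub_chi ε))

lemma contDiff_Psi (hN : 1 ≤ N) (D : PenalizedProblem N) (ε : ℝ) : ContDiff ℝ 1 (D.Ψ ε) := by
  rw [funext fun u => Psi_eq u]
  exact ((contDiff_J hN D ε).sub (contDiff_const.mul ((toL2L D ε).contDiff.norm_sq ℝ))).sub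
    ((admissible_kk hN D).contDiff hN (D.isWeight_one_sub_chi ε))

lemma hasFDerivAt_half_sq {E F : Type*} [NormedAddCommGroup E] [NormedSpace ℝ E]
    [NormedAddCommGroup F] [InnerProductSpace ℝ F] (A : E →L[ℝ] F) (u : E) :
    HasFDerivAt (fun u => 1 / 2 * ‖A u‖ ^ 2) ((innerSL ℝ (A u)).comp A) u := by
  refine ((A.hasFDerivAt (x := u)).norm_sq.const_mul (1 / 2)).congr_fderiv ?_
  ext v
  simp

lemma fderiv_J_apply (hN : 1 ≤ N) (u v : D.X ε) : fderiv ℝ (D.J ε) u v =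
    ⟪embedL D ε u, embedL D ε v⟫_ℝ + (∫ x, 1 * dF1 D.δ (u x) * v x) -
      (∫ x, D.chi ε x * dF2 D.δ (u x) * v x) - ∫ x, (1 - D.chi ε x) * D.gt (u x) * v x := by
  have h1 := ((admissible_F1 hN D).contDiff hN isWeight_one (ε := ε)).differentiable one_ne_zero u
  have h2 := ((admissible_F2 hN D).contDiff hN (D.isWeight_chi ε) (ε := ε)).differentiable
    one_ne_zero u
  have h3 := ((admissible_Gt hN D).contDiff hN (D.isWeight_one_sub_chi ε) (ε := ε)).differentiable
    one_ne_zero u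
  have h := (((hasFDerivAt_half_sq (embedL D ε) u).add h1.hasFDerivAt).sub h2.hasFDerivAt).sub
    h3.hasFDerivAt
  rw [(h.congr_of_eventuallyEq (Eventually.of_forall fun w => J_eq hN w)).fderiv]
  rw [← (admissible_F1 hN D).fderiv_apply hN isWeight_one,
    ← (admissible_F2 hN D).fderiv_apply hN (D.isWeight_chi ε),
    ← (admissible_Gt hN D).fderiv_apply hN (D.isWeight_one_sub_chi ε)]
  rfl

lemma fderiv_Psi_apply (hN : 1 ≤ N) (u v : D.X ε) : fderiv ℝ (D.Ψ ε) u v =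
    fderiv ℝ (D.J ε) u v - ⟪toL2L D ε u, toL2L D ε v⟫_ℝ -
      ∫ x, (1 - D.chi ε x) * D.dkk (u x) * v x := by
  have h1 := (contDiff_J hN D ε).differentiable one_ne_zero u
  have h3 := ((admissible_kk hN D).contDiff hN (D.isWeight_one_sub_chi ε) (ε := ε)).differentiable
    one_ne_zero u
  have h := (h1.hasFDerivAt.sub (hasFDerivAt_half_sq (toL2L D ε) u)).sub h3.hasFDerivAt
  rw [(h.congr_of_eventuallyEq (Eventually.of_forall fun w => Psi_eq w)).fderiv]
  rw [← (admissible_kk hN D).fderiv_apply hN (D.isWeight_one_sub_chi ε)]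
  rfl

/-- The functional `Ψ_ε` vanishes on the Nehari set: it is half of `J_ε'(u) u`, because
`F₁'(s) s = 2 F₁(s) - s² - 2 F₂(s) + F₂'(s) s`. -/
lemma Psi_eq_half (hN : 1 ≤ N) (u : D.X ε) : D.Ψ ε u = 1 / 2 * fderiv ℝ (D.J ε) u u := by
  have i1 := (admissible_F1 hN D).integrable hN isWeight_one u
  have i2 := (admissible_F2 hN D).integrable hN (D.isWeight_chi ε) u
  have i3 := (admissible_Gt hN D).integrable hN (D.isWeight_one_sub_chi ε) u
  have i4 := (admissible_kk hN D).integrable hN (D.isWeight_one_sub_chi ε) u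
  have j1 := (admissible_F1 hN D).integrable_deriv hN isWeight_one u u
  have j2 := (admissible_F2 hN D).integrable_deriv hN (D.isWeight_chi ε) u u
  have j3 := (admissible_Gt hN D).integrable_deriv hN (D.isWeight_one_sub_chi ε) u u
  have key : (∫ x, 1 * F1 D.δ (u x)) - (∫ x, D.chi ε x * F2 D.δ (u x)) -
      (∫ x, (1 - D.chi ε x) * D.Gt (u x)) - (∫ x, 1 / 2 * (u x) ^ 2) -
      (∫ x, (1 - D.chi ε x) * D.kk (u x)) =
      (∫ x, 1 / 2 * (1 * dF1 D.δ (u x) * u x)) -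
      (∫ x, 1 / 2 * (D.chi ε x * dF2 D.δ (u x) * u x)) -
      ∫ x, 1 / 2 * ((1 - D.chi ε x) * D.gt (u x) * u x) := by
    have k1 := i1.sub i2
    have k2 := k1.sub i3
    have k3 := k2.sub ((integrable_sq u).const_mul (1 / 2))
    have k4 := (j1.const_mul (1 / 2)).sub (j2.const_mul (1 / 2))
    rw [← integral_sub i1 i2]
    erw [← integral_sub k1 i3, ← integral_sub k2 ((integrable_sq u).const_mul (1 / 2)),
      ← integral_sub k3 i4]
    rw [← integral_sub (j1.const_mul (1 / 2)) (j2.const_mul (1 / 2))]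
    erw [← integral_sub k4 (j3.const_mul (1 / 2))]
    refine integral_congr_ae (ae_of_all _ fun x => ?_)
    simp only [Pi.sub_apply, kk, dF1, F1_eq D.δ_pos]
    ring
  simp only [integral_const_mul] at key
  rw [fderiv_J_apply hN, Psi_eq, J_eq hN, toL2L_apply, norm_toL2_sq, real_inner_self_eq_norm_sq]
  simp only [integral_const_mul] at key ⊢
  linarith

lemma mem_nehari_iff (hN : 1 ≤ N) (u : D.X ε) : u ∈ D.nehari ε ↔ u ≠ 0 ∧ D.Ψ ε u = 0 := by
  rw [Psi_eq_half hN]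
  simp [nehari]

lemma integrable_chi_sq (u : D.X ε) : Integrable fun x => D.chi ε x * (u x) ^ 2 :=
  (integrable_sq u).bdd_mul (c := 1) (D.isWeight_chi ε).measurable.aestronglyMeasurable
    (ae_of_all _ fun x => (D.isWeight_chi ε).abs_le_one x)

lemma integral_chi_sq_nonneg (u : D.X ε) : 0 ≤ ∫ x, D.chi ε x * (u x) ^ 2 :=
  integral_nonneg fun x => mul_nonneg (D.chi_nonneg ε x) (sq_nonneg _)

lemma fderiv_Psi_self_le (hN : 1 ≤ N) {u : D.X ε} (hu : u ∈ D.nehari ε) :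
    fderiv ℝ (D.Ψ ε) u u ≤ -∫ x, D.chi ε x * (u x) ^ 2 := by
  have i := (admissible_kk hN D).integrable_deriv hN (D.isWeight_one_sub_chi ε) u u
  rw [fderiv_Psi_apply hN, hu.2, real_inner_self_eq_norm_sq, toL2L_apply, norm_toL2_sq]
  have h : ∫ x, D.chi ε x * (u x) ^ 2 ≤
      (∫ x, (u x) ^ 2) + ∫ x, (1 - D.chi ε x) * D.dkk (u x) * u x := by
    rw [← integral_add (integrable_sq u) i]
    refine integral_mono (integrable_chi_sq u) ((integrable_sq u).add i) fun x => ?_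
    simp only
    have e : D.dkk (u x) * u x = 1 / 2 * ((dF2 D.δ (u x) - ddF2 D.δ (u x) * u x) * u x) +
        1 / 2 * (D.dF2tilde' |u x| * u x * u x - D.gt (u x) * u x) := by unfold dkk; ring
    have h1 := D.gt_le_deriv (u x)
    have h2 := D.max_sub_le (u x)
    have h3 : -(u x) ^ 2 ≤ D.dkk (u x) * u x := by
      rw [e, dF2_sub_ddF2 D.δ_pos, ← sq_abs (u x)]
      nlinarith [abs_nonneg (u x)]
    rcases D.chi_cases ε x with h | h <;> rw [h]
    · linarith
    · linarith
  linarith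

lemma integral_chi_sq_le_J (hN : 1 ≤ N) {u : D.X ε} (hu : u ∈ D.nehari ε) :
    ∫ x, D.chi ε x * (u x) ^ 2 ≤ 2 * D.J ε u := by
  have i := (admissible_kk hN D).integrable hN (D.isWeight_one_sub_chi ε) u
  have h0 := ((mem_nehari_iff hN u).1 hu).2
  rw [Psi_eq, toL2L_apply, norm_toL2_sq] at h0
  have h : ∫ x, 1 / 2 * (D.chi ε x * (u x) ^ 2) ≤
      (∫ x, 1 / 2 * (u x) ^ 2) + ∫ x, (1 - D.chi ε x) * D.kk (u x) := by
    rw [← integral_add ((integrable_sq u).const_mul _) i]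
    refine integral_mono ((integrable_chi_sq u).const_mul _)
      (((integrable_sq u).const_mul _).add i) fun x => ?_
    simp only
    have h1 := D.Gt_le_half (u x)
    have h2 := D.max_sub_le (u x)
    have h4 := D.max_sub_nonneg (u x)
    have h3 : -(1 / 2 * (u x) ^ 2) ≤ D.kk (u x) := by
      unfold kk
      rw [F2_sub_half D.δ_pos, ← sq_abs (u x)]
      nlinarith [abs_nonneg (u x)]
    rcases D.chi_cases ε x with h | h <;> rw [h]
    · linarith
    · linarith
  simp only [integral_const_mul] at h
  linarith

end PenalizedProblem

/-! ### The geometry of the Nehari set -/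

namespace PenalizedProblem

variable {N : ℕ} {D : PenalizedProblem N} {ε : ℝ}

lemma integrable_rpow (hN : 1 ≤ N) (u : D.X ε) : Integrable fun x => |u x| ^ sobExp N := by
  refine (integrable_gr hN u).mono' ((aemeasurable_coe u).norm.pow_const _).aestronglyMeasurable
    (ae_of_all _ fun x => ?_)
  rw [Real.norm_of_nonneg (by positivity)]
  exact D.rpow_le_gr _

lemma integrable_F1 (hN : 1 ≤ N) (u : D.X ε) : Integrable fun x => F1 D.δ (u x) := by
  simpa using (admissible_F1 hN D).integrable hN isWeight_one u

lemma integrable_dF1_mul (hN : 1 ≤ N) (u v : D.X ε) :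
    Integrable fun x => dF1 D.δ (u x) * v x := by
  simpa using (admissible_F1 hN D).integrable_deriv hN isWeight_one u v

lemma exists_integral_rpow_le (hN : 1 ≤ N) (D : PenalizedProblem N) (ε : ℝ) :
    ∃ C : ℝ, 0 ≤ C ∧ ∀ u : D.X ε, ∫ x, |u x| ^ sobExp N ≤ C * D.normH ε u ^ sobExp N := by
  obtain ⟨C, hC, h⟩ := exists_sobolev_X hN D ε
  refine ⟨C, hC, fun u => ?_⟩
  have h1 := h u
  rwa [← ofReal_integral_eq_lintegral_ofReal (integrable_rpow hN u)
    (ae_of_all _ fun x => by positivity), ENNReal.ofReal_le_ofReal_iff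
    (mul_nonneg hC (Real.rpow_nonneg (normH_nonneg u) _))] at h1

/-- The consequence of `J_ε'(u) u = 0` on which all estimates on the Nehari set rest: the
logarithmic term is split at the height `T`, and below that height only the mass in `Λ_ε` counts. -/
lemma exists_energy_le (hN : 1 ≤ N) (D : PenalizedProblem N) (ε : ℝ) :
    ∃ C : ℝ, 0 < C ∧ ∀ u : D.X ε, fderiv ℝ (D.J ε) u u = 0 → ∀ T, D.δ ≤ T →
      1 / 2 * D.normH ε u ^ 2 + ∫ x, dF1 D.δ (u x) * u x ≤
        2 * Real.log (T / D.δ) * (∫ x, D.chi ε x * (u x) ^ 2) +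
          C * T ^ (-(2 / (N : ℝ))) * D.normH ε u ^ sobExp N := by
  obtain ⟨C₁, hC₁, h1⟩ := dF2_mul_le_rpow hN D
  obtain ⟨C₂, hC₂, h2⟩ := exists_integral_rpow_le hN D ε
  refine ⟨C₁ * (C₂ + 1), by positivity, fun u hu T hT => ?_⟩
  have hT0 : 0 < T := D.δ_pos.trans_le hT
  have hp := Real.rpow_nonneg (normH_nonneg u) (sobExp N)
  have j2 := (admissible_F2 hN D).integrable_deriv hN (D.isWeight_chi ε) u u
  have j3 := (admissible_Gt hN D).integrable_deriv hN (D.isWeight_one_sub_chi ε) u u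
  rw [fderiv_J_apply hN, real_inner_self_eq_norm_sq, ← normH_eq'] at hu
  simp only [one_mul] at hu
  have e1 : ∫ x, D.chi ε x * dF2 D.δ (u x) * u x ≤
      2 * Real.log (T / D.δ) * (∫ x, D.chi ε x * (u x) ^ 2) +
        C₁ * T ^ (-(2 / (N : ℝ))) * ∫ x, |u x| ^ sobExp N := by
    rw [← integral_const_mul, ← integral_const_mul, ← integral_add
      ((integrable_chi_sq u).const_mul _) ((integrable_rpow hN u).const_mul _)]
    refine integral_mono j2 (((integrable_chi_sq u).const_mul _).add
      ((integrable_rpow hN u).const_mul _)) fun x => ?_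
    simp only
    have h3 := h1 T hT (u x)
    have h4 : 0 ≤ C₁ * T ^ (-(2 / (N : ℝ))) * |u x| ^ sobExp N := by positivity
    rcases D.chi_cases ε x with h | h <;> rw [h] <;> linarith
  have e2 : ∫ x, (1 - D.chi ε x) * D.gt (u x) * u x ≤ 1 / 2 * D.normH ε u ^ 2 := by
    have e3 : ∫ x, (1 - D.chi ε x) * D.gt (u x) * u x ≤ ∫ x, D.b₀ * (u x) ^ 2 := by
      refine integral_mono j3 ((integrable_sq u).const_mul _) fun x => ?_
      simp only
      have h3 := D.gt_mul_le (u x)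
      have h4 := D.gt_mul_nonneg (u x)
      rcases D.chi_cases ε x with h | h <;> rw [h] <;> linarith
    rw [integral_const_mul] at e3
    have e4 := wt_mul_integral_sq_le u
    have e5 : 2 * D.b₀ ≤ D.wt := D.b₀_small.le
    have e6 : 0 ≤ ∫ x, (u x) ^ 2 := integral_nonneg fun x => sq_nonneg _
    nlinarith
  have e7 : C₁ * T ^ (-(2 / (N : ℝ))) * ∫ x, |u x| ^ sobExp N ≤
      C₁ * (C₂ + 1) * T ^ (-(2 / (N : ℝ))) * D.normH ε u ^ sobExp N := by
    have h3 := h2 u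
    have h4 : 0 ≤ C₁ * T ^ (-(2 / (N : ℝ))) := by positivity
    nlinarith [mul_le_mul_of_nonneg_left h3 h4, mul_nonneg h4 hp]
  linarith

lemma integral_dF1_mul_nonneg (u : D.X ε) : 0 ≤ ∫ x, dF1 D.δ (u x) * u x :=
  integral_nonneg fun _ => D.dF1_mul_nonneg _

/-- The Nehari set stays away from the origin. -/
lemma exists_pos_le_normH (hN : 1 ≤ N) (D : PenalizedProblem N) (ε : ℝ) :
    ∃ c : ℝ, 0 < c ∧ ∀ u ∈ D.nehari ε, c ≤ D.normH ε u := by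
  obtain ⟨C, hC, h⟩ := exists_energy_le hN D ε
  have hδ := D.δ_pos
  have hN0 : (0 : ℝ) < N := by exact_mod_cast hN
  set A : ℝ := C * D.δ ^ (-(2 / (N : ℝ))) with hA
  have hA0 : 0 < A := by positivity
  refine ⟨(1 / (2 * A)) ^ ((N : ℝ) / 2), by positivity, fun u hu => ?_⟩
  -- at the height `δ` the logarithm vanishes
  have h1 := h u hu.2 D.δ le_rfl
  rw [div_self hδ.ne', Real.log_one, mul_zero, zero_mul, zero_add, ← hA] at h1
  have h2 := integral_dF1_mul_nonneg u
  have h3 := normH_pos hu.1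
  have h4 : D.normH ε u ^ sobExp N = D.normH ε u ^ 2 * D.normH ε u ^ (2 / (N : ℝ)) := by
    rw [sobExp, Real.rpow_add h3, Real.rpow_two]
  rw [h4] at h1
  have h5 : 1 / (2 * A) ≤ D.normH ε u ^ (2 / (N : ℝ)) := by
    rw [div_le_iff₀ (by positivity)]
    have h6 : 0 < D.normH ε u ^ 2 := by positivity
    by_contra hlt
    nlinarith
  calc (1 / (2 * A)) ^ ((N : ℝ) / 2) ≤ (D.normH ε u ^ (2 / (N : ℝ))) ^ ((N : ℝ) / 2) := by gcongr
    _ = D.normH ε u := by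
      rw [← Real.rpow_mul h3.le]
      have : 2 / (N : ℝ) * (N / 2) = 1 := by field_simp
      rw [this, Real.rpow_one]

/-- The mass in `Λ_ε` of the elements of bounded subsets of the Nehari set is bounded below. -/
lemma exists_pos_le_integral_chi_sq (hN : 1 ≤ N) (D : PenalizedProblem N) (ε M : ℝ) :
    ∃ c : ℝ, 0 < c ∧ ∀ u ∈ D.nehari ε, ‖u‖ ≤ M → c ≤ ∫ x, D.chi ε x * (u x) ^ 2 := by
  obtain ⟨C, hC, h⟩ := exists_energy_le hN D ε
  obtain ⟨c, hc, hcu⟩ := exists_pos_le_normH hN D ε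
  have hδ := D.δ_pos
  have hN0 : (0 : ℝ) < N := by exact_mod_cast hN
  have hp := two_lt_sobExp hN
  -- a height above which the superlinear part is absorbed
  have h1 : Tendsto (fun T : ℝ => C * T ^ (-(2 / (N : ℝ))) * |M| ^ sobExp N) atTop (𝓝 0) := by
    have := ((tendsto_rpow_neg_atTop (show 0 < 2 / (N : ℝ) by positivity)).const_mul C).mul_const
      (|M| ^ sobExp N)
    simpa using this
  obtain ⟨T, hT1, hT2⟩ := ((h1.eventually (Iic_mem_nhds (show (0 : ℝ) < c ^ 2 / 4 by
    positivity))).and (eventually_ge_atTop D.δ)).exists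
  have hT0 : 0 < T := hδ.trans_le hT2
  have hlog : 0 ≤ Real.log (T / D.δ) := Real.log_nonneg ((one_le_div₀ hδ).2 hT2)
  refine ⟨c ^ 2 / 4 / (2 * Real.log (T / D.δ) + 1), by positivity, fun u hu huM => ?_⟩
  have h2 := h u hu.2 T hT2
  have h3 := integral_dF1_mul_nonneg u
  have h4 := hcu u hu
  have h5 : C * T ^ (-(2 / (N : ℝ))) * D.normH ε u ^ sobExp N ≤ c ^ 2 / 4 := by
    refine le_trans ?_ hT1
    have h6 := normH_nonneg u
    have h7 : D.normH ε u ≤ |M| := (normH_le_norm u).trans (huM.trans (le_abs_self M))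
    have h8 : 0 ≤ sobExp N := by linarith
    gcongr
  have h6 : c ^ 2 ≤ D.normH ε u ^ 2 := by gcongr
  rw [div_le_iff₀ (by positivity)]
  have h7 := integral_chi_sq_nonneg u
  nlinarith

lemma fderiv_Psi_self_neg (hN : 1 ≤ N) {u : D.X ε} (hu : u ∈ D.nehari ε) :
    fderiv ℝ (D.Ψ ε) u u < 0 := by
  obtain ⟨c, hc, h⟩ := exists_pos_le_integral_chi_sq hN D ε ‖u‖
  have h1 := h u hu le_rfl
  have h2 := fderiv_Psi_self_le hN hu
  linarith

lemma isC1Hypersurface_nehari (hN : 1 ≤ N) (D : PenalizedProblem N) (ε : ℝ) :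
    IsC1Hypersurface (D.nehari ε) := by
  refine isC1Hypersurface_of_regular (contDiff_Psi hN D ε) (U := {0}ᶜ) isOpen_compl_singleton
    (fun x hx => ?_) (fun _ hx => hx.1) fun u hu h => ?_
  · rw [mem_nehari_iff hN]
    exact and_iff_right hx
  · have := fderiv_Psi_self_neg hN hu
    rw [h] at this
    exact lt_irrefl _ this

lemma Admissible.exists_abs_le (hN : 1 ≤ N) {f f' : ℝ → ℝ} (h : D.Admissible f f')
    {ρ : EuclideanSpace ℝ (Fin N) → ℝ} (hρ : IsWeight ρ) (ε M : ℝ) :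
    ∃ B : ℝ, 0 ≤ B ∧ ∀ u : D.X ε, ‖u‖ ≤ M → ∀ v : D.X ε,
      |∫ x, ρ x * f' (u x) * v x| ≤ B * ‖v‖ := by
  obtain ⟨B, hB, hBu⟩ := h.exists_lintegral_le hN hρ ε M
  exact ⟨B, hB, fun u hu v => abs_integral_le_of_lintegral (by positivity) (hBu u hu v)⟩

lemma exists_norm_fderiv_Psi_le (hN : 1 ≤ N) (D : PenalizedProblem N) (ε M : ℝ) :
    ∃ B : ℝ, 0 ≤ B ∧ ∀ u : D.X ε, ‖u‖ ≤ M → ‖fderiv ℝ (D.Ψ ε) u‖ ≤ B := by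
  obtain ⟨B₁, hB₁, h1⟩ := (admissible_F1 hN D).exists_abs_le hN isWeight_one ε M
  obtain ⟨B₂, hB₂, h2⟩ := (admissible_F2 hN D).exists_abs_le hN (D.isWeight_chi ε) ε M
  obtain ⟨B₃, hB₃, h3⟩ := (admissible_Gt hN D).exists_abs_le hN (D.isWeight_one_sub_chi ε) ε M
  obtain ⟨B₄, hB₄, h4⟩ := (admissible_kk hN D).exists_abs_le hN (D.isWeight_one_sub_chi ε) ε M
  set B₀ : ℝ := ‖embedL D ε‖ * |M| * ‖embedL D ε‖ + ‖toL2L D ε‖ * |M| * ‖toL2L D ε‖ with hB₀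
  refine ⟨B₀ + B₁ + B₂ + B₃ + B₄, by positivity, fun u hu => ?_⟩
  refine ContinuousLinearMap.opNorm_le_bound _ (by positivity) fun v => ?_
  rw [fderiv_Psi_apply hN, fderiv_J_apply hN]
  have huM : ‖u‖ ≤ |M| := hu.trans (le_abs_self M)
  have key : ∀ {F : Type} [NormedAddCommGroup F] [InnerProductSpace ℝ F] (A : D.X ε →L[ℝ] F),
      |⟪A u, A v⟫_ℝ| ≤ ‖A‖ * |M| * ‖A‖ * ‖v‖ := by
    intro F _ _ A
    have e1 : ‖A u‖ ≤ ‖A‖ * |M| :=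
      (A.le_opNorm u).trans (mul_le_mul_of_nonneg_left huM (norm_nonneg _))
    calc |⟪A u, A v⟫_ℝ| ≤ ‖A u‖ * ‖A v‖ := abs_real_inner_le_norm _ _
      _ ≤ (‖A‖ * |M|) * (‖A‖ * ‖v‖) := by gcongr; exact A.le_opNorm v
      _ = _ := by ring
  have k1 := key (embedL D ε)
  have k2 := key (toL2L D ε)
  have g1 := h1 u hu v
  have g2 := h2 u hu v
  have g3 := h3 u hu v
  have g4 := h4 u hu v
  rw [hB₀, Real.norm_eq_abs]
  rw [abs_le] at k1 k2 g1 g2 g3 g4 ⊢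
  constructor <;> linarith

/-- The natural constraint property, in quantitative form: the derivative of `J_ε` is controlled by
its constrained norm on bounded subsets of the Nehari set. Testing with `u` bounds the multiplier,
since `J_ε'(u) u = 0` while `Ψ_ε'(u) u` is bounded away from `0`. -/
lemma exists_norm_fderiv_J_le (hN : 1 ≤ N) (D : PenalizedProblem N) (ε M : ℝ) :
    ∃ K : ℝ, 0 < K ∧ ∀ u ∈ D.nehari ε, ‖u‖ ≤ M →
      ‖fderiv ℝ (D.J ε) u‖ ≤ K * D.constrainedNorm ε u := by
  obtain ⟨c, hc, h⟩ := exists_pos_le_integral_chi_sq hN D ε M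
  obtain ⟨B, hB, hBu⟩ := exists_norm_fderiv_Psi_le hN D ε M
  refine ⟨1 + |M| / c * B, by positivity, fun u hu huM => ?_⟩
  have hK : 0 < 1 + |M| / c * B := by positivity
  rw [← div_le_iff₀' hK]
  refine le_ciInf fun r => ?_
  rw [div_le_iff₀' hK]
  set t := ‖fderiv ℝ (D.J ε) u - r • fderiv ℝ (D.Ψ ε) u‖ with ht
  have ht0 : 0 ≤ t := norm_nonneg _
  have h1 : c ≤ |fderiv ℝ (D.Ψ ε) u u| := by
    have := fderiv_Psi_self_le hN hu
    have := h u hu huM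
    rw [abs_of_neg (fderiv_Psi_self_neg hN hu)]
    linarith
  have h2 : |r| * |fderiv ℝ (D.Ψ ε) u u| ≤ t * |M| := by
    have h3 := (fderiv ℝ (D.J ε) u - r • fderiv ℝ (D.Ψ ε) u).le_opNorm u
    rw [sub_apply, hu.2, zero_sub, norm_neg, smul_apply, smul_eq_mul, Real.norm_eq_abs,
      abs_mul] at h3
    exact h3.trans (mul_le_mul_of_nonneg_left (huM.trans (le_abs_self M)) ht0)
  have h3 : |r| ≤ t * |M| / c := by
    rw [le_div_iff₀ hc]
    exact (mul_le_mul_of_nonneg_left h1 (abs_nonneg r)).trans h2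
  calc ‖fderiv ℝ (D.J ε) u‖
      = ‖(fderiv ℝ (D.J ε) u - r • fderiv ℝ (D.Ψ ε) u) + r • fderiv ℝ (D.Ψ ε) u‖ := by
        rw [sub_add_cancel]
    _ ≤ t + ‖r • fderiv ℝ (D.Ψ ε) u‖ := norm_add_le _ _
    _ ≤ t + t * |M| / c * B := by
        rw [norm_smul, Real.norm_eq_abs]
        have := hBu u huM
        gcongr
    _ = _ := by ring

lemma fderiv_J_eq_zero_of_isConstrainedCritical (hN : 1 ≤ N) {u : D.X ε}
    (hu : D.IsConstrainedCritical ε u) : fderiv ℝ (D.J ε) u = 0 := by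
  obtain ⟨K, -, h⟩ := exists_norm_fderiv_J_le hN D ε ‖u‖
  have h1 := h u hu.1 le_rfl
  rw [hu.2, mul_zero] at h1
  exact norm_le_zero_iff.1 h1

/-- Sublevels of `J_ε` on the Nehari set are bounded. -/
lemma exists_norm_le_of_J_le (hN : 1 ≤ N) (D : PenalizedProblem N) (ε K : ℝ) :
    ∃ M : ℝ, ∀ u ∈ D.nehari ε, D.J ε u ≤ K → ‖u‖ ≤ M := by
  obtain ⟨C, hC, h⟩ := exists_energy_le hN D ε
  have hδ := D.δ_pos
  have hN0 : (0 : ℝ) < N := by exact_mod_cast hN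
  set κ : ℝ := (4 * C) ^ ((N : ℝ) / 2) with hκ
  have hκ0 : 0 < κ := by positivity
  set A : ℝ := 4 * |K| * κ / D.δ with hA
  have hA0 : 0 ≤ A := by positivity
  refine ⟨4 * A + (1 + (A * (4 * A) + 1 / 4 * (4 * A) ^ 2)), fun u hu hJ => ?_⟩
  have hn := normH_nonneg u
  set n := D.normH ε u with hnn
  have h1 := integral_chi_sq_le_J hN hu
  have h2 := integral_dF1_mul_nonneg u
  -- the height at which the superlinear part is a quarter of the energy
  have h3 := h u hu.2 (D.δ + κ * n) (by linarith [mul_nonneg hκ0.le hn])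
  rw [← hnn] at h3
  have h4 : Real.log ((D.δ + κ * n) / D.δ) ≤ κ * n / D.δ := by
    have e : (D.δ + κ * n) / D.δ = κ * n / D.δ + 1 := by field_simp; ring
    rw [e]
    have h0 : 0 ≤ κ * n / D.δ := by positivity
    linarith [Real.log_le_sub_one_of_pos (show 0 < κ * n / D.δ + 1 by linarith)]
  have h4' : 0 ≤ Real.log ((D.δ + κ * n) / D.δ) :=
    Real.log_nonneg ((one_le_div₀ hδ).2 (by linarith [mul_nonneg hκ0.le hn]))
  have h5 : C * (D.δ + κ * n) ^ (-(2 / (N : ℝ))) * n ^ sobExp N ≤ 1 / 4 * n ^ 2 := by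
    have hn' : 0 < n := normH_pos hu.1
    have e1 : n ^ sobExp N = n ^ 2 * n ^ (2 / (N : ℝ)) := by
      rw [sobExp, Real.rpow_add hn', Real.rpow_two]
    have e2 : (D.δ + κ * n) ^ (-(2 / (N : ℝ))) ≤ (κ * n) ^ (-(2 / (N : ℝ))) :=
      Real.rpow_le_rpow_of_nonpos (by positivity) (by linarith)
        (neg_nonpos.2 (by positivity))
    have e3 : (κ * n) ^ (-(2 / (N : ℝ))) = (4 * C)⁻¹ * (n ^ (2 / (N : ℝ)))⁻¹ := by
      rw [Real.rpow_neg (by positivity), Real.mul_rpow hκ0.le hn'.le, hκ,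
        ← Real.rpow_mul (by positivity)]
      have : (N : ℝ) / 2 * (2 / N) = 1 := by field_simp
      rw [this, Real.rpow_one, mul_inv]
    have e4 : 0 < n ^ (2 / (N : ℝ)) := by positivity
    calc C * (D.δ + κ * n) ^ (-(2 / (N : ℝ))) * n ^ sobExp N
        ≤ C * (κ * n) ^ (-(2 / (N : ℝ))) * n ^ sobExp N := by gcongr
      _ = 1 / 4 * n ^ 2 := by rw [e3, e1]; field_simp
  have h6 : 2 * Real.log ((D.δ + κ * n) / D.δ) * (∫ x, D.chi ε x * (u x) ^ 2) ≤ A * n := by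
    have e1 : ∫ x, D.chi ε x * (u x) ^ 2 ≤ 2 * |K| := by linarith [le_abs_self K]
    calc 2 * Real.log ((D.δ + κ * n) / D.δ) * (∫ x, D.chi ε x * (u x) ^ 2)
        ≤ 2 * (κ * n / D.δ) * (2 * |K|) := by
          have := integral_chi_sq_nonneg u
          gcongr
      _ = A * n := by rw [hA]; ring
  have h7 : n ≤ 4 * A := by
    have hn' : 0 < n := normH_pos hu.1
    have : n * n ≤ 4 * A * n := by nlinarith
    exact le_of_mul_le_mul_right this hn'
  have h8 : ∫ x, dF1 D.δ (u x) * u x ≤ A * (4 * A) + 1 / 4 * (4 * A) ^ 2 := by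
    have e1 : A * n ≤ A * (4 * A) := by gcongr
    have e2 : n ^ 2 ≤ (4 * A) ^ 2 := by gcongr
    nlinarith [sq_nonneg n]
  have h9 : luxemburgNorm (F1 D.δ) u ≤ 1 + (A * (4 * A) + 1 / 4 * (4 * A) ^ 2) := by
    refine luxemburg_le_of_large (by
      have : 0 ≤ A * (4 * A) + 1 / 4 * (4 * A) ^ 2 := by positivity
      linarith) ?_
    rw [← ofReal_integral_eq_lintegral_ofReal (integrable_F1 hN u)
      (ae_of_all _ fun x => F1_nonneg' D.δ_pos D.δ_small _)]
    refine ENNReal.ofReal_le_ofReal ?_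
    have := integral_mono (integrable_F1 hN u) (integrable_dF1_mul hN u u)
      fun x => F1_le_dF1 D.δ_pos D.δ_small (u x)
    linarith
  rw [norm_def]
  exact add_le_add h7 h9

end PenalizedProblem

/-! ### Weak compactness and cutoff functions -/

/-- Bounded sequences in `L²` have weakly convergent subsequences. -/
lemma exists_subseq_tendsto_inner {N : ℕ} {M : ℝ}
    {w : ℕ → Lp ℝ 2 (volume : Measure (EuclideanSpace ℝ (Fin N)))} (h : ∀ n, ‖w n‖ ≤ M) :
    ∃ (k : ℕ → ℕ) (W : Lp ℝ 2 (volume : Measure (EuclideanSpace ℝ (Fin N)))), StrictMono k ∧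
      ∀ f, Tendsto (fun n => ⟪f, w (k n)⟫_ℝ) atTop (𝓝 ⟪f, W⟫_ℝ) := by
  have : Fact ((2 : ℝ≥0∞) ≠ ⊤) := ⟨by norm_num⟩
  have hsep : TopologicalSpace.SeparableSpace
      (Lp ℝ 2 (volume : Measure (EuclideanSpace ℝ (Fin N)))) :=
    TopologicalSpace.SecondCountableTopology.to_separableSpace
  set T := InnerProductSpace.toDual ℝ (Lp ℝ 2 (volume : Measure (EuclideanSpace ℝ (Fin N)))) with hT
  obtain ⟨L, -, k, hk, hL⟩ := WeakDual.isSeqCompact_closedBall ℝ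
    (Lp ℝ 2 (volume : Measure (EuclideanSpace ℝ (Fin N)))) 0 M
    (x := fun n => StrongDual.toWeakDual (T (w n))) (fun n => by
      change T (w n) ∈ Metric.closedBall 0 M
      rw [mem_closedBall_zero_iff, LinearIsometryEquiv.norm_map]
      exact h n)
  refine ⟨k, T.symm (WeakDual.toStrongDual L), hk, fun f => ?_⟩
  have h1 := ((WeakDual.eval_continuous f).tendsto L).comp hL
  rw [real_inner_comm, hT, InnerProductSpace.toDual_symm_apply]
  refine h1.congr fun n => ?_
  rw [real_inner_comm]
  rfl

/-- Smooth cutoff functions at infinity. -/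
lemma exists_cutoff (N : ℕ) : ∃ A : ℝ, 0 ≤ A ∧ ∀ R : ℝ, 0 < R →
    ∃ ζ : EuclideanSpace ℝ (Fin N) → ℝ, ContDiff ℝ ∞ ζ ∧ (∀ x, 0 ≤ ζ x ∧ ζ x ≤ 1) ∧
      (∀ x, ‖x‖ ≤ R → ζ x = 0) ∧ (∀ x, 2 * R ≤ ‖x‖ → ζ x = 1) ∧ ∀ x, ‖fderiv ℝ ζ x‖ ≤ A / R := by
  set f : ContDiffBump (0 : EuclideanSpace ℝ (Fin N)) := ⟨1, 2, one_pos, one_lt_two⟩ with hf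
  have hfd : ContDiff ℝ ∞ f := f.contDiff
  obtain ⟨A, hA⟩ := (hfd.continuous_fderiv (by simp)).bounded_above_of_compact_support
    (f.hasCompactSupport.fderiv ℝ)
  refine ⟨A, (norm_nonneg _).trans (hA 0), fun R hR =>
    ⟨fun x => 1 - f (R⁻¹ • x), ?_, ?_, ?_, ?_, ?_⟩⟩
  · exact contDiff_const.sub (hfd.comp (contDiff_const_smul R⁻¹))
  · exact fun x => ⟨sub_nonneg.2 f.le_one, by linarith [f.nonneg (x := R⁻¹ • x)]⟩
  · intro x hx
    change 1 - f (R⁻¹ • x) = 0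
    rw [f.one_of_mem_closedBall, sub_self]
    rw [mem_closedBall_zero_iff, norm_smul, norm_inv, Real.norm_of_nonneg hR.le,
      inv_mul_le_iff₀ hR]
    simpa [hf] using hx
  · intro x hx
    change 1 - f (R⁻¹ • x) = 1
    rw [f.zero_of_le_dist, sub_zero]
    rw [dist_zero_right, norm_smul, norm_inv, Real.norm_of_nonneg hR.le, le_inv_mul_iff₀ hR]
    change R * 2 ≤ _
    linarith
  · intro x
    have h1 : HasFDerivAt (fun x => 1 - f (R⁻¹ • x))
        (-((fderiv ℝ f (R⁻¹ • x)).comp (R⁻¹ • ContinuousLinearMap.id ℝ _))) x := by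
      exact (((hfd.differentiable (by simp)) _).hasFDerivAt.comp x
        ((hasFDerivAt_id x).const_smul R⁻¹)).const_sub 1
    rw [h1.fderiv, norm_neg, ContinuousLinearMap.comp_smul, ContinuousLinearMap.comp_id, norm_smul,
      norm_inv, Real.norm_of_nonneg hR.le, div_eq_inv_mul]
    exact mul_le_mul_of_nonneg_left (hA _) (by positivity)

/-- The product rule for weak gradients. -/
lemma HasWeakGradient.smooth_mul {N : ℕ} {u : EuclideanSpace ℝ (Fin N) → ℝ}
    {g : EuclideanSpace ℝ (Fin N) → EuclideanSpace ℝ (Fin N)} (h : HasWeakGradient u g)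
    (hu : LocallyIntegrable u) (hg : LocallyIntegrable g) {ζ : EuclideanSpace ℝ (Fin N) → ℝ}
    (hζ : ContDiff ℝ ∞ ζ) :
    HasWeakGradient (fun x => ζ x * u x) (fun x => ζ x • g x + u x • gradient ζ x) := by
  intro φ hφ hφc v
  have hd : ∀ x, fderiv ℝ (fun x => ζ x * φ x) x v =
      ζ x * fderiv ℝ φ x v + φ x * fderiv ℝ ζ x v := by
    intro x
    rw [fderiv_fun_mul (hζ.differentiable (by simp) x) (hφ.differentiable (by simp) x)]
    simp
  have h1 := h (fun x => ζ x * φ x) (hζ.mul hφ) hφc.mul_left v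
  have c1 : Continuous fun x => fderiv ℝ φ x v :=
    (hφ.continuous_fderiv (by simp)).clm_apply continuous_const
  have c2 : Continuous fun x => fderiv ℝ ζ x v :=
    (hζ.continuous_fderiv (by simp)).clm_apply continuous_const
  have i1 : Integrable fun x => u x * (ζ x * fderiv ℝ φ x v) := by
    have := hu.integrable_smul_left_of_hasCompactSupport (hζ.continuous.mul c1)
      (hφc.fderiv_apply (𝕜 := ℝ) v).mul_left
    simpa [mul_comm] using this
  have i2 : Integrable fun x => u x * (φ x * fderiv ℝ ζ x v) := by
    have := hu.integrable_smul_left_of_hasCompactSupport (hφ.continuous.mul c2) hφc.mul_right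
    simpa [mul_comm] using this
  have i3 : Integrable fun x => ⟪g x, v⟫_ℝ * (ζ x * φ x) :=
    integrable_inner_mul hg (hζ.mul hφ) hφc.mul_left v
  simp only [hd, mul_add] at h1
  rw [integral_add i1 i2] at h1
  have e1 : ∫ x, ζ x * u x * fderiv ℝ φ x v = ∫ x, u x * (ζ x * fderiv ℝ φ x v) := by
    congr 1; ext x; ring
  have e2 : ∫ x, ⟪ζ x • g x + u x • gradient ζ x, v⟫_ℝ * φ x =
      (∫ x, ⟪g x, v⟫_ℝ * (ζ x * φ x)) + ∫ x, u x * (φ x * fderiv ℝ ζ x v) := by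
    rw [← integral_add i3 i2]
    congr 1; ext x
    rw [inner_add_left, real_inner_smul_left, real_inner_smul_left, inner_gradient_left]
    ring
  rw [e1, e2]
  linarith

namespace PenalizedProblem

variable {N : ℕ} {D : PenalizedProblem N} {ε : ℝ}

lemma integrable_energy (u : D.X ε) :
    Integrable fun x => ‖grad u x‖ ^ 2 + (D.V (ε • x) + 1) * (u x) ^ 2 :=
  (integrable_grad_sq u).add (integrable_weight u)

lemma norm_gradient_eq {ζ : EuclideanSpace ℝ (Fin N) → ℝ} (x : EuclideanSpace ℝ (Fin N)) :
    ‖gradient ζ x‖ = ‖fderiv ℝ ζ x‖ := LinearIsometryEquiv.norm_map _ _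

/-- Multiplication by smooth functions with bounded gradient maps `X_ε` to itself. -/
lemma exists_cutoff_mul (u : D.X ε) {ζ : EuclideanSpace ℝ (Fin N) → ℝ} (hζ : ContDiff ℝ ∞ ζ)
    (h01 : ∀ x, 0 ≤ ζ x ∧ ζ x ≤ 1) {A : ℝ} (hA : ∀ x, ‖fderiv ℝ ζ x‖ ≤ A) :
    ∃ w : D.X ε, w =ᵐ[volume] (fun x => ζ x * u x) ∧
      grad w =ᵐ[volume] (fun x => ζ x • grad u x + u x • gradient ζ x) ∧
      ‖w‖ ≤ (2 + 2 * A ^ 2 / D.wt) * ‖u‖ := by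
  have hA0 : 0 ≤ A := (norm_nonneg _).trans (hA 0)
  have hζc := hζ.continuous
  have hgc : Continuous (gradient ζ) :=
    (InnerProductSpace.toDual ℝ _).symm.continuous.comp (hζ.continuous_fderiv (by simp))
  have habs : ∀ x, |ζ x| ≤ 1 := fun x => by rw [abs_of_nonneg (h01 x).1]; exact (h01 x).2
  have hgb : ∀ x, ‖gradient ζ x‖ ≤ A := fun x => (norm_gradient_eq x).le.trans (hA x)
  have m1 : MemLp (fun x => ζ x * u x) 2 volume := by
    refine (Lp.memLp (toL2 u)).mono (hζc.aestronglyMeasurable.mul (aestronglyMeasurable_coe u))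
      (ae_of_all _ fun x => ?_)
    rw [norm_mul]
    exact mul_le_of_le_one_left (norm_nonneg _) (habs x)
  have m2 : MemLp (fun x => ζ x • grad u x + u x • gradient ζ x) 2 volume := by
    refine MemLp.add ?_ ?_
    · refine (Lp.memLp (grad u)).mono (hζc.aestronglyMeasurable.smul
        (Lp.aestronglyMeasurable _)) (ae_of_all _ fun x => ?_)
      rw [norm_smul]
      exact mul_le_of_le_one_left (norm_nonneg _) (habs x)
    · refine (Lp.memLp (toL2 u)).of_le_mul (c := A) ((aestronglyMeasurable_coe u).smul
        hgc.aestronglyMeasurable) (ae_of_all _ fun x => ?_)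
      rw [norm_smul, mul_comm]
      exact mul_le_mul_of_nonneg_right (hgb x) (norm_nonneg _)
  have hw : HasWeakGradient (m1.toLp _) (m2.toLp _) :=
    ((hasWeakGradient_grad u).smooth_mul (memOrlicz u).1 (locallyIntegrable_grad _) hζ).congr
      m1.coeFn_toLp.symm m2.coeFn_toLp.symm
  have hV : Integrable fun x => D.V (ε • x) * (m1.toLp _ x) ^ 2 := by
    refine integrable_V_of_weighted ?_
    refine (integrable_weight u).mono' (((continuous_V_smul D ε).add
      continuous_const).aestronglyMeasurable.mul ((Lp.aestronglyMeasurable _).pow 2)) ?_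
    filter_upwards [m1.coeFn_toLp] with x hx
    have hpos := (V_add_one_pos D (ε • x)).le
    rw [hx, Real.norm_of_nonneg (by positivity), mul_pow]
    refine mul_le_mul_of_nonneg_left (mul_le_of_le_one_left (sq_nonneg _) ?_) hpos
    exact pow_le_one₀ (h01 x).1 (h01 x).2
  have hmod : ∀ l : ℝ, 0 < l → modular (F1 D.δ) (m1.toLp _) l ≤ modular (F1 D.δ) u l := by
    intro l hl
    rw [modular_congr m1.coeFn_toLp]
    refine lintegral_mono fun x => ENNReal.ofReal_le_ofReal (F1_mono D.δ_pos D.δ_small ?_)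
    rw [abs_div, abs_div, abs_abs, abs_abs, abs_mul]
    gcongr
    exact mul_le_of_le_one_left (abs_nonneg _) (habs x)
  have hO : MemOrlicz (F1 D.δ) (m1.toLp _) := by
    obtain ⟨l, hl, hl'⟩ := (memOrlicz u).2
    exact ⟨(Lp.memLp (m1.toLp _)).locallyIntegrable (by norm_num), l, hl, (hmod l hl).trans_lt hl'⟩
  set w : D.X ε := mkX (m1.toLp _) (m2.toLp _) hw hV hO with hwdef
  have ew : w =ᵐ[volume] (fun x => ζ x * u x) := m1.coeFn_toLp
  have eg : grad w =ᵐ[volume] (fun x => ζ x • grad u x + u x • gradient ζ x) := by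
    rw [grad_eq_of_hasWeakGradient (u := w) hw]
    exact m2.coeFn_toLp
  refine ⟨w, ew, eg, ?_⟩
  have hwt := D.wt_pos
  set K : ℝ := 2 + 2 * A ^ 2 / D.wt with hK
  have hK1 : 1 ≤ K := by
    have : 0 ≤ 2 * A ^ 2 / D.wt := by positivity
    linarith
  have hH : D.normH ε w ≤ K * D.normH ε u := by
    refine abs_le_of_sq_le_sq' ?_ (mul_nonneg (by linarith) (normH_nonneg u)) |>.2
    have h1 : D.normH ε w ^ 2 ≤ K * D.normH ε u ^ 2 := by
      have e1 : D.normH ε w ^ 2 ≤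
          ∫ x, (2 * (‖grad u x‖ ^ 2 + (D.V (ε • x) + 1) * (u x) ^ 2) + 2 * A ^ 2 * (u x) ^ 2) := by
        rw [normH_sq]
        refine integral_mono_ae (integrable_energy w)
          (((integrable_energy u).const_mul 2).add
            ((integrable_sq u).const_mul _)) ?_
        filter_upwards [ew, eg] with x hx hxg
        have hpos := (V_add_one_pos D (ε • x)).le
        have b1 : ‖grad w x‖ ^ 2 ≤ 2 * ‖grad u x‖ ^ 2 + 2 * A ^ 2 * (u x) ^ 2 := by
          rw [hxg]
          have n1 : ‖ζ x • grad u x + u x • gradient ζ x‖ ≤ ‖grad u x‖ + A * |u x| := by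
            refine (norm_add_le _ _).trans (add_le_add ?_ ?_)
            · rw [norm_smul]; exact mul_le_of_le_one_left (norm_nonneg _) (habs x)
            · rw [norm_smul, mul_comm]
              exact mul_le_mul_of_nonneg_right (hgb x) (norm_nonneg _)
          calc ‖ζ x • grad u x + u x • gradient ζ x‖ ^ 2 ≤ (‖grad u x‖ + A * |u x|) ^ 2 := by gcongr
            _ ≤ _ := by
              rw [← sq_abs (u x)]
              nlinarith [sq_nonneg (‖grad u x‖ - A * |u x|)]
        have b2 : (w x) ^ 2 ≤ (u x) ^ 2 := by
          rw [hx, mul_pow]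
          exact mul_le_of_le_one_left (sq_nonneg _) (pow_le_one₀ (h01 x).1 (h01 x).2)
        have b3 := mul_le_mul_of_nonneg_left b2 hpos
        have b4 : 0 ≤ (D.V (ε • x) + 1) * (u x) ^ 2 := by positivity
        linarith
      rw [integral_add ((integrable_energy u).const_mul 2)
        ((integrable_sq u).const_mul _), integral_const_mul, integral_const_mul, ← normH_sq] at e1
      have e2 := wt_mul_integral_sq_le u
      have e3 : ∫ x, (u x) ^ 2 ≤ D.normH ε u ^ 2 / D.wt := by
        rw [le_div_iff₀ hwt]; linarith
      calc D.normH ε w ^ 2 ≤ _ := e1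
        _ ≤ 2 * D.normH ε u ^ 2 + 2 * A ^ 2 * (D.normH ε u ^ 2 / D.wt) := by gcongr
        _ = _ := by rw [hK]; ring
    rw [mul_pow]
    refine h1.trans ?_
    gcongr
    nlinarith
  have hL : luxemburgNorm (F1 D.δ) w ≤ luxemburgNorm (F1 D.δ) u := by
    refine csInf_le_csInf ⟨0, fun _ hl => hl.1.le⟩
      ((memOrlicz u).exists_le_one (convexOn_F1 D.δ_pos D.δ_small) (F1_zero D.δ_pos)) ?_
    exact fun l hl => ⟨hl.1, (hmod l hl.1).trans hl.2⟩
  rw [norm_def, norm_def, mul_add]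
  refine add_le_add hH (hL.trans ?_)
  exact le_mul_of_one_le_left luxemburgNorm_nonneg hK1

lemma inner_embedL (u v : D.X ε) : ⟪embedL D ε u, embedL D ε v⟫_ℝ =
    (∫ x, ⟪grad u x, grad v x⟫_ℝ) + ∫ x, (D.V (ε • x) + 1) * (u x * v x) := by
  rw [embedL_apply, embedL_apply, WithLp.prod_inner_apply, L2.inner_def, L2.inner_def]
  congr 1
  refine integral_congr_ae ?_
  filter_upwards [(memLp_weighted u).coeFn_toLp, (memLp_weighted v).coeFn_toLp] with x hx hy
  change ⟪(memLp_weighted u).toLp _ x, (memLp_weighted v).toLp _ x⟫_ℝ = _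
  rw [hx, hy]
  have := Real.mul_self_sqrt (V_add_one_pos D (ε • x)).le
  simp only [RCLike.inner_apply, conj_trivial]
  linear_combination (u x * v x) * this

end PenalizedProblem

/-! ### The Palais–Smale condition -/

namespace PenalizedProblem

variable {N : ℕ} {D : PenalizedProblem N} {ε : ℝ}

lemma exists_norm_le_of_chi_ne_zero (D : PenalizedProblem N) (hε : 0 < ε) :
    ∃ r : ℝ, ∀ x, D.chi ε x ≠ 0 → ‖x‖ ≤ r := by
  obtain ⟨r, hr⟩ := D.isBounded_Λ.subset_closedBall 0
  refine ⟨r / ε, fun x hx => ?_⟩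
  have h1 : ε • x ∈ D.Λ := by
    by_contra h
    exact hx (by simp [chi, h])
  have h2 := mem_closedBall_zero_iff.1 (hr h1)
  rw [norm_smul, Real.norm_of_nonneg hε.le] at h2
  rw [le_div_iff₀ hε]
  linarith

/-- Testing `J_ε'(u)` with a cutoff of `u` that vanishes on `Λ_ε` controls `u` where the cutoff is
`1`, because outside `Λ_ε` the nonlinearity is absorbed by the quadratic part. -/
lemma integral_cutoff_le (hN : 1 ≤ N) (u : D.X ε) {ζ : EuclideanSpace ℝ (Fin N) → ℝ}
    (hζ : ContDiff ℝ ∞ ζ) (h01 : ∀ x, 0 ≤ ζ x ∧ ζ x ≤ 1) {A : ℝ} (hA : ∀ x, ‖fderiv ℝ ζ x‖ ≤ A)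
    (hζΛ : ∀ x, D.chi ε x ≠ 0 → ζ x = 0) :
    ∫ x, ζ x * (1 / 2 * D.wt * (u x) ^ 2 + F1 D.δ (u x)) ≤
      ‖fderiv ℝ (D.J ε) u‖ * ((2 + 2 * A ^ 2 / D.wt) * ‖u‖) + A * (1 / D.wt + 1) * ‖u‖ ^ 2 := by
  have hA0 : 0 ≤ A := (norm_nonneg _).trans (hA 0)
  have hwt := D.wt_pos
  obtain ⟨w, hw, hgw, hwn⟩ := exists_cutoff_mul u hζ h01 hA
  have i0 : Integrable fun x => ζ x * (1 / 2 * D.wt * (u x) ^ 2 + F1 D.δ (u x)) := by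
    refine (((integrable_sq u).const_mul _).add (integrable_F1 hN u)).bdd_mul (c := 1)
      hζ.continuous.aestronglyMeasurable (ae_of_all _ fun x => ?_)
    rw [Real.norm_of_nonneg (h01 x).1]
    exact (h01 x).2
  have i1 : Integrable fun x => ⟪grad u x, grad w x⟫_ℝ := L2.integrable_inner _ _
  have i2 : Integrable fun x => (D.V (ε • x) + 1) * (u x * w x) := by
    refine (integrable_weight u).mono' (((continuous_V_smul D ε).add
      continuous_const).aestronglyMeasurable.mul
        ((aestronglyMeasurable_coe u).mul (aestronglyMeasurable_coe w))) ?_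
    filter_upwards [hw] with x hx
    have hpos := (V_add_one_pos D (ε • x)).le
    have e : u x * w x = ζ x * (u x) ^ 2 := by rw [hx]; ring
    rw [e, Real.norm_of_nonneg (mul_nonneg hpos (mul_nonneg (h01 x).1 (sq_nonneg _)))]
    exact mul_le_mul_of_nonneg_left (mul_le_of_le_one_left (sq_nonneg _) (h01 x).2) hpos
  have i3 := (admissible_F1 hN D).integrable_deriv hN isWeight_one u w
  have i4 := (admissible_F2 hN D).integrable_deriv hN (D.isWeight_chi ε) u w
  have i5 := (admissible_Gt hN D).integrable_deriv hN (D.isWeight_one_sub_chi ε) u w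
  have i6 : Integrable fun x => A * ((u x) ^ 2 + ‖grad u x‖ ^ 2) :=
    ((integrable_sq u).add (integrable_grad_sq u)).const_mul A
  have k1 : Integrable fun x => ⟪grad u x, grad w x⟫_ℝ + (D.V (ε • x) + 1) * (u x * w x) :=
    i1.add i2
  have k2 : Integrable fun x => ⟪grad u x, grad w x⟫_ℝ + (D.V (ε • x) + 1) * (u x * w x) +
    1 * dF1 D.δ (u x) * w x := k1.add i3
  have k3 : Integrable fun x => ⟪grad u x, grad w x⟫_ℝ + (D.V (ε • x) + 1) * (u x * w x) +
    1 * dF1 D.δ (u x) * w x - D.chi ε x * dF2 D.δ (u x) * w x := k2.sub i4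
  have hJ : fderiv ℝ (D.J ε) u w = ∫ x, (⟪grad u x, grad w x⟫_ℝ +
      (D.V (ε • x) + 1) * (u x * w x) + 1 * dF1 D.δ (u x) * w x -
      D.chi ε x * dF2 D.δ (u x) * w x - (1 - D.chi ε x) * D.gt (u x) * w x) := by
    rw [fderiv_J_apply hN, inner_embedL, integral_sub k3 i5, integral_sub k2 i4,
      integral_add k1 i3, integral_add i1 i2]
  have hmono : ∫ x, (ζ x * (1 / 2 * D.wt * (u x) ^ 2 + F1 D.δ (u x)) -
      A * ((u x) ^ 2 + ‖grad u x‖ ^ 2)) ≤ fderiv ℝ (D.J ε) u w := by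
    rw [hJ]
    refine integral_mono_ae (i0.sub i6) (k3.sub i5) ?_
    filter_upwards [hw, hgw] with x hx hgx
    have hz := (h01 x).1
    have b1 : -(A * ((u x) ^ 2 + ‖grad u x‖ ^ 2)) ≤ ⟪grad u x, grad w x⟫_ℝ := by
      rw [hgx, inner_add_right, real_inner_smul_right, real_inner_smul_right,
        real_inner_self_eq_norm_sq]
      have c1 := abs_real_inner_le_norm (grad u x) (gradient ζ x)
      have c2 : ‖gradient ζ x‖ ≤ A := (norm_gradient_eq x).le.trans (hA x)
      have c3 : |u x * ⟪grad u x, gradient ζ x⟫_ℝ| ≤ |u x| * (‖grad u x‖ * A) := by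
        rw [abs_mul]
        gcongr
        exact c1.trans (by gcongr)
      have c4 : |u x| * (‖grad u x‖ * A) ≤ A * ((u x) ^ 2 + ‖grad u x‖ ^ 2) := by
        rw [← sq_abs (u x)]
        have : |u x| * ‖grad u x‖ ≤ |u x| ^ 2 + ‖grad u x‖ ^ 2 := by
          nlinarith [sq_nonneg (|u x| - ‖grad u x‖), sq_nonneg |u x|, sq_nonneg ‖grad u x‖]
        nlinarith
      have c5 : 0 ≤ ζ x * ‖grad u x‖ ^ 2 := by positivity
      have c6 := (abs_le.1 c3).1
      linarith
    have b2 : ζ x * (D.wt * (u x) ^ 2) ≤ (D.V (ε • x) + 1) * (u x * w x) := by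
      have e : (D.V (ε • x) + 1) * (u x * w x) = ζ x * ((D.V (ε • x) + 1) * (u x) ^ 2) := by
        rw [hx]; ring
      rw [e]
      exact mul_le_mul_of_nonneg_left (mul_le_mul_of_nonneg_right (D.wt_le _) (sq_nonneg _)) hz
    have b3 : ζ x * F1 D.δ (u x) ≤ 1 * dF1 D.δ (u x) * w x := by
      have e : 1 * dF1 D.δ (u x) * w x = ζ x * (dF1 D.δ (u x) * u x) := by rw [hx]; ring
      rw [e]
      exact mul_le_mul_of_nonneg_left (F1_le_dF1 D.δ_pos D.δ_small _) hz
    have b4 : D.chi ε x * dF2 D.δ (u x) * w x = 0 := by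
      by_cases hc : D.chi ε x = 0
      · rw [hc]; ring
      · rw [hx, hζΛ x hc]; ring
    have b5 : (1 - D.chi ε x) * D.gt (u x) * w x ≤ ζ x * (1 / 2 * D.wt * (u x) ^ 2) := by
      have e : (1 - D.chi ε x) * D.gt (u x) * w x =
          ζ x * ((1 - D.chi ε x) * (D.gt (u x) * u x)) := by rw [hx]; ring
      rw [e]
      refine mul_le_mul_of_nonneg_left ?_ hz
      have c1 := D.gt_mul_le (u x)
      have c2 := D.gt_mul_nonneg (u x)
      have c3 : 2 * D.b₀ ≤ D.wt := D.b₀_small.le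
      have c4 : D.b₀ * (u x) ^ 2 ≤ 1 / 2 * D.wt * (u x) ^ 2 := by
        refine mul_le_mul_of_nonneg_right (by linarith) (sq_nonneg _)
      have c5 : (1 - D.chi ε x) * (D.gt (u x) * u x) ≤ D.gt (u x) * u x :=
        mul_le_of_le_one_left c2 (by linarith [D.chi_nonneg ε x])
      linarith
    rw [b4]
    linarith
  rw [integral_sub i0 i6, integral_const_mul, integral_add (integrable_sq u)
    (integrable_grad_sq u)] at hmono
  have e1 : fderiv ℝ (D.J ε) u w ≤ ‖fderiv ℝ (D.J ε) u‖ * ((2 + 2 * A ^ 2 / D.wt) * ‖u‖) :=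
    (le_abs_self _).trans (((fderiv ℝ (D.J ε) u).le_opNorm w).trans
      (mul_le_mul_of_nonneg_left hwn (norm_nonneg _)))
  have hn : D.normH ε u ^ 2 ≤ ‖u‖ ^ 2 := by
    have := normH_nonneg u
    gcongr
    exact normH_le_norm u
  have e2 : ∫ x, (u x) ^ 2 ≤ 1 / D.wt * ‖u‖ ^ 2 := by
    have := wt_mul_integral_sq_le u
    rw [one_div, le_inv_mul_iff₀ hwt]
    linarith
  have e3 : ∫ x, ‖grad u x‖ ^ 2 ≤ ‖u‖ ^ 2 := by
    rw [← L2_norm_sq]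
    refine le_trans ?_ hn
    gcongr
    exact norm_grad_le u
  have e4 : A * ((∫ x, (u x) ^ 2) + ∫ x, ‖grad u x‖ ^ 2) ≤ A * (1 / D.wt + 1) * ‖u‖ ^ 2 := by
    rw [mul_assoc]
    refine mul_le_mul_of_nonneg_left ?_ hA0
    linarith
  linarith

lemma integrable_sq_add_F1 (hN : 1 ≤ N) (u : D.X ε) :
    Integrable fun x => (u x) ^ 2 + F1 D.δ (u x) :=
  (integrable_sq u).add (integrable_F1 hN u)

lemma sq_add_F1_nonneg (D : PenalizedProblem N) (s : ℝ) : 0 ≤ s ^ 2 + F1 D.δ s :=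
  add_nonneg (sq_nonneg _) (F1_nonneg' D.δ_pos D.δ_small _)

/-- Bounded sequences along which `J_ε'` tends to `0` lose no mass at infinity. -/
lemma exists_tail_le (hN : 1 ≤ N) (hε : 0 < ε) {M : ℝ} {z : ℕ → D.X ε} (hz : ∀ n, ‖z n‖ ≤ M)
    (hJ : Tendsto (fun n => ‖fderiv ℝ (D.J ε) (z n)‖) atTop (𝓝 0)) {η : ℝ} (hη : 0 < η) :
    ∃ R : ℝ, ∀ᶠ n in atTop,
      ∫ x in (Metric.ball 0 R)ᶜ, ((z n x) ^ 2 + F1 D.δ (z n x)) ≤ η := by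
  have hM : 0 ≤ M := (norm_nonneg _).trans (hz 0)
  have hwt := D.wt_pos
  obtain ⟨r, hr⟩ := exists_norm_le_of_chi_ne_zero D hε
  obtain ⟨A, hA, hcut⟩ := exists_cutoff N
  set C : ℝ := 2 / D.wt + 1 with hC
  have hC0 : 0 < C := by positivity
  have hlim : Tendsto (fun R : ℝ => A / R) atTop (𝓝 0) := tendsto_const_nhds.div_atTop tendsto_id
  have hlim2 : Tendsto (fun R : ℝ => C * (A / R * (1 / D.wt + 1) * M ^ 2)) atTop (𝓝 0) := by
    simpa using ((hlim.mul_const (1 / D.wt + 1)).mul_const (M ^ 2)).const_mul C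
  obtain ⟨R, ⟨⟨h1, h2⟩, h3⟩, h4⟩ := (((hlim.eventually (Iic_mem_nhds one_pos)).and
    (hlim2.eventually (Iic_mem_nhds (half_pos hη)))).and (eventually_ge_atTop r)).and
    (eventually_gt_atTop 0) |>.exists
  obtain ⟨ζ, hζ, h01, hζ0, hζ1, hζd⟩ := hcut R h4
  have hJ2 : Tendsto (fun n => C * (‖fderiv ℝ (D.J ε) (z n)‖ * ((2 + 2 / D.wt) * M))) atTop
      (𝓝 0) := by
    simpa using (hJ.mul_const ((2 + 2 / D.wt) * M)).const_mul C
  refine ⟨2 * R, ?_⟩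
  filter_upwards [hJ2.eventually (Iic_mem_nhds (half_pos hη))] with n hn
  have h5 := integral_cutoff_le hN (z n) hζ h01 hζd fun x hx => hζ0 x ((hr x hx).trans h3)
  have hi : Integrable fun x => ζ x * (1 / 2 * D.wt * (z n x) ^ 2 + F1 D.δ (z n x)) := by
    refine (((integrable_sq (z n)).const_mul _).add (integrable_F1 hN (z n))).bdd_mul (c := 1)
      hζ.continuous.aestronglyMeasurable (ae_of_all _ fun x => ?_)
    rw [Real.norm_of_nonneg (h01 x).1]
    exact (h01 x).2
  have h6 : ∫ x in (Metric.ball 0 (2 * R))ᶜ, ((z n x) ^ 2 + F1 D.δ (z n x)) ≤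
      C * ∫ x, ζ x * (1 / 2 * D.wt * (z n x) ^ 2 + F1 D.δ (z n x)) := by
    rw [← integral_indicator Metric.isOpen_ball.measurableSet.compl, ← integral_const_mul]
    refine integral_mono ((integrable_sq_add_F1 hN (z n)).indicator
      Metric.isOpen_ball.measurableSet.compl) (hi.const_mul C) fun x => ?_
    have hF := F1_nonneg' D.δ_pos D.δ_small (z n x)
    have hs := sq_nonneg (z n x)
    by_cases hx : x ∈ (Metric.ball (0 : EuclideanSpace ℝ (Fin N)) (2 * R))ᶜ
    · have hx2 : 2 * R ≤ ‖x‖ := by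
        rw [mem_compl_iff, mem_ball_zero_iff, not_lt] at hx
        exact hx
      simp only [indicator_of_mem hx, hζ1 x hx2, one_mul]
      have e : C * (1 / 2 * D.wt * (z n x) ^ 2 + F1 D.δ (z n x)) = (z n x) ^ 2 + F1 D.δ (z n x) +
          (1 / 2 * D.wt * (z n x) ^ 2 + 2 / D.wt * F1 D.δ (z n x)) := by
        rw [hC]; field_simp; ring
      rw [e]
      have : 0 ≤ 1 / 2 * D.wt * (z n x) ^ 2 + 2 / D.wt * F1 D.δ (z n x) := by positivity
      linarith
    · simp only [indicator_of_notMem hx]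
      have := (h01 x).1
      positivity
  have h7 : ‖fderiv ℝ (D.J ε) (z n)‖ * ((2 + 2 * (A / R) ^ 2 / D.wt) * ‖z n‖) ≤
      ‖fderiv ℝ (D.J ε) (z n)‖ * ((2 + 2 / D.wt) * M) := by
    have e : (A / R) ^ 2 ≤ 1 := pow_le_one₀ (by positivity) h1
    gcongr
    · linarith
    · exact hz n
  have h8 : A / R * (1 / D.wt + 1) * ‖z n‖ ^ 2 ≤ A / R * (1 / D.wt + 1) * M ^ 2 := by
    have := hz n
    gcongr
  calc _ ≤ _ := h6
    _ ≤ C * (‖fderiv ℝ (D.J ε) (z n)‖ * ((2 + 2 / D.wt) * M) +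
        A / R * (1 / D.wt + 1) * M ^ 2) := by
      refine mul_le_mul_of_nonneg_left ?_ hC0.le
      linarith
    _ ≤ η := by rw [mul_add]; linarith

lemma tendsto_prod_fst : Tendsto Prod.fst (atTop : Filter (ℕ × ℕ)) atTop := by
  rw [← prod_atTop_atTop_eq]; exact tendsto_fst

lemma tendsto_prod_snd : Tendsto Prod.snd (atTop : Filter (ℕ × ℕ)) atTop := by
  rw [← prod_atTop_atTop_eq]; exact tendsto_snd

/-- Local compactness: bounded sequences of `X_ε` that converge weakly in `L²` are Cauchy in `L²`
on balls. -/
lemma tendsto_integral_ball_sub {M : ℝ} {z : ℕ → D.X ε} (hz : ∀ n, ‖z n‖ ≤ M)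
    {W : Lp ℝ 2 (volume : Measure (EuclideanSpace ℝ (Fin N)))}
    (hW : ∀ f, Tendsto (fun n => ⟪f, toL2 (z n)⟫_ℝ) atTop (𝓝 ⟪f, W⟫_ℝ)) (R : ℝ) :
    Tendsto (fun p : ℕ × ℕ => ∫ x in Metric.ball 0 R, ((z p.1 - z p.2 : D.X ε) x) ^ 2) atTop
      (𝓝 0) := by
  have hM : 0 ≤ M := (norm_nonneg _).trans (hz 0)
  have hE := D.embC_pos
  have hH : ∀ p : ℕ × ℕ, D.normH ε (z p.1 - z p.2) ≤ 2 * M := fun p =>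
    (normH_le_norm _).trans ((norm_sub_le _ _).trans (by linarith [hz p.1, hz p.2]))
  have h := tendsto_lintegral_ball (l := (atTop : Filter (ℕ × ℕ))) (M := (1 + D.embC) * (2 * M))
    (fun p => toL2 (z p.1 - z p.2)) (fun p => grad (z p.1 - z p.2))
    (fun p => hasWeakGradient_grad _)
    (fun p => (norm_toL2_le _).trans (by
      have := normH_nonneg (z p.1 - z p.2)
      have := hH p
      gcongr
      linarith))
    (fun p => (norm_grad_le _).trans ((hH p).trans (by nlinarith)))
    (fun f => by
      have h1 := ((hW f).comp tendsto_prod_fst).sub ((hW f).comp tendsto_prod_snd)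
      rw [sub_self] at h1
      refine h1.congr fun p => ?_
      change ⟪f, toL2 (z p.1)⟫_ℝ - ⟪f, toL2 (z p.2)⟫_ℝ = ⟪f, toL2 (z p.1) - toL2 (z p.2)⟫_ℝ
      rw [inner_sub_right]) R
  have h2 := (ENNReal.tendsto_toReal ENNReal.zero_ne_top).comp h
  rw [ENNReal.toReal_zero] at h2
  refine h2.congr fun p => ?_
  rw [integral_eq_lintegral_of_nonneg_ae (ae_of_all _ fun x => sq_nonneg _)
    ((aestronglyMeasurable_coe _).pow 2).restrict]
  simp only [Function.comp_apply]
  congr 1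
  refine lintegral_congr fun x => ?_
  rw [← ofReal_norm, ← ENNReal.ofReal_pow (norm_nonneg _), Real.norm_eq_abs, sq_abs]

/-- The differences tend to `0` in `L²` and in the modular of `F₁`. -/
lemma tendsto_integral_sub (hN : 1 ≤ N) (hε : 0 < ε) {M : ℝ} {z : ℕ → D.X ε}
    (hz : ∀ n, ‖z n‖ ≤ M) (hJ : Tendsto (fun n => ‖fderiv ℝ (D.J ε) (z n)‖) atTop (𝓝 0))
    {W : Lp ℝ 2 (volume : Measure (EuclideanSpace ℝ (Fin N)))}
    (hW : ∀ f, Tendsto (fun n => ⟪f, toL2 (z n)⟫_ℝ) atTop (𝓝 ⟪f, W⟫_ℝ)) :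
    Tendsto (fun p : ℕ × ℕ => ∫ x, (((z p.1 - z p.2 : D.X ε) x) ^ 2 +
      F1 D.δ ((z p.1 - z p.2 : D.X ε) x))) atTop (𝓝 0) := by
  rw [Metric.tendsto_nhds]
  intro η hη
  obtain ⟨R, hR⟩ := exists_tail_le hN hε hz hJ (show 0 < η / 32 by positivity)
  set B := Metric.ball (0 : EuclideanSpace ℝ (Fin N)) R with hB
  have hBm : MeasurableSet B := Metric.isOpen_ball.measurableSet
  set b : ℝ := (volume B).toReal with hb
  -- outside `B` both terms are small by tightness; on `B`, `F₁` is bounded by a small constant plus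
  -- a multiple of the square, and local compactness applies
  obtain ⟨C, hC, hF⟩ := F1_le_add_sq D.δ_pos D.δ_small
    (show 0 < η / (4 * (b + 1)) by positivity)
  have h1 : Tendsto (fun p : ℕ × ℕ => (C + 1) *
      ∫ x in B, ((z p.1 - z p.2 : D.X ε) x) ^ 2) atTop (𝓝 0) := by
    simpa using (tendsto_integral_ball_sub hz hW R).const_mul (C + 1)
  filter_upwards [h1.eventually (Iic_mem_nhds (show 0 < η / 4 by positivity)),
    tendsto_prod_fst.eventually hR, tendsto_prod_snd.eventually hR] with p hp1 hp2 hp3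
  have hi := integrable_sq_add_F1 hN (z p.1 - z p.2)
  have h0 : 0 ≤ ∫ x, (((z p.1 - z p.2 : D.X ε) x) ^ 2 + F1 D.δ ((z p.1 - z p.2 : D.X ε) x)) :=
    integral_nonneg fun x => D.sq_add_F1_nonneg _
  rw [Real.dist_0_eq_abs, abs_of_nonneg h0, ← integral_add_compl hBm hi]
  have hBfin : volume B ≠ ⊤ := measure_ball_lt_top.ne
  have e1 : ∫ x in B, (((z p.1 - z p.2 : D.X ε) x) ^ 2 + F1 D.δ ((z p.1 - z p.2 : D.X ε) x)) ≤
      η / 4 + η / 4 := by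
    have hc : IntegrableOn (fun _ : EuclideanSpace ℝ (Fin N) => η / (4 * (b + 1))) B :=
      integrableOn_const hBfin
    calc _ ≤ ∫ x in B, (η / (4 * (b + 1)) + (C + 1) * ((z p.1 - z p.2 : D.X ε) x) ^ 2) := by
          refine integral_mono hi.integrableOn
            (hc.add ((integrable_sq _).const_mul _).integrableOn) fun x => ?_
          have := hF ((z p.1 - z p.2 : D.X ε) x)
          simp only
          linarith
      _ = b * (η / (4 * (b + 1))) + (C + 1) * ∫ x in B, ((z p.1 - z p.2 : D.X ε) x) ^ 2 := by
          rw [integral_add hc ((integrable_sq _).const_mul _).integrableOn, integral_const_mul,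
            setIntegral_const, smul_eq_mul]
          rfl
      _ ≤ η / 4 + η / 4 := by
          refine add_le_add ?_ hp1
          have hb0 : 0 ≤ b := ENNReal.toReal_nonneg
          rw [mul_div_assoc', div_le_iff₀ (by positivity)]
          nlinarith
  have e2 : ∫ x in Bᶜ, (((z p.1 - z p.2 : D.X ε) x) ^ 2 + F1 D.δ ((z p.1 - z p.2 : D.X ε) x)) ≤
      4 * (η / 32) + 4 * (η / 32) := by
    have j1 := (integrable_sq_add_F1 hN (z p.1)).integrableOn (s := Bᶜ)
    have j2 := (integrable_sq_add_F1 hN (z p.2)).integrableOn (s := Bᶜ)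
    calc _ ≤ ∫ x in Bᶜ, (4 * ((z p.1 x) ^ 2 + F1 D.δ (z p.1 x)) +
          4 * ((z p.2 x) ^ 2 + F1 D.δ (z p.2 x))) := by
          refine integral_mono_ae hi.integrableOn ((j1.const_mul 4).add (j2.const_mul 4)) ?_
          filter_upwards [ae_restrict_of_ae (coe_sub (z p.1) (z p.2))] with x hx
          rw [hx]
          have := F1_sub_le D.δ_pos D.δ_small (z p.1 x) (z p.2 x)
          nlinarith [sq_nonneg (z p.1 x + z p.2 x), sq_nonneg (z p.1 x), sq_nonneg (z p.2 x)]
      _ = 4 * (∫ x in Bᶜ, ((z p.1 x) ^ 2 + F1 D.δ (z p.1 x))) +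
          4 * ∫ x in Bᶜ, ((z p.2 x) ^ 2 + F1 D.δ (z p.2 x)) := by
          rw [integral_add (j1.const_mul 4) (j2.const_mul 4), integral_const_mul,
            integral_const_mul]
      _ ≤ _ := by gcongr
  linarith

lemma abs_integral_mul_le_of_sq {f : EuclideanSpace ℝ (Fin N) → ℝ} (hf : AEStronglyMeasurable f)
    {K : ℝ} (hi : Integrable fun x => f x ^ 2) (hK : ∫ x, f x ^ 2 ≤ K) (w : D.X ε) :
    |∫ x, f x * w x| ≤ Real.sqrt K * ‖toL2 w‖ := by
  have hm : MemLp f 2 volume := (memLp_two_iff_integrable_sq hf).2 hi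
  have h1 : ‖hm.toLp f‖ ≤ Real.sqrt K := by
    refine Real.le_sqrt_of_sq_le ?_
    rw [L2_norm_sq]
    refine (integral_congr_ae ?_).trans_le hK
    filter_upwards [hm.coeFn_toLp] with x hx
    rw [hx, Real.norm_eq_abs, sq_abs]
  have h2 := abs_real_inner_le_norm (hm.toLp f) (toL2 w)
  rw [L2.inner_def] at h2
  refine le_trans (le_of_eq ?_) (h2.trans (mul_le_mul_of_nonneg_right h1 (norm_nonneg _)))
  congr 1
  refine integral_congr_ae ?_
  filter_upwards [hm.coeFn_toLp] with x hx
  rw [hx]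
  simp [mul_comm]

/-- The lower order part of `J_ε'(u)` is bounded in `L²` for bounded `u`. -/
lemma exists_abs_integral_le_toL2 (hN : 1 ≤ N) (D : PenalizedProblem N) (ε M : ℝ) :
    ∃ B : ℝ, 0 ≤ B ∧ ∀ u : D.X ε, ‖u‖ ≤ M → ∀ w : D.X ε,
      |∫ x, D.chi ε x * dF2 D.δ (u x) * w x| +
        |∫ x, (1 - D.chi ε x) * D.gt (u x) * w x| ≤ B * ‖toL2 w‖ := by
  have hN0 : (0 : ℝ) < N := by exact_mod_cast hN
  obtain ⟨C, hC, hd⟩ := dF2_sq_le D.δ_pos (show 0 < 2 / (N : ℝ) by positivity)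
  obtain ⟨C₁, hC₁, hS⟩ := exists_integral_rpow_le hN D ε
  have hwt := D.wt_pos
  refine ⟨Real.sqrt (C * (C₁ * |M| ^ sobExp N)) + Real.sqrt (D.b₀ ^ 2 * (|M| ^ 2 / D.wt)),
    by positivity, fun u hu w => ?_⟩
  have hH : D.normH ε u ≤ |M| := (normH_le_norm u).trans (hu.trans (le_abs_self M))
  have hH0 := normH_nonneg u
  have wsq : ∀ {ρ : EuclideanSpace ℝ (Fin N) → ℝ}, IsWeight ρ → ∀ x a, (ρ x * a) ^ 2 ≤ a ^ 2 :=
    fun hρ x a => sq_le_sq.2 (hρ.norm_mul_le x a)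
  have m1 := ((admissible_F2 hN D).aemeasurable_deriv (D.isWeight_chi ε) u).aestronglyMeasurable
  have m2 := ((admissible_Gt hN D).aemeasurable_deriv
    (D.isWeight_one_sub_chi ε) u).aestronglyMeasurable
  have p1 : ∀ x, (D.chi ε x * dF2 D.δ (u x)) ^ 2 ≤ C * |u x| ^ sobExp N := fun x =>
    (wsq (D.isWeight_chi ε) x _).trans (hd _)
  have p2 : ∀ x, ((1 - D.chi ε x) * D.gt (u x)) ^ 2 ≤ D.b₀ ^ 2 * (u x) ^ 2 := fun x => by
    refine (wsq (D.isWeight_one_sub_chi ε) x _).trans ?_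
    rw [← mul_pow]
    refine sq_le_sq.2 ?_
    rw [abs_mul, abs_of_pos D.b₀_pos]
    exact D.abs_gt_le _
  have i1 : Integrable fun x => (D.chi ε x * dF2 D.δ (u x)) ^ 2 := by
    refine ((integrable_rpow hN u).const_mul C).mono' (m1.pow 2) (ae_of_all _ fun x => ?_)
    rw [Real.norm_of_nonneg (sq_nonneg _)]
    exact p1 x
  have i2 : Integrable fun x => ((1 - D.chi ε x) * D.gt (u x)) ^ 2 := by
    refine ((integrable_sq u).const_mul (D.b₀ ^ 2)).mono' (m2.pow 2) (ae_of_all _ fun x => ?_)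
    rw [Real.norm_of_nonneg (sq_nonneg _)]
    exact p2 x
  rw [add_mul]
  refine add_le_add (abs_integral_mul_le_of_sq m1 i1 ?_ w) (abs_integral_mul_le_of_sq m2 i2 ?_ w)
  · refine (integral_mono i1 ((integrable_rpow hN u).const_mul C) p1).trans ?_
    rw [integral_const_mul]
    refine mul_le_mul_of_nonneg_left ((hS u).trans ?_) hC
    have hp := two_lt_sobExp hN
    have : 0 ≤ sobExp N := by linarith
    gcongr
  · refine (integral_mono i2 ((integrable_sq u).const_mul _) p2).trans ?_
    rw [integral_const_mul]
    refine mul_le_mul_of_nonneg_left ?_ (sq_nonneg _)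
    rw [le_div_iff₀ hwt, mul_comm]
    refine (wt_mul_integral_sq_le u).trans ?_
    gcongr

/-- Monotonicity of `F₁'` turns smallness of `J_ε'` and of the difference in `L²` into smallness
of the difference in `H_ε`. -/
lemma exists_normH_sub_sq_le (hN : 1 ≤ N) (D : PenalizedProblem N) (ε M : ℝ) :
    ∃ B : ℝ, 0 ≤ B ∧ ∀ a b : D.X ε, ‖a‖ ≤ M → ‖b‖ ≤ M →
      D.normH ε (a - b) ^ 2 ≤
        (‖fderiv ℝ (D.J ε) a‖ + ‖fderiv ℝ (D.J ε) b‖) * (2 * M) + B * ‖toL2 (a - b)‖ := by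
  obtain ⟨B, hB, h⟩ := exists_abs_integral_le_toL2 hN D ε M
  refine ⟨2 * B, by positivity, fun a b ha hb => ?_⟩
  set w := a - b with hw
  have hwn : ‖w‖ ≤ 2 * M := (norm_sub_le a b).trans (by linarith)
  have e1 : fderiv ℝ (D.J ε) a w - fderiv ℝ (D.J ε) b w ≤
      (‖fderiv ℝ (D.J ε) a‖ + ‖fderiv ℝ (D.J ε) b‖) * (2 * M) := by
    have h1 := (le_abs_self _).trans ((fderiv ℝ (D.J ε) a).le_opNorm w)
    have h2 := (neg_le_abs _).trans ((fderiv ℝ (D.J ε) b).le_opNorm w)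
    have h3 := mul_le_mul_of_nonneg_left hwn (norm_nonneg (fderiv ℝ (D.J ε) a))
    have h4 := mul_le_mul_of_nonneg_left hwn (norm_nonneg (fderiv ℝ (D.J ε) b))
    linarith
  have e2 : D.normH ε w ^ 2 =
      ⟪embedL D ε a, embedL D ε w⟫_ℝ - ⟪embedL D ε b, embedL D ε w⟫_ℝ := by
    rw [normH_eq', ← real_inner_self_eq_norm_sq, ← inner_sub_left, ← map_sub]
  have e3 : ∫ x, 1 * dF1 D.δ (b x) * w x ≤ ∫ x, 1 * dF1 D.δ (a x) * w x := by
    refine integral_mono_ae ((admissible_F1 hN D).integrable_deriv hN isWeight_one b w)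
      ((admissible_F1 hN D).integrable_deriv hN isWeight_one a w) ?_
    filter_upwards [coe_sub a b] with x hx
    rw [hw, hx, one_mul, one_mul]
    rcases le_total (a x) (b x) with hab | hab
    · exact mul_le_mul_of_nonpos_right (monotone_dF1 D.δ_pos D.δ_small hab) (by linarith)
    · exact mul_le_mul_of_nonneg_right (monotone_dF1 D.δ_pos D.δ_small hab) (by linarith)
  rw [fderiv_J_apply hN, fderiv_J_apply hN] at e1
  have ha' := h a ha w
  have hb' := h b hb w
  have k1 := le_abs_self (∫ x, D.chi ε x * dF2 D.δ (a x) * w x)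
  have k2 := le_abs_self (∫ x, (1 - D.chi ε x) * D.gt (a x) * w x)
  have k3 := neg_le_abs (∫ x, D.chi ε x * dF2 D.δ (b x) * w x)
  have k4 := neg_le_abs (∫ x, (1 - D.chi ε x) * D.gt (b x) * w x)
  linarith

lemma cauchySeq_of_tendsto_inner (hN : 1 ≤ N) (hε : 0 < ε) {M : ℝ} {z : ℕ → D.X ε}
    (hz : ∀ n, ‖z n‖ ≤ M) (hJ : Tendsto (fun n => ‖fderiv ℝ (D.J ε) (z n)‖) atTop (𝓝 0))
    {W : Lp ℝ 2 (volume : Measure (EuclideanSpace ℝ (Fin N)))}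
    (hW : ∀ f, Tendsto (fun n => ⟪f, toL2 (z n)⟫_ℝ) atTop (𝓝 ⟪f, W⟫_ℝ)) : CauchySeq z := by
  have hT := tendsto_integral_sub hN hε hz hJ hW
  obtain ⟨B, hB, hH⟩ := exists_normH_sub_sq_le hN D ε M
  have hle : ∀ p : ℕ × ℕ, ‖toL2 (z p.1 - z p.2)‖ ^ 2 ≤
      ∫ x, (((z p.1 - z p.2 : D.X ε) x) ^ 2 + F1 D.δ ((z p.1 - z p.2 : D.X ε) x)) := by
    intro p
    rw [norm_toL2_sq]
    refine integral_mono (integrable_sq _) (integrable_sq_add_F1 hN _) fun x => ?_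
    have := F1_nonneg' D.δ_pos D.δ_small ((z p.1 - z p.2 : D.X ε) x)
    simp only
    linarith
  have hL2 : Tendsto (fun p : ℕ × ℕ => ‖toL2 (z p.1 - z p.2)‖) atTop (𝓝 0) := by
    have h1 : Tendsto (fun p : ℕ × ℕ => Real.sqrt (∫ x, (((z p.1 - z p.2 : D.X ε) x) ^ 2 +
        F1 D.δ ((z p.1 - z p.2 : D.X ε) x)))) atTop (𝓝 0) := by
      simpa using hT.sqrt
    exact squeeze_zero (fun p => norm_nonneg _) (fun p => Real.le_sqrt_of_sq_le (hle p)) h1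
  have hn : Tendsto (fun p : ℕ × ℕ => D.normH ε (z p.1 - z p.2)) atTop (𝓝 0) := by
    have h1 : Tendsto (fun p : ℕ × ℕ =>
        Real.sqrt ((‖fderiv ℝ (D.J ε) (z p.1)‖ + ‖fderiv ℝ (D.J ε) (z p.2)‖) * (2 * M) +
          B * ‖toL2 (z p.1 - z p.2)‖)) atTop (𝓝 0) := by
      have h2 := ((((hJ.comp tendsto_prod_fst).add (hJ.comp tendsto_prod_snd)).mul_const
        (2 * M)).add (hL2.const_mul B)).sqrt
      simpa using h2
    exact squeeze_zero (fun p => normH_nonneg _)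
      (fun p => Real.le_sqrt_of_sq_le (hH _ _ (hz _) (hz _))) h1
  have hl : Tendsto (fun p : ℕ × ℕ => luxemburgNorm (F1 D.δ) (z p.1 - z p.2 : D.X ε)) atTop
      (𝓝 0) := by
    rw [Metric.tendsto_nhds]
    intro η hη
    set l : ℝ := min (η / 2) 1 with hl
    have hl0 : 0 < l := lt_min (by positivity) one_pos
    have hlη : l < η := (min_le_left _ _).trans_lt (half_lt_self hη)
    filter_upwards [hT.eventually (Iic_mem_nhds (show 0 < l ^ 2 by positivity))] with p hp
    rw [Real.dist_0_eq_abs, abs_of_nonneg luxemburgNorm_nonneg]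
    refine (luxemburg_le_of_small hl0 (min_le_right _ _) ?_).trans_lt hlη
    rw [← ofReal_integral_eq_lintegral_ofReal (integrable_F1 hN _)
      (ae_of_all _ fun x => F1_nonneg' D.δ_pos D.δ_small _)]
    refine ENNReal.ofReal_le_ofReal (le_trans ?_ hp)
    refine integral_mono (integrable_F1 hN _) (integrable_sq_add_F1 hN _) fun x => ?_
    simp only
    linarith [sq_nonneg ((z p.1 - z p.2 : D.X ε) x)]
  rw [cauchySeq_iff_tendsto_dist_atTop_0]
  have := hn.add hl
  rw [add_zero] at this
  refine this.congr fun p => ?_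
  rw [dist_eq_norm, norm_def]

lemma palaisSmale (hN : 1 ≤ N) (hε : 0 < ε) {c : ℝ} {u : ℕ → D.X ε}
    (hu : D.IsConstrainedPS ε c u) :
    ∃ v ∈ D.nehari ε, ∃ k : ℕ → ℕ, StrictMono k ∧ Tendsto (u ∘ k) atTop (𝓝 v) := by
  obtain ⟨huN, huc, hu0⟩ := hu
  obtain ⟨K, hK⟩ := huc.bddAbove_range
  obtain ⟨M, hM⟩ := exists_norm_le_of_J_le hN D ε K
  have huM : ∀ n, ‖u n‖ ≤ M := fun n => hM _ (huN n) (hK ⟨n, rfl⟩)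
  obtain ⟨K', -, hK'⟩ := exists_norm_fderiv_J_le hN D ε M
  have hJ : Tendsto (fun n => ‖fderiv ℝ (D.J ε) (u n)‖) atTop (𝓝 0) :=
    squeeze_zero (fun n => norm_nonneg _) (fun n => hK' _ (huN n) (huM n))
      (by simpa using hu0.const_mul K')
  have hL2 : ∀ n, ‖toL2 (u n)‖ ≤ D.embC * M := fun n =>
    (norm_toL2_le _).trans (mul_le_mul_of_nonneg_left ((normH_le_norm _).trans (huM n))
      D.embC_pos.le)
  obtain ⟨k, W, hk, hW⟩ := exists_subseq_tendsto_inner hL2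
  obtain ⟨v, hv⟩ := cauchySeq_tendsto_of_complete
    (cauchySeq_of_tendsto_inner hN hε (z := u ∘ k) (fun n => huM _)
      (hJ.comp hk.tendsto_atTop) hW)
  refine ⟨v, (mem_nehari_iff hN v).2 ⟨?_, ?_⟩, k, hk, hv⟩
  · obtain ⟨r, hr, hrN⟩ := exists_pos_le_normH hN D ε
    rintro rfl
    have h1 := (((embedL D ε).continuous.tendsto 0).comp hv).norm
    rw [map_zero, norm_zero] at h1
    refine hr.not_ge (ge_of_tendsto' h1 fun n => ?_)
    simp only [Function.comp_apply]
    rw [← normH_eq']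
    exact hrN _ (huN _)
  · have h1 := ((contDiff_Psi hN D ε).continuous.tendsto v).comp hv
    refine tendsto_nhds_unique h1 ?_
    have h2 : D.Ψ ε ∘ u ∘ k = fun _ => 0 :=
      funext fun n => ((mem_nehari_iff hN _).1 (huN (k n))).2
    rw [h2]
    exact tendsto_const_nhds

end PenalizedProblem

end LogNehari

end

theorem mainTheorem9 {N : ℕ} (hN : 1 ≤ N) (D : LogNehari.PenalizedProblem N) (ε : ℝ)
    (hε : 0 < ε) :
    (ContDiff ℝ 1 (D.J ε) ∧ ContDiff ℝ 1 (D.Ψ ε)) ∧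
    (∀ u ∈ D.nehari ε, fderiv ℝ (D.Ψ ε) u u ≠ 0) ∧
    LogNehari.IsC1Hypersurface (D.nehari ε) ∧
    (∀ u : D.X ε, D.IsConstrainedCritical ε u → fderiv ℝ (D.J ε) u = 0) ∧
    (∀ (c : ℝ) (u : ℕ → D.X ε), D.IsConstrainedPS ε c u →
      ∃ v ∈ D.nehari ε, ∃ k : ℕ → ℕ, StrictMono k ∧ Tendsto (u ∘ k) atTop (𝓝 v)) := by
  open LogNehari.PenalizedProblem in
  exact ⟨⟨contDiff_J hN D ε, contDiff_Psi hN D ε⟩, fun u hu => (fderiv_Psi_self_neg hN hu).ne,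
    isC1Hypersurface_nehari hN D ε, fun u hu => fderiv_J_eq_zero_of_isConstrainedCritical hN hu,
    fun c u hu => palaisSmale hN hε hu⟩
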